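/- Let $\epsilon$ be a primitive third root of unity, and let $\Phi_6=x^6+y^6+z^6-10(x^3y^3+x^3z^3+y^3z^3)$. Let $X$ be the complex K3 surface $w^2+\Phi_6(x,y,z)=0$ in the weighted projective space $\mathbb P(1,1,1,3)$, let $q:X\to\mathbb P^2$, $(x,y,z,w)\mapsto(x,y,z)$, be the double cover branched along the sextic $\Phi_6=0$, and let $\sigma:(x,y,z,w)\mapsto(x,y,z,-w)$ be its covering involution. Let $G_{216}\subset \mathrm{PGL}(3,\mathbb C)$ be the Hessian group, i.e. the group of projective transformations of $\mathbb P^2$ that preserve the Hesse pencil $t_0(x^3+y^3+z^3)+t_1xyz=0$. Let $T_1,\dots,T_4$ be the triangles of this pencil, with equations $xyz=0$ and $x^3+y^3+z^3+\mu\,xyz=0$ for $\mu=-3,-3\epsilon,-3\epsilon^2$ respectively; the vertices of $T_i$ are its three singular points. The action of $G_{216}$ on $\mathbb P^2$ lifts along $q$ to an action on $X$ by automorphisms (this lift is unique), and $X$ has four pairs of elliptic fibrations $\mathfrak h_i,\mathfrak h_i':X\to\mathbb P^1$, $i=1,\dots,4$, the eight of them pairwise distinct (even up to automorphisms of $\mathbb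 P^1$), with the following properties. a) $\mathfrak h_i$ and $\mathfrak h_i'$ are exchanged by the covering involution: $\mathfrak h_i'=\mathfrak h_i\circ\sigma$ and $\mathfrak h_i=\mathfrak h_i'\circ\sigma$. The group $G_{216}$ acts on the set of fibrations $\{\mathfrak h_1,\dots,\mathfrak h_4\}$ (considered up to automorphisms of $\mathbb P^1$), and this action is transitive. b) Every smooth fibre of $\mathfrak h_i$ or $\mathfrak h_i'$ is an elliptic curve with $j$-invariant $0$. c) Each of the eight fibrations has exactly six reducible fibres, and each of these is of Kodaira type $IV$, i.e. it is reduced and is the union of three smooth rational curves that meet at one point, pairwise transversally. The image under $q$ of the set of singular points of the reducible fibres of $\mathfrak h_i$ is the set of vertices of the triangle $T_i$, and the same holds for $\mathfrak h_i'$. d) Each of the eight fibrations is jacobian, i.e. it has a section $\mathbb P^1\to X$. -/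

import Mathlib

open MvPolynomial
open scoped LinearAlgebra.Projectivization Pointwise

noncomputable section

/-! ### Classical algebraic varieties over `ℂ` in homogeneous coordinates -/

/-- A set `X` of points with (possibly weighted) homogeneous coordinates: `rep x` is a chosen vector
of homogeneous coordinates of the point `x`, and `weight i` is the weight of the `i`-th coordinate.
Below `rep` is only fed into weighted homogeneous polynomials and into quotients of two such
polynomials of the same degree, so that nothing depends on the choice of the coordinate vectors. -/
class HomogeneousCoordinates (X : Type) (ι : outParam Type) where
  weight : ι → ℕ
  rep : X → ι → ℂ

/-- The projective space `ℙ(ℂⁿ)` with its usual homogeneous coordinates. -/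
instance projectiveCoordinates (n : ℕ) : HomogeneousCoordinates (ℙ ℂ (Fin n → ℂ)) (Fin n) where
  weight := fun _ => 1
  rep := Projectivization.rep

/-- A subset of a space with homogeneous coordinates inherits the coordinates. -/
instance subtypeCoordinates {X ι : Type} [HomogeneousCoordinates X ι] (S : Set X) :
    HomogeneousCoordinates S ι where
  weight := HomogeneousCoordinates.weight X
  rep := fun x => HomogeneousCoordinates.rep x.1

section Varieties

variable {X Y ι κ : Type} [HomogeneousCoordinates X ι] [HomogeneousCoordinates Y κ]

/-- The value of a polynomial at the chosen coordinates of a point. -/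
def evalAt (f : MvPolynomial ι ℂ) (x : X) : ℂ := eval (HomogeneousCoordinates.rep x) f

variable (X) in
/-- `f` is weighted homogeneous of degree `e` in the coordinates of `X`. -/
def IsForm (f : MvPolynomial ι ℂ) (e : ℕ) : Prop :=
  IsWeightedHomogeneous (HomogeneousCoordinates.weight X) f e

variable (X) in
/-- The set of points of `X` at which a form vanishes. -/
def zeroLocus (f : MvPolynomial ι ℂ) : Set X := {x | evalAt f x = 0}

variable (X) in
/-- The Zariski topology: the sets `{b ≠ 0}`, for `b` a form, are a basis of the open sets. -/
@[reducible] def zariskiTopology : TopologicalSpace X where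
  IsOpen U := ∀ x ∈ U, ∃ (e : ℕ) (b : MvPolynomial ι ℂ), IsForm X b e ∧ evalAt b x ≠ 0 ∧
    ∀ y, evalAt b y ≠ 0 → y ∈ U
  isOpen_univ := fun x _ => ⟨0, 1, isWeightedHomogeneous_one _ _, by simp [evalAt], by simp⟩
  isOpen_inter := by
    rintro U V hU hV x ⟨hxU, hxV⟩
    obtain ⟨e, b, hb, hbx, hbU⟩ := hU x hxU
    obtain ⟨e', b', hb', hbx', hbV⟩ := hV x hxV
    refine ⟨e + e', b * b', IsWeightedHomogeneous.mul hb hb', ?_, fun y hy => ?_⟩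
    · simpa [evalAt] using And.intro hbx hbx'
    · have h : evalAt b y ≠ 0 ∧ evalAt b' y ≠ 0 := by simpa [evalAt] using hy
      exact ⟨hbU y h.1, hbV y h.2⟩
  isOpen_sUnion := by
    rintro 𝒰 h𝒰 x ⟨U, hU, hxU⟩
    obtain ⟨e, b, hb, hbx, hbU⟩ := h𝒰 U hU x hxU
    exact ⟨e, b, hb, hbx, fun y hy => ⟨U, hU, hbU y hy⟩⟩

/-- `P` holds at all points of some Zariski neighbourhood of `x`. -/
def Near (x : X) (P : X → Prop) : Prop := ∀ᶠ y in @nhds X (zariskiTopology X) x, P y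

/-- The function `f` is regular at `x`: on a Zariski neighbourhood of `x` it is a quotient of two
forms of the same degree. Only the germ of `f` at `x` matters, and the germs of the functions that
are regular at `x` form the local ring of `X` at `x`. -/
def RegularAt (f : X → ℂ) (x : X) : Prop :=
  ∃ (e : ℕ) (a b : MvPolynomial ι ℂ), IsForm X a e ∧ IsForm X b e ∧ evalAt b x ≠ 0 ∧
    ∀ y, evalAt b y ≠ 0 → f y = evalAt a y / evalAt b y

/-- Morphisms of varieties: maps that pull back regular functions to regular functions.
As a germ may be represented by any function that agrees with it near the point, this
includes continuity for the Zariski topologies. -/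
def IsMorphism (φ : X → Y) : Prop :=
  ∀ (x : X) (f : Y → ℂ), RegularAt f (φ x) → RegularAt (f ∘ φ) x

variable (X Y) in
/-- `X` and `Y` are isomorphic as varieties. -/
def IsIsomorphic : Prop := ∃ φ : X ≃ Y, IsMorphism φ ∧ IsMorphism φ.symm

/-- `f` is regular at `x` and vanishes at `x`, i.e. its germ lies in the maximal ideal `𝔪` of the
local ring of `X` at `x`. -/
def InMaximalIdeal (f : X → ℂ) (x : X) : Prop := RegularAt f x ∧ f x = 0

/-- The germ of `f` at `x` lies in the square `𝔪²` of the maximal ideal of the local ring. -/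
def InMaximalIdealSq (f : X → ℂ) (x : X) : Prop :=
  ∃ (n : ℕ) (a b : Fin n → X → ℂ), (∀ k, InMaximalIdeal (a k) x ∧ InMaximalIdeal (b k) x) ∧
    Near x (fun y => f y = ∑ k, a k y * b k y)

/-- The germ of `f` at `x` lies in the ideal of the subset `C` in the local ring of `X` at `x`. -/
def InIdealOf (C : Set X) (f : X → ℂ) (x : X) : Prop :=
  RegularAt f x ∧ Near x (fun y => y ∈ C → f y = 0)

end Varieties

/-- The projective line. -/
abbrev P1 : Type := ℙ ℂ (Fin 2 → ℂ)

/-- The projective plane. -/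
abbrev P2 : Type := ℙ ℂ (Fin 3 → ℂ)

/-! ### The Hesse pencil and the Hessian group -/

/-- The cubic form `t₀ (x³ + y³ + z³) + t₁ xyz`. -/
def hesseCubic (t₀ t₁ : ℂ) : MvPolynomial (Fin 3) ℂ :=
  C t₀ * (X 0 ^ 3 + X 1 ^ 3 + X 2 ^ 3) + C t₁ * (X 0 * X 1 * X 2)

/-- The Hesse pencil, as a set of plane curves. -/
def hessePencil : Set (Set P2) :=
  {E | ∃ t₀ t₁ : ℂ, (t₀, t₁) ≠ (0, 0) ∧ E = zeroLocus P2 (hesseCubic t₀ t₁)}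

/-- The group of projective transformations of the plane, `PGL(3, ℂ)`, as a group of permutations
of the points of the plane. -/
def projectiveTransformations : Subgroup (Equiv.Perm P2) :=
  (MulAction.toPermHom (LinearMap.GeneralLinearGroup ℂ (Fin 3 → ℂ)) P2).range

/-- The Hessian group `G₂₁₆`: the projective transformations of the plane that preserve the
Hesse pencil. -/
def hessianGroup : Subgroup (Equiv.Perm P2) :=
  projectiveTransformations ⊓ MulAction.stabilizer (Equiv.Perm P2) hessePencil

/-- The equations of the four triangles `T₁, …, T₄` of the Hesse pencil, namely the members
`xyz = 0` and `x³ + y³ + z³ + μ xyz = 0` for `μ = -3, -3ε, -3ε²`. -/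
def triangle (ε : ℂ) : Fin 4 → MvPolynomial (Fin 3) ℂ :=
  ![hesseCubic 0 1, hesseCubic 1 (-3), hesseCubic 1 (-3 * ε), hesseCubic 1 (-3 * ε ^ 2)]

/-- The vertices of the triangle `Tᵢ`: the singular points of this plane cubic. -/
def triangleVertices (ε : ℂ) (i : Fin 4) : Set P2 :=
  {p | ∀ k, evalAt (pderiv k (triangle ε i)) p = 0}

/-! ### The K3 surface -/

section WeightedProjectiveSpace

variable {n : ℕ}

/-- Two nonzero vectors are equivalent if they differ by `(vᵢ) ↦ (s ^ dᵢ vᵢ)`, `s ≠ 0`. -/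
def weightedSetoid (d : Fin n → ℕ) : Setoid {v : Fin n → ℂ // v ≠ 0} where
  r v w := ∃ s : ℂ, s ≠ 0 ∧ ∀ i, w.1 i = s ^ d i * v.1 i
  iseqv :=
    { refl := fun v => ⟨1, one_ne_zero, by simp⟩
      symm := by
        rintro v w ⟨s, hs, h⟩
        refine ⟨s⁻¹, inv_ne_zero hs, fun i => ?_⟩
        rw [h i, ← mul_assoc, ← mul_pow, inv_mul_cancel₀ hs, one_pow, one_mul]
      trans := by
        rintro u v w ⟨s, hs, h⟩ ⟨s', hs', h'⟩
        refine ⟨s' * s, mul_ne_zero hs' hs, fun i => ?_⟩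
        rw [h' i, h i, mul_pow, mul_assoc] }

/-- The weighted projective space with weights `d`. -/
def WeightedProjectiveSpace (d : Fin n → ℕ) : Type := Quotient (weightedSetoid d)

/-- The point with homogeneous coordinates `v`. -/
def WeightedProjectiveSpace.mk (d : Fin n → ℕ) (v : Fin n → ℂ) (hv : v ≠ 0) :
    WeightedProjectiveSpace d :=
  Quotient.mk (weightedSetoid d) ⟨v, hv⟩

instance weightedCoordinates (d : Fin n → ℕ) :
    HomogeneousCoordinates (WeightedProjectiveSpace d) (Fin n) where
  weight := d
  rep := fun p => (Quotient.out p).1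

theorem WeightedProjectiveSpace.rep_mk (d : Fin n → ℕ) (v : Fin n → ℂ) (hv : v ≠ 0) :
    ∃ s : ℂ, s ≠ 0 ∧ ∀ i,
      v i = s ^ d i * HomogeneousCoordinates.rep (WeightedProjectiveSpace.mk d v hv) i :=
  Quotient.mk_out (s := weightedSetoid d) ⟨v, hv⟩

end WeightedProjectiveSpace

/-- The invariant sextic form
`Φ₆ = x⁶ + y⁶ + z⁶ - 10 (x³y³ + x³z³ + y³z³)`, whose zero locus is the plane sextic `C₆`. -/
def phi6 : MvPolynomial (Fin 3) ℂ :=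
  X 0 ^ 6 + X 1 ^ 6 + X 2 ^ 6
    - C 10 * (X 0 ^ 3 * X 1 ^ 3 + X 0 ^ 3 * X 2 ^ 3 + X 1 ^ 3 * X 2 ^ 3)

/-- The equation `w² + Φ₆(x, y, z)` of the double plane branched along `C₆`. -/
def doublePlaneEquation : MvPolynomial (Fin 4) ℂ :=
  X 3 ^ 2 + rename Fin.castSucc phi6

/-- The K3 surface `X`: the double cover `w² + Φ₆(x, y, z) = 0` of the plane branched along `C₆`,
in the weighted projective space `ℙ(1, 1, 1, 3)`. -/
abbrev K3 : Type := zeroLocus (WeightedProjectiveSpace ![1, 1, 1, 3]) doublePlaneEquation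

theorem eval_doublePlaneEquation (v : Fin 4 → ℂ) :
    eval v doublePlaneEquation = v 3 ^ 2 + (v 0 ^ 6 + v 1 ^ 6 + v 2 ^ 6
      - 10 * (v 0 ^ 3 * v 1 ^ 3 + v 0 ^ 3 * v 2 ^ 3 + v 1 ^ 3 * v 2 ^ 3)) := by
  simp [doublePlaneEquation, phi6]

/-- The point of the K3 surface with homogeneous coordinates `v = (x, y, z, w)`. -/
def K3.mk (v : Fin 4 → ℂ) (hv : v ≠ 0) (h : eval v doublePlaneEquation = 0) : K3 :=
  ⟨WeightedProjectiveSpace.mk ![1, 1, 1, 3] v hv, by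
    obtain ⟨s, hs, hr⟩ := WeightedProjectiveSpace.rep_mk ![1, 1, 1, 3] v hv
    have h0 := hr 0
    have h1 := hr 1
    have h2 := hr 2
    have h3 := hr 3
    simp only [Matrix.cons_val, pow_one] at h0 h1 h2 h3
    rw [eval_doublePlaneEquation, h0, h1, h2, h3] at h
    refine (mul_eq_zero.mp (?_ : s ^ 6 * _ = 0)).resolve_left (pow_ne_zero 6 hs)
    rw [evalAt, eval_doublePlaneEquation]
    linear_combination h⟩

/-- The chosen homogeneous coordinates of a point of the K3 surface. -/
def K3.rep (p : K3) : Fin 4 → ℂ := HomogeneousCoordinates.rep p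

theorem K3.eval_rep (p : K3) : eval p.rep doublePlaneEquation = 0 := p.2

theorem K3.rep_ne_zero (p : K3) : p.rep ≠ 0 := (Quotient.out p.1).2

theorem K3.xyz_ne_zero (p : K3) : ![p.rep 0, p.rep 1, p.rep 2] ≠ 0 := by
  intro h
  have h0 : p.rep 0 = 0 := congrFun h 0
  have h1 : p.rep 1 = 0 := congrFun h 1
  have h2 : p.rep 2 = 0 := congrFun h 2
  have h3 := p.eval_rep
  rw [eval_doublePlaneEquation, h0, h1, h2] at h3
  have h4 : p.rep 3 = 0 := by simpa using h3
  exact p.rep_ne_zero (by ext i; fin_cases i <;> assumption)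

/-- The double cover `q : X → ℙ²`, `(x, y, z, w) ↦ (x, y, z)`. -/
def coverMap (p : K3) : P2 :=
  Projectivization.mk ℂ ![p.rep 0, p.rep 1, p.rep 2] p.xyz_ne_zero

/-- The covering involution `(x, y, z, w) ↦ (x, y, z, -w)` of `q`. -/
def coveringInvolution (p : K3) : K3 :=
  K3.mk ![p.rep 0, p.rep 1, p.rep 2, -p.rep 3]
    (fun h => p.xyz_ne_zero (by
      have h0 : p.rep 0 = 0 := congrFun h 0
      have h1 : p.rep 1 = 0 := congrFun h 1
      have h2 : p.rep 2 = 0 := congrFun h 2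
      ext i; fin_cases i <;> assumption))
    (by
      have h := p.eval_rep
      rw [eval_doublePlaneEquation] at h ⊢
      simp only [Matrix.cons_val]
      linear_combination h)

/-- An action of the Hessian group on the K3 surface by automorphisms that lifts its action on the
plane. There is exactly one: two lifts of an element differ by the covering involution, and the
Hessian group has no nontrivial homomorphism to a group of order two. -/
def IsHessianAction (ρ : hessianGroup →* Equiv.Perm K3) : Prop :=
  ∀ g, IsMorphism (ρ g) ∧ ∀ p, coverMap (ρ g p) = g.1 (coverMap p)

/-! ### Elliptic fibrations on the K3 surface -/

/-- The variety `F` is an elliptic curve (a smooth projective curve of genus one) with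
`j`-invariant `j`: it is isomorphic to a nonsingular plane Weierstrass cubic with
this `j`-invariant. -/
def IsEllipticCurveWithJ (F : Set K3) (j : ℂ) : Prop :=
  ∃ (W : WeierstrassCurve ℂ) (_ : W.IsElliptic), W.j = j ∧
    IsIsomorphic F (zeroLocus P2 W.toProjective.polynomial)

/-- The scheme-theoretic fibre of `h` through `x` is smooth at `x`: the pull-back of a local
parameter of `ℙ¹` at `h x` does not lie in the square of the maximal ideal at `x`. -/
def FibreSmoothAt (h : K3 → P1) (x : K3) : Prop :=
  ∃ t : P1 → ℂ, InMaximalIdeal t (h x) ∧ ¬ InMaximalIdealSq (t ∘ h) x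

/-- The scheme-theoretic fibre of `h` over `t` is smooth. -/
def IsSmoothFibre (h : K3 → P1) (t : P1) : Prop := ∀ x, h x = t → FibreSmoothAt h x

/-- The fibre of `h` over `t` is reducible. -/
def IsReducibleFibre (h : K3 → P1) (t : P1) : Prop :=
  ¬ @IsIrreducible K3 (zariskiTopology K3) (h ⁻¹' {t})

/-- The scheme-theoretic fibre of `h` through `x` is reduced at `x`: the ideal of the point set of
the fibre is generated by the pull-backs of the functions vanishing at `h x`. -/
def FibreReducedAt (h : K3 → P1) (x : K3) : Prop :=
  ∀ f, InIdealOf (h ⁻¹' {h x}) f x →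
    ∃ (t : P1 → ℂ) (c : K3 → ℂ), InMaximalIdeal t (h x) ∧ RegularAt c x ∧
      Near x (fun y => f y = c y * t (h y))

/-- An elliptic fibration: a surjective morphism to the projective line all but finitely many of
whose fibres are smooth curves of genus one. -/
structure IsEllipticFibration (h : K3 → P1) : Prop where
  morphism : IsMorphism h
  surjective : Function.Surjective h
  generic : {t | ¬ (IsSmoothFibre h t ∧ ∃ j, IsEllipticCurveWithJ (h ⁻¹' {t}) j)}.Finite

/-- The fibre of `h` over `t` is of Kodaira type IV: it is reduced and is the union of three smooth
rational curves which meet at one point `p`, any two of them only at `p` and transversally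
there (their ideals generate the maximal ideal at `p`). -/
def IsTypeIV (h : K3 → P1) (t : P1) : Prop :=
  (∀ x, h x = t → FibreReducedAt h x) ∧
  ∃ (D : Fin 3 → Set K3) (p : K3),
    h ⁻¹' {t} = ⋃ i, D i ∧
    (∀ i, @IsClosed K3 (zariskiTopology K3) (D i) ∧ IsIsomorphic (D i) P1) ∧
    ∀ i j, i ≠ j → D i ∩ D j = {p} ∧
      ∀ f, InMaximalIdeal f p → ∃ a b, InIdealOf (D i) a p ∧ InIdealOf (D j) b p ∧
        Near p (fun y => f y = a y + b y)

/-- The points of the reducible fibres of `h` at which these fibres are singular. -/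
def reducibleFibreSingularPoints (h : K3 → P1) : Set K3 :=
  {x | IsReducibleFibre h (h x) ∧ ¬ FibreSmoothAt h x}

/-- The fibration is jacobian: it has a section. -/
def IsJacobian (h : K3 → P1) : Prop := ∃ s : P1 → K3, IsMorphism s ∧ ∀ t, h (s t) = t

/-- Two maps to the projective line define the same fibration: they differ by an automorphism of
the projective line. -/
def SameFibration (h h' : K3 → P1) : Prop :=
  ∃ A : LinearMap.GeneralLinearGroup ℂ (Fin 2 → ℂ), ∀ x, h' x = A • h x

end

noncomputable section

/-! ### Regular functions and morphisms -/

section Generalities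

variable {X Y ι κ : Type} [HomogeneousCoordinates X ι] [HomogeneousCoordinates Y κ]

/-! The sextic is a quadratic form in the cubes of the coordinates. With S = x³ + y³ + z³ and its
twists U, V by the nontrivial third roots of unity it equals 4UV − 3S² (`sextic_eq`). Taking r² = 3,
the surface becomes (w − rS)(w + rS) = −4UV, the vanishing of a 2×2 determinant. The ratio of either
row, [w − rS : 2U] = [−2V : w + rS], is a map `fib` to the line, and it has no base points because
S, U, V have no common zero.

The fibre over t is given by two equations linear in w. Eliminating w presents it as the graph of a
cubic form over the diagonal plane cubic with coefficients `coef t` (`fibre_equations`). If no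
coefficient vanishes, this cubic is projectively the Fermat cubic, so j = 0
(`isEllipticCurve_fibre`). The product of the coefficients is t₀⁶ + t₁⁶ and two of them never vanish
together, so exactly six fibres degenerate, each into three lines through a vertex of the coordinate
triangle (`isTypeIV_of_coef`). A section lies over a line on which Φ₆ is minus a square
(`sec_equations`). The scheme-theoretic claims rest on three arguments: a holomorphic curve
transversal to the fibres (`fibreSmoothAt`), the absence of terms of order below three at a vertex
(`not_fibreSmoothAt`), and division by the equations of the fibre (`fibreReducedAt`).

For the group, the cross product of the gradients of two generators of the Hesse pencil is a quartic
vector field, and the trace of the square of its Jacobian is 2Φ₆. A linear map M over the Hessian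
group carries the pencil to itself, hence carries the field to c times itself, hence multiplies Φ₆
by c² (`exists_field_smul`, `sextic_of_covariant`). So (v, w) ↦ (Mv, cw) acts on the surface, and
scalar matrices act trivially (`toHessian_ker`).

The other fibrations are pulled back from `fib` along lifts that carry the triangles to the
coordinate one. The stabilizer of the coordinate triangle consists of monomial matrices, and these
preserve `fib` up to a change of coordinate on the line, without exchanging it with its conjugate
(`exists_smul_fib`). This makes the four fibrations an orbit. Fibrations of different index are told
apart by their triangles (`eq_of_sameFibration`); a fibration is told apart from its conjugate by
two points of one fibre which the involution sends to different fibres. -/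

theorem near_iff {x : X} {P : X → Prop} :
    Near x P ↔ ∃ (e : ℕ) (b : MvPolynomial ι ℂ), IsForm X b e ∧ evalAt b x ≠ 0 ∧
      ∀ y, evalAt b y ≠ 0 → P y := by
  unfold Near
  rw [@Filter.eventually_iff, @mem_nhds_iff X (zariskiTopology X)]
  constructor
  · rintro ⟨U, hUP, hU, hx⟩
    obtain ⟨e, b, hb, hbx, h⟩ := hU x hx
    exact ⟨e, b, hb, hbx, fun y hy => hUP (h y hy)⟩
  · rintro ⟨e, b, hb, hbx, h⟩
    exact ⟨{y | evalAt b y ≠ 0}, fun y hy => h y hy, fun y hy => ⟨e, b, hb, hy, fun _ h => h⟩, hbx⟩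

theorem Near.and {x : X} {P Q : X → Prop} (hP : Near x P) (hQ : Near x Q) :
    Near x (fun y => P y ∧ Q y) := Filter.Eventually.and hP hQ

theorem Near.mono {x : X} {P Q : X → Prop} (hP : Near x P) (h : ∀ y, P y → Q y) : Near x Q :=
  Filter.Eventually.mono hP h

theorem near_of_forall {x : X} {P : X → Prop} (h : ∀ y, P y) : Near x P :=
  Filter.Eventually.of_forall h

theorem near_ne_zero {x : X} {e : ℕ} {b : MvPolynomial ι ℂ} (hb : IsForm X b e)
    (hx : evalAt b x ≠ 0) : Near x (fun y => evalAt b y ≠ 0) :=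
  near_iff.2 ⟨e, b, hb, hx, fun _ h => h⟩

@[simp] theorem evalAt_add (a b : MvPolynomial ι ℂ) (x : X) :
    evalAt (a + b) x = evalAt a x + evalAt b x := by simp [evalAt]

@[simp] theorem evalAt_sub (a b : MvPolynomial ι ℂ) (x : X) :
    evalAt (a - b) x = evalAt a x - evalAt b x := by simp [evalAt]

@[simp] theorem evalAt_mul (a b : MvPolynomial ι ℂ) (x : X) :
    evalAt (a * b) x = evalAt a x * evalAt b x := by simp [evalAt]

@[simp] theorem evalAt_pow (a : MvPolynomial ι ℂ) (n : ℕ) (x : X) :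
    evalAt (a ^ n) x = evalAt a x ^ n := by simp [evalAt]

@[simp] theorem evalAt_C (c : ℂ) (x : X) : evalAt (C c) x = c := by simp [evalAt]

@[simp] theorem evalAt_one (x : X) : evalAt (1 : MvPolynomial ι ℂ) x = 1 := by simp [evalAt]

@[simp] theorem evalAt_X (i : ι) (x : X) :
    evalAt (MvPolynomial.X i : MvPolynomial ι ℂ) x = HomogeneousCoordinates.rep x i := by
  simp [evalAt]

theorem isForm_one : IsForm X (1 : MvPolynomial ι ℂ) 0 := isWeightedHomogeneous_one _ _

theorem IsForm.add {a b : MvPolynomial ι ℂ} {e : ℕ} (ha : IsForm X a e) (hb : IsForm X b e) :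
    IsForm X (a + b) e := IsWeightedHomogeneous.add ha hb

theorem IsForm.sub {a b : MvPolynomial ι ℂ} {e : ℕ} (ha : IsForm X a e) (hb : IsForm X b e) :
    IsForm X (a - b) e := IsWeightedHomogeneous.sub ha hb

theorem IsForm.mul {a b : MvPolynomial ι ℂ} {d e : ℕ} (ha : IsForm X a d) (hb : IsForm X b e) :
    IsForm X (a * b) (d + e) := IsWeightedHomogeneous.mul ha hb

theorem IsForm.C_mul {a : MvPolynomial ι ℂ} {d : ℕ} (ha : IsForm X a d) (c : ℂ) :
    IsForm X (C c * a) d := IsWeightedHomogeneous.C_mul ha c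

theorem IsForm.pow {a : MvPolynomial ι ℂ} {d : ℕ} (ha : IsForm X a d) (n : ℕ) :
    IsForm X (a ^ n) (n * d) := by
  exact IsWeightedHomogeneous.pow ha n

theorem isForm_X (i : ι) :
    IsForm X (MvPolynomial.X i : MvPolynomial ι ℂ) (HomogeneousCoordinates.weight X i) :=
  isWeightedHomogeneous_X _ _ i

theorem IsForm.cast {a : MvPolynomial ι ℂ} {d e : ℕ} (ha : IsForm X a d) (h : d = e) :
    IsForm X a e := h ▸ ha

theorem IsForm.sum {α : Type*} {s : Finset α} {a : α → MvPolynomial ι ℂ} {d : ℕ}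
    (ha : ∀ i ∈ s, IsForm X (a i) d) : IsForm X (∑ i ∈ s, a i) d := by
  classical
  induction s using Finset.induction_on with
  | empty => exact isWeightedHomogeneous_zero _ _ _
  | insert i s hi ih =>
    rw [Finset.sum_insert hi]
    exact (ha i (by simp)).add (ih fun j hj => ha j (by simp [hj]))

/-- Composition of forms is a form. -/
theorem IsForm.bind {a : MvPolynomial κ ℂ} {n d : ℕ} (ha : IsForm Y a n)
    {P : κ → MvPolynomial ι ℂ}
    (hP : ∀ j, IsForm X (P j) (d * HomogeneousCoordinates.weight Y j)) :
    IsForm X (bind₁ P a) (d * n) := by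
  classical
  rw [← MvPolynomial.support_sum_monomial_coeff a, map_sum]
  refine IsForm.sum fun m hm => ?_
  rw [bind₁_monomial]
  refine IsForm.C_mul ?_ _
  have h := ha (mem_support_iff.1 hm)
  have h2 := IsWeightedHomogeneous.prod (w := HomogeneousCoordinates.weight X) m.support
    (fun j => P j ^ m j) (fun j => m j • (d * HomogeneousCoordinates.weight Y j))
    (fun j _ => IsWeightedHomogeneous.pow (hP j) (m j))
  refine IsForm.cast h2 ?_
  rw [← h, Finsupp.weight_apply, Finsupp.sum, Finset.mul_sum]
  refine Finset.sum_congr rfl fun j _ => ?_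
  simp only [smul_eq_mul]
  ring

/-- Rescaling the coordinates rescales the value of a form. -/
theorem IsForm.eval_scale {a : MvPolynomial ι ℂ} {n : ℕ} (ha : IsForm X a n)
    {s : ℂ} {v v' : ι → ℂ} (h : ∀ i, v' i = s ^ HomogeneousCoordinates.weight X i * v i) :
    eval v' a = s ^ n * eval v a := by
  classical
  rw [← MvPolynomial.support_sum_monomial_coeff a, map_sum, map_sum, Finset.mul_sum]
  refine Finset.sum_congr rfl fun m hm => ?_
  have hw := ha (mem_support_iff.1 hm)
  rw [eval_monomial, eval_monomial, Finsupp.prod, Finsupp.prod, ← hw, Finsupp.weight_apply,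
    Finsupp.sum, ← Finset.prod_pow_eq_pow_sum, mul_left_comm, ← Finset.prod_mul_distrib]
  congr 1
  refine Finset.prod_congr rfl fun j _ => ?_
  rw [h, mul_pow, ← pow_mul, smul_eq_mul, mul_comm (m j)]

namespace RegularAt

theorem quotient {x : X} {a b : MvPolynomial ι ℂ} {e : ℕ} (ha : IsForm X a e) (hb : IsForm X b e)
    (hx : evalAt b x ≠ 0) : RegularAt (fun y => evalAt a y / evalAt b y) x :=
  ⟨e, a, b, ha, hb, hx, fun _ _ => rfl⟩

/-- Regularity demands equality wherever the denominator is nonzero. Multiplying numerator and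
denominator by a form whose nonvanishing locus lies in the set of agreement keeps the fraction and
shrinks that locus. -/
theorem congr {x : X} {f g : X → ℂ} (hf : RegularAt f x) (h : Near x (fun y => g y = f y)) :
    RegularAt g x := by
  obtain ⟨e, a, b, ha, hb, hx, hab⟩ := hf
  obtain ⟨d, c, hc, hcx, h⟩ := near_iff.1 h
  refine ⟨e + d, a * c, b * c, ha.mul hc, hb.mul hc, by simp [hx, hcx], fun y hy => ?_⟩
  simp only [evalAt_mul, ne_eq, mul_eq_zero, not_or] at hy
  rw [h y hy.2, hab y hy.1, evalAt_mul, evalAt_mul, mul_div_mul_right _ _ hy.2]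

theorem const (c : ℂ) (x : X) : RegularAt (fun _ => c) x :=
  ⟨0, C c, 1, isWeightedHomogeneous_C _ _, isForm_one, by simp, fun y _ => by simp⟩

theorem add {x : X} {f g : X → ℂ} (hf : RegularAt f x) (hg : RegularAt g x) :
    RegularAt (fun y => f y + g y) x := by
  obtain ⟨e, a, b, ha, hb, hx, h⟩ := hf
  obtain ⟨e', a', b', ha', hb', hx', h'⟩ := hg
  refine ⟨e + e', a * b' + b * a', b * b', (ha.mul hb').add (hb.mul ha'), hb.mul hb',
    by simp [hx, hx'], fun y hy => ?_⟩
  simp only [evalAt_mul, ne_eq, mul_eq_zero, not_or] at hy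
  have h1 := hy.1
  have h2 := hy.2
  beta_reduce
  rw [h y h1, h' y h2]
  simp only [evalAt_mul, evalAt_add]
  field_simp

theorem mul {x : X} {f g : X → ℂ} (hf : RegularAt f x) (hg : RegularAt g x) :
    RegularAt (fun y => f y * g y) x := by
  obtain ⟨e, a, b, ha, hb, hx, h⟩ := hf
  obtain ⟨e', a', b', ha', hb', hx', h'⟩ := hg
  refine ⟨e + e', a * a', b * b', ha.mul ha', hb.mul hb', by simp [hx, hx'], fun y hy => ?_⟩
  simp only [evalAt_mul, ne_eq, mul_eq_zero, not_or] at hy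
  beta_reduce
  rw [h y hy.1, h' y hy.2]
  simp only [evalAt_mul]
  rw [div_mul_div_comm]

theorem sub {x : X} {f g : X → ℂ} (hf : RegularAt f x) (hg : RegularAt g x) :
    RegularAt (fun y => f y - g y) x := by
  have := hf.add ((const (-1) x).mul hg)
  refine this.congr (near_of_forall fun y => by ring)

theorem inv {x : X} {f : X → ℂ} (hf : RegularAt f x) (h0 : f x ≠ 0) :
    RegularAt (fun y => (f y)⁻¹) x := by
  obtain ⟨e, a, b, ha, hb, hx, h⟩ := hf
  have hax : evalAt a x ≠ 0 := by
    intro h1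
    rw [h x hx, h1, zero_div] at h0
    exact h0 rfl
  refine ⟨e + e, b * b, a * b, hb.mul hb, ha.mul hb, by simp [hx, hax], fun y hy => ?_⟩
  simp only [evalAt_mul, ne_eq, mul_eq_zero, not_or] at hy
  beta_reduce
  rw [h y hy.2, evalAt_mul, evalAt_mul, inv_div, mul_div_mul_right _ _ hy.2]

theorem near_ne_zero {x : X} {f : X → ℂ} (hf : RegularAt f x) (h0 : f x ≠ 0) :
    Near x (fun y => f y ≠ 0) := by
  obtain ⟨e, a, b, ha, hb, hx, h⟩ := hf
  have hax : evalAt a x ≠ 0 := by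
    intro h1
    rw [h x hx, h1, zero_div] at h0
    exact h0 rfl
  refine near_iff.2 ⟨e + e, a * b, ha.mul hb, by simp [hx, hax], fun y hy => ?_⟩
  simp only [evalAt_mul, ne_eq, mul_eq_zero, not_or] at hy
  rw [h y hy.2]
  exact div_ne_zero hy.1 hy.2

theorem polynomial {x : X} {f : X → ℂ} (hf : RegularAt f x) (p : Polynomial ℂ) :
    RegularAt (fun y => p.eval (f y)) x := by
  induction p using Polynomial.induction_on' with
  | add p q hp hq => simpa using hp.add hq
  | monomial n c =>
    induction n with
    | zero => simpa using const c x
    | succ n ih =>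
      simp only [Polynomial.eval_monomial] at ih ⊢
      exact (ih.mul hf).congr (near_of_forall fun y => by ring)

end RegularAt

/-! ### Morphisms and the pull-back of germs and ideals -/

theorem IsMorphism.comp {Z μ : Type} [HomogeneousCoordinates Z μ] {ψ : Y → Z} {φ : X → Y}
    (hψ : IsMorphism ψ) (hφ : IsMorphism φ) : IsMorphism (ψ ∘ φ) :=
  fun x f hf => hφ x (f ∘ ψ) (hψ (φ x) f hf)

theorem isMorphism_id : IsMorphism (id : X → X) := fun _ _ hf => hf

/-- Continuity is hidden in the definition of a morphism: the indicator function of {b ≠ 0} is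
regular where b ≠ 0, being b/b there, and its pull-back is nonzero only over that set. -/
theorem IsMorphism.near {φ : X → Y} (hφ : IsMorphism φ) {x : X} {P : Y → Prop}
    (h : Near (φ x) P) : Near x (fun y => P (φ y)) := by
  classical
  obtain ⟨e, b, hb, hbx, h⟩ := near_iff.1 h
  have hf : RegularAt (fun y : Y => if evalAt b y ≠ 0 then (1 : ℂ) else 0) (φ x) :=
    ⟨e, b, b, hb, hb, hbx, fun y hy => by simp [hy]⟩
  refine ((hφ x _ hf).near_ne_zero (by simp [hbx])).mono fun y hy => h _ ?_
  by_contra h0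
  exact hy (by simp [h0])

/-- A map that is given near every point by forms is a morphism. -/
theorem isMorphism_of_forms {φ : X → Y}
    (h : ∀ x : X, ∃ (d : ℕ) (P : κ → MvPolynomial ι ℂ) (e : ℕ) (s : MvPolynomial ι ℂ),
      (∀ j, IsForm X (P j) (d * HomogeneousCoordinates.weight Y j)) ∧ IsForm X s e ∧
      evalAt s x ≠ 0 ∧ ∀ y, evalAt s y ≠ 0 → ∃ l : ℂ, l ≠ 0 ∧ ∀ j,
        evalAt (P j) y =
          l ^ HomogeneousCoordinates.weight Y j * HomogeneousCoordinates.rep (φ y) j) :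
    IsMorphism φ := by
  intro x f hf
  obtain ⟨n, a, b, ha, hb, hbx, hab⟩ := hf
  obtain ⟨d, P, e, s, hP, hs, hsx, hsP⟩ := h x
  have key : ∀ (c : MvPolynomial κ ℂ), IsForm Y c n → ∀ y, evalAt s y ≠ 0 →
      ∃ l : ℂ, l ≠ 0 ∧ (∀ c, IsForm Y c n → evalAt (bind₁ P c) y = l ^ n * evalAt c (φ y)) := by
    intro c hc y hy
    obtain ⟨l, hl, hlj⟩ := hsP y hy
    refine ⟨l, hl, fun c hc => ?_⟩
    have : evalAt (bind₁ P c) y = eval (fun j => evalAt (P j) y) c := by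
      exact eval₂Hom_bind₁ _ _ _ _
    rw [this, hc.eval_scale hlj]
    rfl
  refine ⟨d * n + e, bind₁ P a * s, bind₁ P b * s, (ha.bind hP).mul hs, (hb.bind hP).mul hs, ?_, ?_⟩
  · obtain ⟨l, hl, h⟩ := key a ha x hsx
    simp [h b hb, hl, hbx, hsx]
  · intro y hy
    simp only [evalAt_mul, ne_eq, mul_eq_zero, not_or] at hy
    obtain ⟨l, hl, h⟩ := key a ha y hy.2
    have hby : evalAt b (φ y) ≠ 0 := by
      intro h0
      exact hy.1 (by rw [h b hb, h0, mul_zero])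
    rw [Function.comp_apply, hab _ hby, evalAt_mul, evalAt_mul, mul_div_mul_right _ _ hy.2,
      h a ha, h b hb, mul_div_mul_left _ _ (pow_ne_zero _ hl)]

/-- The restriction of a morphism to subvarieties is a morphism. -/
theorem IsMorphism.restrict {φ : X → Y} (hφ : IsMorphism φ) {S : Set X} {T : Set Y}
    (h : ∀ x : S, φ x ∈ T) : IsMorphism (fun x : S => (⟨φ x, h x⟩ : T)) := by
  classical
  rintro x f ⟨e, a, b, ha, hb, hbx, hab⟩
  have hf : RegularAt (fun y : Y => if hy : y ∈ T then f ⟨y, hy⟩ else evalAt a y / evalAt b y)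
      (φ x) := by
    refine ⟨e, a, b, ha, hb, hbx, fun y hy => ?_⟩
    by_cases hT : y ∈ T
    · simp only [dif_pos hT]
      exact hab ⟨y, hT⟩ hy
    · simp only [dif_neg hT]
  obtain ⟨d, a', b', ha', hb', hbx', hab'⟩ := hφ x _ hf
  refine ⟨d, a', b', ha', hb', hbx', fun y hy => ?_⟩
  have := hab' y hy
  simp only [Function.comp_apply, dif_pos (h y)] at this
  exact this

theorem IsIsomorphic.trans {Z μ : Type} [HomogeneousCoordinates Z μ]
    (h : IsIsomorphic X Y) (h' : IsIsomorphic Y Z) : IsIsomorphic X Z := by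
  obtain ⟨φ, h1, h2⟩ := h
  obtain ⟨ψ, h3, h4⟩ := h'
  exact ⟨φ.trans ψ, h3.comp h1, h2.comp h4⟩

/-- An automorphism maps a subset isomorphically to its image. -/
theorem isIsomorphic_preimage (φ : X ≃ Y) (h : IsMorphism φ) (h' : IsMorphism φ.symm)
    (S : Set Y) : IsIsomorphic (φ ⁻¹' S) S :=
  ⟨⟨fun x => ⟨φ x, x.2⟩, fun y => ⟨φ.symm y, by simp⟩, fun x => by simp, fun y => by simp⟩,
    h.restrict fun x => x.2, h'.restrict fun y => by simp⟩

theorem InMaximalIdeal.comp {φ : X → Y} (hφ : IsMorphism φ) {x : X} {f : Y → ℂ}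
    (hf : InMaximalIdeal f (φ x)) : InMaximalIdeal (f ∘ φ) x := ⟨hφ x f hf.1, hf.2⟩

theorem InMaximalIdealSq.comp {φ : X → Y} (hφ : IsMorphism φ) {x : X} {f : Y → ℂ}
    (hf : InMaximalIdealSq f (φ x)) : InMaximalIdealSq (f ∘ φ) x := by
  obtain ⟨n, a, b, hab, h⟩ := hf
  exact ⟨n, fun k => a k ∘ φ, fun k => b k ∘ φ,
    fun k => ⟨(hab k).1.comp hφ, (hab k).2.comp hφ⟩, hφ.near h⟩

theorem InIdealOf.comp {φ : X → Y} (hφ : IsMorphism φ) {x : X} {f : Y → ℂ} {S : Set Y}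
    (hf : InIdealOf S f (φ x)) : InIdealOf (φ ⁻¹' S) (f ∘ φ) x :=
  ⟨hφ x f hf.1, hφ.near hf.2⟩

theorem isClosed_zeroLocus {f : MvPolynomial ι ℂ} {e : ℕ} (hf : IsForm X f e) :
    @IsClosed X (zariskiTopology X) (zeroLocus X f) := by
  refine @IsClosed.mk X (zariskiTopology X) _ ?_
  exact fun x hx => ⟨e, f, hf, hx, fun y hy => hy⟩

theorem IsMorphism.continuous {φ : X → Y} (hφ : IsMorphism φ) :
    @Continuous X Y (zariskiTopology X) (zariskiTopology Y) φ := by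
  let _ := zariskiTopology X
  let _ := zariskiTopology Y
  refine continuous_def.2 fun s hs => ?_
  rw [isOpen_iff_mem_nhds]
  intro x hx
  have : Near (φ x) (fun y => y ∈ s) := hs.mem_nhds hx
  exact hφ.near this

end Generalities


/-! ### Coordinates on projective spaces and on the K3 surface -/

theorem exists_rep_mk {n : ℕ} (v : Fin n → ℂ) (hv : v ≠ 0) :
    ∃ s : ℂ, s ≠ 0 ∧
      ∀ i, v i = s * HomogeneousCoordinates.rep (Projectivization.mk ℂ v hv) i := by
  obtain ⟨a, ha⟩ := Projectivization.exists_smul_eq_mk_rep ℂ v hv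
  refine ⟨(a⁻¹ : ℂˣ), Units.ne_zero _, fun i => ?_⟩
  change v i = _ * (Projectivization.mk ℂ v hv).rep i
  rw [← ha]
  simp [Units.smul_def]

theorem proj_mk_eq {n : ℕ} {v w : Fin n → ℂ} {hv : v ≠ 0} {hw : w ≠ 0} (s : ℂ)
    (h : ∀ i, w i = s * v i) : Projectivization.mk ℂ v hv = Projectivization.mk ℂ w hw :=
  ((Projectivization.mk_eq_mk_iff' ℂ w v hw hv).2 ⟨s, by ext i; simp [h i]⟩).symm

theorem proj_mk_rep {n : ℕ} (p : ℙ ℂ (Fin n → ℂ)) :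
    Projectivization.mk ℂ (HomogeneousCoordinates.rep p) p.rep_nonzero = p :=
  p.mk_rep

theorem P1_mk_eq_iff {v w : Fin 2 → ℂ} {hv : v ≠ 0} {hw : w ≠ 0} :
    Projectivization.mk ℂ v hv = Projectivization.mk ℂ w hw ↔ v 0 * w 1 = v 1 * w 0 := by
  rw [Projectivization.mk_eq_mk_iff']
  constructor
  · rintro ⟨a, rfl⟩
    simp only [Pi.smul_apply, smul_eq_mul]
    ring
  · intro h
    by_cases h0 : w 0 = 0
    · have h1 : w 1 ≠ 0 := fun h1 => hw (by ext i; fin_cases i <;> assumption)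
      refine ⟨v 1 / w 1, ?_⟩
      have : v 0 = 0 := by
        rw [h0, mul_zero] at h
        exact (mul_eq_zero.1 h).resolve_right h1
      ext i; fin_cases i
      · simp [h0, this]
      · simp [h1]
    · refine ⟨v 0 / w 0, ?_⟩
      ext i; fin_cases i
      · simp [h0]
      · simp only [Pi.smul_apply, smul_eq_mul, Fin.mk_one]
        field_simp
        linear_combination h

/-- The value of the sextic form `Φ₆`. -/
def sextic (v : Fin 3 → ℂ) : ℂ :=
  v 0 ^ 6 + v 1 ^ 6 + v 2 ^ 6
    - 10 * (v 0 ^ 3 * v 1 ^ 3 + v 0 ^ 3 * v 2 ^ 3 + v 1 ^ 3 * v 2 ^ 3)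

namespace K3

/-- The plane coordinates of a point. -/
def xyz (p : K3) : Fin 3 → ℂ := ![p.rep 0, p.rep 1, p.rep 2]

/-- The last coordinate of a point. -/
def w (p : K3) : ℂ := p.rep 3

theorem xyz_ne (p : K3) : p.xyz ≠ 0 := p.xyz_ne_zero

theorem equation (p : K3) : p.w ^ 2 + sextic p.xyz = 0 := by
  have := p.eval_rep
  rw [eval_doublePlaneEquation] at this
  exact this

/-- The point with plane coordinates `v` and last coordinate `w`. -/
def point (v : Fin 3 → ℂ) (w : ℂ) (hv : v ≠ 0) (h : w ^ 2 + sextic v = 0) : K3 :=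
  K3.mk ![v 0, v 1, v 2, w]
    (fun h0 => hv (by
      have h0' := congrFun h0 0
      have h1' := congrFun h0 1
      have h2' := congrFun h0 2
      ext i; fin_cases i <;> assumption))
    (by rw [eval_doublePlaneEquation]; exact h)

theorem exists_point (v : Fin 3 → ℂ) (w : ℂ) (hv : v ≠ 0) (h : w ^ 2 + sextic v = 0) :
    ∃ s : ℂ, s ≠ 0 ∧ (∀ i, v i = s * (point v w hv h).xyz i) ∧
      w = s ^ 3 * (point v w hv h).w := by
  obtain ⟨s, hs, hr⟩ := WeightedProjectiveSpace.rep_mk ![1, 1, 1, 3] ![v 0, v 1, v 2, w]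
    (fun h0 => hv (by
      have h0' := congrFun h0 0
      have h1' := congrFun h0 1
      have h2' := congrFun h0 2
      ext i; fin_cases i <;> assumption))
  have h0 := hr 0
  have h1 := hr 1
  have h2 := hr 2
  have h3 := hr 3
  simp only [Matrix.cons_val, pow_one] at h0 h1 h2 h3
  refine ⟨s, hs, fun i => ?_, h3⟩
  fin_cases i
  exacts [h0, h1, h2]

theorem ext_of_scale {p q : K3} (s : ℂ) (hs : s ≠ 0) (h : ∀ i, q.xyz i = s * p.xyz i)
    (hw : q.w = s ^ 3 * p.w) : p = q := by
  apply Subtype.ext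
  have hp : (Quotient.mk (weightedSetoid ![1, 1, 1, 3]) (Quotient.out p.1)) = p.1 :=
    Quotient.out_eq p.1
  have hq : (Quotient.mk (weightedSetoid ![1, 1, 1, 3]) (Quotient.out q.1)) = q.1 :=
    Quotient.out_eq q.1
  rw [← hp, ← hq]
  refine Quotient.sound ⟨s, hs, fun i => ?_⟩
  fin_cases i
  · exact (h 0).trans (congrArg (· * _) (pow_one s).symm)
  · exact (h 1).trans (congrArg (· * _) (pow_one s).symm)
  · exact (h 2).trans (congrArg (· * _) (pow_one s).symm)
  · exact hw

theorem point_eq {v v' : Fin 3 → ℂ} {w w' : ℂ} {hv : v ≠ 0} {hv' : v' ≠ 0}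
    {h : w ^ 2 + sextic v = 0} {h' : w' ^ 2 + sextic v' = 0} (s : ℂ) (hs : s ≠ 0)
    (hvv : ∀ i, v' i = s * v i) (hww : w' = s ^ 3 * w) : point v w hv h = point v' w' hv' h' := by
  obtain ⟨a, ha, h1, h2⟩ := exists_point v w hv h
  obtain ⟨b, hb, h3, h4⟩ := exists_point v' w' hv' h'
  refine ext_of_scale (s * a / b) (by positivity) (fun i => ?_) ?_
  · have := hvv i
    rw [h1, h3] at this
    field_simp
    linear_combination this
  · rw [h4, h2] at hww
    field_simp
    linear_combination hww

theorem point_self (p : K3) : point p.xyz p.w p.xyz_ne p.equation = p := by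
  obtain ⟨a, ha, h1, h2⟩ := exists_point p.xyz p.w p.xyz_ne p.equation
  exact ext_of_scale a ha h1 h2

theorem exists_eq_point (p : K3) : ∃ v w hv h, p = point v w hv h :=
  ⟨_, _, _, _, p.point_self.symm⟩

end K3

theorem coverMap_point (v : Fin 3 → ℂ) (w : ℂ) (hv : v ≠ 0) (h : w ^ 2 + sextic v = 0) :
    coverMap (K3.point v w hv h) = Projectivization.mk ℂ v hv := by
  obtain ⟨a, ha, h1, h2⟩ := K3.exists_point v w hv h
  exact proj_mk_eq a h1

section Morphisms

variable {X ι : Type} [HomogeneousCoordinates X ι]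

theorem isMorphism_toProj {n : ℕ} {φ : X → ℙ ℂ (Fin n → ℂ)}
    (h : ∀ x : X, ∃ (d : ℕ) (P : Fin n → MvPolynomial ι ℂ) (e : ℕ) (s : MvPolynomial ι ℂ),
      (∀ j, IsForm X (P j) d) ∧ IsForm X s e ∧ evalAt s x ≠ 0 ∧
      ∀ y, evalAt s y ≠ 0 → ∃ hne : (fun j => evalAt (P j) y) ≠ 0,
        φ y = Projectivization.mk ℂ _ hne) : IsMorphism φ := by
  refine isMorphism_of_forms fun x => ?_
  obtain ⟨d, P, e, s, hP, hs, hsx, hy⟩ := h x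
  refine ⟨d, P, e, s, fun j => (hP j).cast (mul_one d).symm, hs, hsx, fun y hsy => ?_⟩
  obtain ⟨hne, hφ⟩ := hy y hsy
  obtain ⟨l, hl, hl'⟩ := exists_rep_mk _ hne
  refine ⟨l, hl, fun j => ?_⟩
  rw [hφ]
  change _ = l ^ 1 * _
  rw [pow_one]
  exact hl' j

theorem isMorphism_toK3 {φ : X → K3}
    (h : ∀ x : X, ∃ (d : ℕ) (P : Fin 3 → MvPolynomial ι ℂ) (R : MvPolynomial ι ℂ) (e : ℕ)
      (s : MvPolynomial ι ℂ),
      (∀ j, IsForm X (P j) d) ∧ IsForm X R (d * 3) ∧ IsForm X s e ∧ evalAt s x ≠ 0 ∧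
      ∀ y, evalAt s y ≠ 0 → ∃ hne heq,
        φ y = K3.point (fun j => evalAt (P j) y) (evalAt R y) hne heq) : IsMorphism φ := by
  refine isMorphism_of_forms fun x => ?_
  obtain ⟨d, P, R, e, s, hP, hR, hs, hsx, hy⟩ := h x
  refine ⟨d, ![P 0, P 1, P 2, R], e, s, fun j => ?_, hs, hsx, fun y hsy => ?_⟩
  · fin_cases j
    · exact (hP 0).cast (mul_one d).symm
    · exact (hP 1).cast (mul_one d).symm
    · exact (hP 2).cast (mul_one d).symm
    · exact hR
  · obtain ⟨hne, heq, hφ⟩ := hy y hsy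
    obtain ⟨l, hl, hl', hw⟩ := K3.exists_point _ _ hne heq
    refine ⟨l, hl, fun j => ?_⟩
    rw [hφ]
    fin_cases j
    · exact (hl' 0).trans (by rw [← pow_one l, ← pow_mul]; rfl)
    · exact (hl' 1).trans (by rw [← pow_one l, ← pow_mul]; rfl)
    · exact (hl' 2).trans (by rw [← pow_one l, ← pow_mul]; rfl)
    · exact hw

theorem IsMorphism.codRestrict {Y κ : Type} [HomogeneousCoordinates Y κ] {φ : X → Y}
    (hφ : IsMorphism φ) {T : Set Y} (h : ∀ x, φ x ∈ T) :
    IsMorphism (fun x => (⟨φ x, h x⟩ : T)) := by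
  classical
  rintro x f ⟨e, a, b, ha, hb, hbx, hab⟩
  have hf : RegularAt (fun y : Y => if hy : y ∈ T then f ⟨y, hy⟩ else evalAt a y / evalAt b y)
      (φ x) := by
    refine ⟨e, a, b, ha, hb, hbx, fun y hy => ?_⟩
    by_cases hT : y ∈ T
    · simp only [dif_pos hT]
      exact hab ⟨y, hT⟩ hy
    · simp only [dif_neg hT]
  refine (hφ x _ hf).congr (near_of_forall fun y => ?_)
  simp only [Function.comp_apply, dif_pos (h y)]

end Morphisms

/-- The coordinates of the value of a linear map, as linear forms in some of the variables. -/
def linForm {ι : Type} {n m : ℕ} (A : (Fin n → ℂ) →ₗ[ℂ] (Fin m → ℂ)) (c : Fin n → ι) (j : Fin m) :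
    MvPolynomial ι ℂ :=
  ∑ i, C (A (fun k => if i = k then 1 else 0) j) * MvPolynomial.X (c i)

theorem eval_linForm {ι : Type} {n m : ℕ} (A : (Fin n → ℂ) →ₗ[ℂ] (Fin m → ℂ)) (c : Fin n → ι)
    (j : Fin m) (v : ι → ℂ) : eval v (linForm A c j) = A (fun i => v (c i)) j := by
  rw [LinearMap.pi_apply_eq_sum_univ A]
  simp [linForm, mul_comm]

theorem isForm_linForm {X ι : Type} [HomogeneousCoordinates X ι] {n m d : ℕ}
    (A : (Fin n → ℂ) →ₗ[ℂ] (Fin m → ℂ)) {c : Fin n → ι}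
    (hc : ∀ i, HomogeneousCoordinates.weight X (c i) = d) (j : Fin m) :
    IsForm X (linForm A c j) d :=
  IsForm.sum fun i _ => ((isForm_X (c i)).C_mul _).cast (hc i)

/-- A projective transformation is a morphism. -/
theorem isMorphism_smul {n : ℕ} (A : LinearMap.GeneralLinearGroup ℂ (Fin n → ℂ)) :
    IsMorphism (fun p : ℙ ℂ (Fin n → ℂ) => A • p) := by
  refine isMorphism_toProj fun x => ⟨1, linForm A.1 id, 0, 1,
    isForm_linForm _ fun _ => rfl, isForm_one, by simp, fun y _ => ?_⟩
  have key : (fun j => evalAt (linForm A.1 id j) y) = A • HomogeneousCoordinates.rep y := by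
    ext j
    exact eval_linForm _ _ _ _
  have hne : A • HomogeneousCoordinates.rep y ≠ 0 := (smul_ne_zero_iff_ne A).2 y.rep_nonzero
  refine ⟨by rw [key]; exact hne, ?_⟩
  conv_lhs => rw [← proj_mk_rep y, Projectivization.smul_mk]
  simp only [key]


/-! ### The covariant vector field of the Hesse pencil -/

/-- The quartic vector field `∇(x³ + y³ + z³) × ∇(xyz) / 3`. -/
def hesseField (v : Fin 3 → ℂ) : Fin 3 → ℂ :=
  ![v 0 * (v 1 ^ 3 - v 2 ^ 3), v 1 * (v 2 ^ 3 - v 0 ^ 3), v 2 * (v 0 ^ 3 - v 1 ^ 3)]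

/-- The Jacobian matrix of the vector field `hesseField`. -/
def hesseJacobian (v : Fin 3 → ℂ) : Matrix (Fin 3) (Fin 3) ℂ :=
  !![v 1 ^ 3 - v 2 ^ 3, 3 * v 0 * v 1 ^ 2, -3 * v 0 * v 2 ^ 2;
    -3 * v 1 * v 0 ^ 2, v 2 ^ 3 - v 0 ^ 3, 3 * v 1 * v 2 ^ 2;
    3 * v 2 * v 0 ^ 2, -3 * v 2 * v 1 ^ 2, v 0 ^ 3 - v 1 ^ 3]

/-- The five-point central difference formula is exact for polynomials of degree four. It expresses
the Jacobian by values of the field alone, so a covariance of the field passes to its Jacobian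
without differentiation. -/
theorem hesseJacobian_mulVec (v u : Fin 3 → ℂ) :
    (12 : ℂ) • (hesseJacobian v).toLin' u = (8 : ℂ) • (hesseField (v + u) - hesseField (v - u)) -
      (hesseField (v + (2 : ℂ) • u) - hesseField (v - (2 : ℂ) • u)) := by
  ext i
  fin_cases i <;>
  · simp [hesseJacobian, hesseField, dotProduct, Fin.sum_univ_three]
    ring

/-- This is the source of the invariance of the sextic: a trace is unchanged by conjugation, so the
sextic inherits the covariance of the vector field. -/
theorem trace_hesseJacobian_sq (v : Fin 3 → ℂ) :
    LinearMap.trace ℂ _ ((hesseJacobian v).toLin' * (hesseJacobian v).toLin') = 2 * sextic v := by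
  rw [Module.End.mul_eq_comp, ← Matrix.toLin'_mul, Matrix.trace_toLin'_eq]
  simp [hesseJacobian, Matrix.trace, Fin.sum_univ_three, sextic]
  ring

/-- The sextic form is an invariant of the linear maps that preserve the vector field. -/
theorem sextic_of_covariant {M : LinearMap.GeneralLinearGroup ℂ (Fin 3 → ℂ)} {c : ℂ}
    (h : ∀ v, hesseField (M • v) = c • M • hesseField v) (v : Fin 3 → ℂ) :
    sextic (M • v) = c ^ 2 * sextic v := by
  -- The chain rule for the covariance, J(Mv)M = cMJ(v), read off from the difference formula at v
  -- and at Mv.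
  have hJ : ∀ u, (hesseJacobian (M • v)).toLin' (M • u) = c • M • (hesseJacobian v).toLin' u := by
    intro u
    have h1 := hesseJacobian_mulVec (M • v) (M • u)
    have hl : ∀ (s : ℂ) (u : Fin 3 → ℂ), M • s • u = s • M • u := fun s u =>
      (M : (Fin 3 → ℂ) →ₗ[ℂ] (Fin 3 → ℂ)).map_smul s u
    rw [← hl, ← smul_add, ← smul_sub, ← smul_add, ← smul_sub, h, h, h, h] at h1
    have h2 := congrArg (fun x => c • M • x) (hesseJacobian_mulVec v u)
    simp only [hl, smul_sub] at h1 h2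
    have h3 : (12 : ℂ) • (hesseJacobian (M • v)).toLin' (M • u)
        = (12 : ℂ) • c • M • (hesseJacobian v).toLin' u := by
      rw [h1, smul_comm (12 : ℂ) c, h2]
      simp only [smul_comm c (8 : ℂ)]
    exact smul_right_injective _ (by norm_num : (12 : ℂ) ≠ 0) h3
  set J := (hesseJacobian v).toLin'
  set J' := (hesseJacobian (M • v)).toLin'
  have hc : J' * M.1 = c • (M.1 * J) := LinearMap.ext hJ
  have hJ' : J' = c • (M.1 * J * M.inv) := by
    calc J' = J' * M.1 * M.inv := by rw [mul_assoc, M.val_inv, mul_one]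
      _ = _ := by rw [hc, smul_mul_assoc]
  have htr : LinearMap.trace ℂ _ (J' * J') = c ^ 2 * LinearMap.trace ℂ _ (J * J) := by
    have : J' * J' = (c ^ 2) • (M.1 * (J * J) * M.inv) := by
      have e : J' * J' = (c ^ 2) • (M.1 * J * (M.inv * M.1) * J * M.inv) := by
        rw [hJ', smul_mul_smul_comm, sq]
        simp only [mul_assoc]
      rw [e, M.inv_val]
      simp only [mul_assoc, one_mul]
    rw [this, map_smul, smul_eq_mul]
    congr 1
    rw [LinearMap.trace_mul_comm, ← mul_assoc, M.inv_val, one_mul]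
  rw [trace_hesseJacobian_sq, trace_hesseJacobian_sq] at htr
  linear_combination htr / 2

/-! ### Lifts of the Hessian group -/

/-- The projective transformation of the plane defined by a linear map. -/
def planeAction : LinearMap.GeneralLinearGroup ℂ (Fin 3 → ℂ) →* Equiv.Perm P2 :=
  MulAction.toPermHom _ _

/-- The pairs `(M, c)` such that `M` represents an element of the Hessian group and
the map `(v, w) ↦ (M v, c w)` preserves the double plane. -/
def hesseLifts : Subgroup (LinearMap.GeneralLinearGroup ℂ (Fin 3 → ℂ) × ℂˣ) where
  carrier := {m | planeAction m.1 ∈ hessianGroup ∧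
    ∀ v, hesseField (m.1 • v) = (m.2 : ℂ) • m.1 • hesseField v}
  one_mem' := ⟨by rw [Prod.fst_one, map_one]; exact one_mem _, fun v => by simp⟩
  mul_mem' := by
    rintro ⟨M, c⟩ ⟨N, d⟩ ⟨h1, h2⟩ ⟨h3, h4⟩
    refine ⟨by simpa only [Prod.mk_mul_mk, map_mul] using mul_mem h1 h3, fun v => ?_⟩
    simp only [Prod.mk_mul_mk, mul_smul, Units.val_mul] at *
    rw [h2, h4]
    congr 1
    exact (M : (Fin 3 → ℂ) →ₗ[ℂ] (Fin 3 → ℂ)).map_smul _ _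
  inv_mem' := by
    rintro ⟨M, c⟩ ⟨h1, h2⟩
    refine ⟨by simpa only [Prod.inv_mk, map_inv] using inv_mem h1, fun v => ?_⟩
    have h := h2 (M⁻¹ • v)
    simp only [smul_inv_smul] at h
    simp only [Prod.inv_mk]
    have hl : ∀ (s : ℂ) (u : Fin 3 → ℂ), M⁻¹ • s • u = s • M⁻¹ • u := fun s u =>
      (M⁻¹.1 : (Fin 3 → ℂ) →ₗ[ℂ] (Fin 3 → ℂ)).map_smul s u
    rw [h, hl, inv_smul_smul, smul_smul]
    simp

/-- The group of lifts. -/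
abbrev HesseLift : Type := hesseLifts

namespace HesseLift

variable (m : HesseLift)

/-- The linear map of a lift. -/
abbrev lin : LinearMap.GeneralLinearGroup ℂ (Fin 3 → ℂ) := m.1.1

/-- The scalar of a lift. -/
abbrev scalar : ℂ := (m.1.2 : ℂ)

theorem field_smul (v : Fin 3 → ℂ) : hesseField (m.lin • v) = m.scalar • m.lin • hesseField v :=
  m.2.2 v

theorem equation {v : Fin 3 → ℂ} {w : ℂ} (h : w ^ 2 + sextic v = 0) :
    (m.scalar * w) ^ 2 + sextic (m.lin • v) = 0 := by
  rw [sextic_of_covariant m.field_smul]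
  linear_combination m.scalar ^ 2 * h

instance : SMul HesseLift K3 where
  smul m p := K3.point (m.lin • p.xyz) (m.scalar * p.w)
    ((smul_ne_zero_iff_ne _).2 p.xyz_ne) (m.equation p.equation)

/-- The action is defined on chosen representatives; linearity in v and the weight 3 of w make it
independent of the choice. -/
theorem smul_point (v : Fin 3 → ℂ) (w : ℂ) (hv : v ≠ 0) (h : w ^ 2 + sextic v = 0) :
    m • K3.point v w hv h = K3.point (m.lin • v) (m.scalar * w)
      ((smul_ne_zero_iff_ne _).2 hv) (m.equation h) := by
  obtain ⟨s, hs, h1, h2⟩ := K3.exists_point v w hv h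
  refine K3.point_eq s hs (fun i => ?_) (by rw [mul_left_comm, ← h2])
  have : v = s • (K3.point v w hv h).xyz := funext h1
  conv_lhs => rw [this]
  exact congrFun ((m.lin : (Fin 3 → ℂ) →ₗ[ℂ] (Fin 3 → ℂ)).map_smul s _) i

instance : MulAction HesseLift K3 where
  one_smul p := by
    obtain ⟨v, w, hv, h, rfl⟩ := p.exists_eq_point
    rw [smul_point]
    exact K3.point_eq 1 one_ne_zero (fun i => by rw [one_mul]; exact congrFun (one_smul _ v).symm i)
      (by rw [one_pow, one_mul]; exact (one_mul w).symm)
  mul_smul m n p := by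
    obtain ⟨v, w, hv, h, rfl⟩ := p.exists_eq_point
    rw [smul_point, smul_point, smul_point]
    refine K3.point_eq 1 one_ne_zero (fun i => ?_) ?_
    · rw [one_mul, smul_smul]
      rfl
    · rw [one_pow, one_mul, ← mul_assoc]
      rfl

theorem coverMap_smul (p : K3) : coverMap (m • p) = m.lin • coverMap p := by
  obtain ⟨v, w, hv, h, rfl⟩ := p.exists_eq_point
  rw [smul_point, coverMap_point, coverMap_point, Projectivization.smul_mk]

theorem isMorphism_smul : IsMorphism (fun p : K3 => m • p) := by
  refine isMorphism_toK3 fun x => ⟨1, linForm m.lin.1 ![0, 1, 2], C m.scalar * X 3, 0, 1,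
    isForm_linForm _ fun i => by fin_cases i <;> rfl, (isForm_X (X := K3) 3).C_mul _, isForm_one,
    by simp, fun y _ => ?_⟩
  have key : (fun j => evalAt (linForm m.lin.1 ![0, 1, 2] j) y) = m.lin • y.xyz := by
    ext j
    refine (eval_linForm _ _ _ _).trans ?_
    have : (fun i => K3.rep y (![0, 1, 2] i)) = y.xyz := by
      ext i; fin_cases i <;> rfl
    exact congrArg (fun u => m.lin.1 u j) this
  have key2 : evalAt (C m.scalar * X 3) y = m.scalar * y.w := by
    rw [evalAt_mul, evalAt_C, evalAt_X]
    rfl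
  refine ⟨by rw [key]; exact (smul_ne_zero_iff_ne _).2 y.xyz_ne,
    by rw [key, key2]; exact m.equation y.equation, ?_⟩
  conv_lhs => rw [← K3.point_self y, smul_point]
  simp only [key, key2]

/-- The element of the Hessian group below a lift. -/
def toHessian : HesseLift →* hessianGroup where
  toFun m := ⟨planeAction m.lin, m.2.1⟩
  map_one' := Subtype.ext (map_one planeAction)
  map_mul' m n := Subtype.ext (map_mul planeAction m.lin n.lin)

theorem toHessian_apply (p : P2) : (toHessian m).1 p = m.lin • p := rfl

theorem exists_scalar {M : LinearMap.GeneralLinearGroup ℂ (Fin 3 → ℂ)} (h : ∀ p : P2, M • p = p) :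
    ∃ s : ℂ, s ≠ 0 ∧ ∀ v : Fin 3 → ℂ, M • v = s • v := by
  have hv : ∀ v : Fin 3 → ℂ, ∃ a : ℂ, M • v = a • v := by
    intro v
    by_cases hv : v = 0
    · exact ⟨0, by rw [hv]; simp⟩
    have := h (Projectivization.mk ℂ v hv)
    rw [Projectivization.smul_mk, Projectivization.mk_eq_mk_iff'] at this
    obtain ⟨a, ha⟩ := this
    exact ⟨a, ha.symm⟩
  obtain ⟨s, hs⟩ := LinearMap.exists_eq_smul_id_of_forall_notLinearIndependent
    (f := (M : (Fin 3 → ℂ) →ₗ[ℂ] (Fin 3 → ℂ))) fun v hli => by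
      obtain ⟨a, ha⟩ := hv v
      have := LinearIndependent.pair_iff.1 hli a (-1) (by
        rw [show M.1 v = a • v from ha]; simp)
      simpa using this.2
  have hs' : ∀ v : Fin 3 → ℂ, M • v = s • v := fun v => by
    change M.1 v = _
    rw [hs]
    rfl
  refine ⟨s, ?_, hs'⟩
  rintro rfl
  have h0 : M • (1 : Fin 3 → ℂ) ≠ 0 := (smul_ne_zero_iff_ne M).2 one_ne_zero
  exact h0 (by rw [hs', zero_smul])

/-- A lift that is trivial on the plane is a scalar s. The field has degree four, so s⁴ = cs and c =
s³, which is the factor by which w is rescaled in weighted projective space. -/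
theorem toHessian_ker : toHessian.ker ≤ (MulAction.toPermHom HesseLift K3).ker := by
  intro m hm
  rw [MonoidHom.mem_ker] at hm ⊢
  obtain ⟨s, hs, h⟩ := exists_scalar (M := m.lin) fun p => by
    rw [← toHessian_apply, hm]
    rfl
  have hc : m.scalar = s ^ 3 := by
    -- At (1, 2, 0) the first component of the field is 8, so comparing both sides determines c.
    have h1 := congrFun (m.field_smul ![1, 2, 0]) 0
    rw [h, h] at h1
    simp [hesseField] at h1
    have h2 : (m.scalar - s ^ 3) * (8 * s) = 0 := by linear_combination -h1
    exact sub_eq_zero.1 ((mul_eq_zero.1 h2).resolve_right (by simpa using hs))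
  ext p : 1
  obtain ⟨v, w, hv, hp, rfl⟩ := p.exists_eq_point
  change m • K3.point v w hv hp = K3.point v w hv hp
  rw [smul_point]
  refine (K3.point_eq s hs (fun i => ?_) (by rw [hc])).symm
  rw [h]
  rfl

end HesseLift


/-! ### The action of the Hessian group -/

theorem mk_mem_zeroLocus {n e : ℕ} {f : MvPolynomial (Fin n) ℂ}
    (hf : IsForm (ℙ ℂ (Fin n → ℂ)) f e) {v : Fin n → ℂ} (hv : v ≠ 0) :
    Projectivization.mk ℂ v hv ∈ zeroLocus (ℙ ℂ (Fin n → ℂ)) f ↔ eval v f = 0 := by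
  obtain ⟨s, hs, h⟩ := exists_rep_mk v hv
  have h' : eval v f = s ^ e * evalAt f (Projectivization.mk ℂ v hv) :=
    hf.eval_scale fun i => (h i).trans (congrArg (· * _) (pow_one s).symm)
  rw [h', mul_eq_zero, or_iff_right (pow_ne_zero e hs)]
  rfl

theorem isForm_hesseCubic (a b : ℂ) : IsForm P2 (hesseCubic a b) 3 := by
  have h : ∀ i : Fin 3, IsForm P2 (X i) 1 := fun i => isForm_X (X := P2) i
  exact (((((h 0).pow 3).add ((h 1).pow 3)).add ((h 2).pow 3)).C_mul a).add
    ((((h 0).mul (h 1)).mul (h 2)).C_mul b)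

/-- The Fermat cubic. -/
def fermatCubic (v : Fin 3 → ℂ) : ℂ := v 0 ^ 3 + v 1 ^ 3 + v 2 ^ 3

/-- The product of the coordinates. -/
def coordProd (v : Fin 3 → ℂ) : ℂ := v 0 * v 1 * v 2

theorem eval_hesseCubic (a b : ℂ) (v : Fin 3 → ℂ) :
    eval v (hesseCubic a b) = a * fermatCubic v + b * coordProd v := by
  simp [hesseCubic, fermatCubic, coordProd]

theorem mk_mem_hesse {a b : ℂ} {v : Fin 3 → ℂ} (hv : v ≠ 0) :
    Projectivization.mk ℂ v hv ∈ zeroLocus P2 (hesseCubic a b) ↔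
      a * fermatCubic v + b * coordProd v = 0 := by
  rw [mk_mem_zeroLocus (isForm_hesseCubic a b), eval_hesseCubic]

/-- Cubic forms that vanish at the base points of the Hesse pencil belong to the pencil. -/
theorem exists_eq_hesse_of_vanish {ε : ℂ} (hε : ε ^ 2 + ε + 1 = 0)
    {c30 c03 c00 c21 c20 c12 c02 c10 c01 c11 : ℂ} {f : (Fin 3 → ℂ) → ℂ}
    (hf : ∀ v, f v = c30 * v 0 ^ 3 + c03 * v 1 ^ 3 + c00 * v 2 ^ 3 + c21 * v 0 ^ 2 * v 1
      + c20 * v 0 ^ 2 * v 2 + c12 * v 0 * v 1 ^ 2 + c02 * v 1 ^ 2 * v 2 + c10 * v 0 * v 2 ^ 2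
      + c01 * v 1 * v 2 ^ 2 + c11 * v 0 * v 1 * v 2)
    (h : ∀ v, v ≠ 0 → fermatCubic v = 0 → coordProd v = 0 → f v = 0) :
    ∃ a b, ∀ v, f v = a * fermatCubic v + b * coordProd v := by
  have hε3 : ε ^ 3 = 1 := by linear_combination (ε - 1) * hε
  -- The nine base points lie three on each coordinate line. Vanishing at three points of such a
  -- line determines the restricted binary cubic up to a factor: equal pure cubes and no mixed
  -- terms.
  have key : ∀ ζ : ℂ, ζ ^ 3 = 1 → f ![0, 1, -ζ] = 0 ∧ f ![1, 0, -ζ] = 0 ∧ f ![1, -ζ, 0] = 0 := by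
    intro ζ hζ
    refine ⟨h _ (fun h0 => one_ne_zero (congrFun h0 1)) ?_ ?_,
      h _ (fun h0 => one_ne_zero (congrFun h0 0)) ?_ ?_,
      h _ (fun h0 => one_ne_zero (congrFun h0 0)) ?_ ?_⟩ <;>
    simp [fermatCubic, coordProd] <;> linear_combination -hζ
  obtain ⟨p1, q1, r1⟩ := key 1 (one_pow 3)
  obtain ⟨p2, q2, r2⟩ := key ε hε3
  obtain ⟨p3, q3, r3⟩ := key (ε ^ 2) (by rw [← pow_mul, mul_comm, pow_mul, hε3, one_pow])
  rw [hf] at p1 q1 r1 p2 q2 r2 p3 q3 r3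
  simp at p1 q1 r1 p2 q2 r2 p3 q3 r3
  have a1 : c03 - c00 = 0 := by grind
  have a2 : c02 = 0 := by grind
  have a3 : c01 = 0 := by grind
  have b1 : c30 - c00 = 0 := by grind
  have b2 : c20 = 0 := by grind
  have b3 : c10 = 0 := by grind
  have d2 : c21 = 0 := by grind
  have d3 : c12 = 0 := by grind
  refine ⟨c00, c11, fun v => ?_⟩
  rw [hf, fermatCubic, coordProd, a2, a3, b2, b3, d2, d3]
  linear_combination v 1 ^ 3 * a1 + v 0 ^ 3 * b1

/-- The common zeros of the two generators are the points common to all members, a description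
depending only on the pencil as a set of curves. The Hessian group therefore permutes them. -/
theorem base_point_iff {v : Fin 3 → ℂ} (hv : v ≠ 0) :
    (∀ E ∈ hessePencil, Projectivization.mk ℂ v hv ∈ E) ↔ fermatCubic v = 0 ∧ coordProd v = 0 := by
  constructor
  · intro h
    have h1 := h _ ⟨1, 0, by simp, rfl⟩
    have h2 := h _ ⟨0, 1, by simp, rfl⟩
    rw [mk_mem_hesse] at h1 h2
    exact ⟨by simpa using h1, by simpa using h2⟩
  · rintro ⟨h1, h2⟩ _ ⟨a, b, -, rfl⟩
    rw [mk_mem_hesse, h1, h2]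
    simp

theorem base_point_smul {M : LinearMap.GeneralLinearGroup ℂ (Fin 3 → ℂ)}
    (hM : planeAction M ∈ hessianGroup) {v : Fin 3 → ℂ} (hv : v ≠ 0) (h1 : fermatCubic v = 0)
    (h2 : coordProd v = 0) : fermatCubic (M • v) = 0 ∧ coordProd (M • v) = 0 := by
  have hs : planeAction M • hessePencil = hessePencil := hM.2
  rw [← base_point_iff ((smul_ne_zero_iff_ne M).2 hv)]
  intro E hE
  rw [← hs] at hE
  obtain ⟨E', hE', rfl⟩ := hE
  exact ⟨_, (base_point_iff hv).2 ⟨h1, h2⟩ E' hE', rfl⟩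

/-- The coordinates of a linear map. -/
theorem smul_apply_coords (M : LinearMap.GeneralLinearGroup ℂ (Fin 3 → ℂ)) (v : Fin 3 → ℂ)
    (i : Fin 3) : (M • v) i = LinearMap.toMatrix' M.1 i 0 * v 0 + LinearMap.toMatrix' M.1 i 1 * v 1
      + LinearMap.toMatrix' M.1 i 2 * v 2 := by
  have : M • v = (LinearMap.toMatrix' M.1).mulVec v := (LinearMap.toMatrix'_mulVec M.1 v).symm
  rw [this]
  simp [Matrix.mulVec, dotProduct, Fin.sum_univ_three]

/-- Preserving a set of curves is turned into a statement about forms: the pull-back of a generator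
is a cubic vanishing at the nine base points, so it lies in the pencil. The named coefficients are
those of the expanded pull-back. -/
theorem exists_hesse_smul {ε : ℂ} (hε : ε ^ 2 + ε + 1 = 0)
    {M : LinearMap.GeneralLinearGroup ℂ (Fin 3 → ℂ)} (hM : planeAction M ∈ hessianGroup) :
    (∃ a b, ∀ v, fermatCubic (M • v) = a * fermatCubic v + b * coordProd v) ∧
      ∃ a b, ∀ v, coordProd (M • v) = a * fermatCubic v + b * coordProd v := by
  have hA := smul_apply_coords M
  generalize LinearMap.toMatrix' M.1 = A at hA
  constructor
  · refine exists_eq_hesse_of_vanish hε (f := fun v => fermatCubic (M • v)) (fun v => ?_)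
      (fun v hv h1 h2 => (base_point_smul hM hv h1 h2).1)
      (c30 := A 0 0 ^ 3 + A 1 0 ^ 3 + A 2 0 ^ 3) (c03 := A 0 1 ^ 3 + A 1 1 ^ 3 + A 2 1 ^ 3)
      (c00 := A 0 2 ^ 3 + A 1 2 ^ 3 + A 2 2 ^ 3)
      (c21 := 3 * (A 0 0 ^ 2 * A 0 1 + A 1 0 ^ 2 * A 1 1 + A 2 0 ^ 2 * A 2 1))
      (c20 := 3 * (A 0 0 ^ 2 * A 0 2 + A 1 0 ^ 2 * A 1 2 + A 2 0 ^ 2 * A 2 2))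
      (c12 := 3 * (A 0 0 * A 0 1 ^ 2 + A 1 0 * A 1 1 ^ 2 + A 2 0 * A 2 1 ^ 2))
      (c02 := 3 * (A 0 1 ^ 2 * A 0 2 + A 1 1 ^ 2 * A 1 2 + A 2 1 ^ 2 * A 2 2))
      (c10 := 3 * (A 0 0 * A 0 2 ^ 2 + A 1 0 * A 1 2 ^ 2 + A 2 0 * A 2 2 ^ 2))
      (c01 := 3 * (A 0 1 * A 0 2 ^ 2 + A 1 1 * A 1 2 ^ 2 + A 2 1 * A 2 2 ^ 2))
      (c11 := 6 * (A 0 0 * A 0 1 * A 0 2 + A 1 0 * A 1 1 * A 1 2 + A 2 0 * A 2 1 * A 2 2))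
    simp only [fermatCubic, hA]
    ring
  · refine exists_eq_hesse_of_vanish hε (f := fun v => coordProd (M • v)) (fun v => ?_)
      (fun v hv h1 h2 => (base_point_smul hM hv h1 h2).2)
      (c30 := A 0 0 * A 1 0 * A 2 0) (c03 := A 0 1 * A 1 1 * A 2 1)
      (c00 := A 0 2 * A 1 2 * A 2 2)
      (c21 := A 0 0 * A 1 0 * A 2 1 + A 0 0 * A 1 1 * A 2 0 + A 0 1 * A 1 0 * A 2 0)
      (c20 := A 0 0 * A 1 0 * A 2 2 + A 0 0 * A 1 2 * A 2 0 + A 0 2 * A 1 0 * A 2 0)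
      (c12 := A 0 0 * A 1 1 * A 2 1 + A 0 1 * A 1 0 * A 2 1 + A 0 1 * A 1 1 * A 2 0)
      (c02 := A 0 1 * A 1 1 * A 2 2 + A 0 1 * A 1 2 * A 2 1 + A 0 2 * A 1 1 * A 2 1)
      (c10 := A 0 0 * A 1 2 * A 2 2 + A 0 2 * A 1 0 * A 2 2 + A 0 2 * A 1 2 * A 2 0)
      (c01 := A 0 1 * A 1 2 * A 2 2 + A 0 2 * A 1 1 * A 2 2 + A 0 2 * A 1 2 * A 2 1)
      (c11 := A 0 0 * A 1 1 * A 2 2 + A 0 0 * A 1 2 * A 2 1 + A 0 1 * A 1 0 * A 2 2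
        + A 0 1 * A 1 2 * A 2 0 + A 0 2 * A 1 0 * A 2 1 + A 0 2 * A 1 1 * A 2 0)
    simp only [coordProd, hA]
    ring

/-- The vector field is a covariant of the Hesse pencil. -/
theorem exists_field_smul {M : LinearMap.GeneralLinearGroup ℂ (Fin 3 → ℂ)} {a b c d : ℂ}
    (h1 : ∀ v, fermatCubic (M • v) = a * fermatCubic v + b * coordProd v)
    (h2 : ∀ v, coordProd (M • v) = c * fermatCubic v + d * coordProd v) :
    ∃ s : ℂ, s ≠ 0 ∧ ∀ v, hesseField (M • v) = s • M • hesseField v := by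
  have hdet : (LinearMap.toMatrix' M.1).det ≠ 0 := by
    rw [LinearMap.det_toMatrix']
    exact (Units.map LinearMap.det M).ne_zero
  have hA := smul_apply_coords M
  have hfield : ∀ v, hesseField (M • v)
      = ((a * d - b * c) / (LinearMap.toMatrix' M.1).det) • M • hesseField v := by
    intro v
    generalize LinearMap.toMatrix' M.1 = A at hA hdet
    -- Polarization gives the gradient identity: for a cubic form f, half of f(v + u) − f(v − u) is
    -- the derivative at v along u plus f(u).
    have g1 : ∀ u : Fin 3 → ℂ, 3 * ((M • v) 0 ^ 2 * (M • u) 0 + (M • v) 1 ^ 2 * (M • u) 1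
        + (M • v) 2 ^ 2 * (M • u) 2) = a * (3 * (v 0 ^ 2 * u 0 + v 1 ^ 2 * u 1 + v 2 ^ 2 * u 2))
        + b * (u 0 * v 1 * v 2 + v 0 * u 1 * v 2 + v 0 * v 1 * u 2) := by
      intro u
      have e1 := h1 (v + u)
      have e2 := h1 (v - u)
      have e3 := h1 u
      rw [smul_add] at e1
      rw [smul_sub] at e2
      simp only [fermatCubic, coordProd, Pi.add_apply, Pi.sub_apply] at e1 e2 e3
      linear_combination (e1 - e2) / 2 - e3
    have g2 : ∀ u : Fin 3 → ℂ, (M • u) 0 * (M • v) 1 * (M • v) 2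
        + (M • v) 0 * (M • u) 1 * (M • v) 2 + (M • v) 0 * (M • v) 1 * (M • u) 2
        = c * (3 * (v 0 ^ 2 * u 0 + v 1 ^ 2 * u 1 + v 2 ^ 2 * u 2))
        + d * (u 0 * v 1 * v 2 + v 0 * u 1 * v 2 + v 0 * v 1 * u 2) := by
      intro u
      have e1 := h2 (v + u)
      have e2 := h2 (v - u)
      have e3 := h2 u
      rw [smul_add] at e1
      rw [smul_sub] at e2
      simp only [fermatCubic, coordProd, Pi.add_apply, Pi.sub_apply] at e1 e2 e3
      linear_combination (e1 - e2) / 2 - e3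
    have p0 := g1 ![1, 0, 0]
    have p1 := g1 ![0, 1, 0]
    have p2 := g1 ![0, 0, 1]
    have q0 := g2 ![1, 0, 0]
    have q1 := g2 ![0, 1, 0]
    have q2 := g2 ![0, 0, 1]
    rw [hA ![1, 0, 0], hA ![1, 0, 0], hA ![1, 0, 0]] at p0 q0
    rw [hA ![0, 1, 0], hA ![0, 1, 0], hA ![0, 1, 0]] at p1 q1
    rw [hA ![0, 0, 1], hA ![0, 0, 1], hA ![0, 0, 1]] at p2 q2
    simp only [Matrix.cons_val, mul_one, mul_zero, add_zero, zero_add] at p0 p1 p2 q0 q1 q2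
    have hd := Matrix.det_fin_three A
    generalize A.det = D at hd hdet
    have hH := hA (hesseField v)
    set x := (M • v) 0
    set y := (M • v) 1
    set z := (M • v) 2
    -- These are the components of the cross product of the two gradients pulled back by Aᵀ. The
    -- rest is the identity A(Aᵀp × Aᵀq) = det(A)(p × q).
    have n0 := congrArg₂ (· - ·) (congrArg₂ (· * ·) p1 q2) (congrArg₂ (· * ·) p2 q1)
    have n1 := congrArg₂ (· - ·) (congrArg₂ (· * ·) p2 q0) (congrArg₂ (· * ·) p0 q2)
    have n2 := congrArg₂ (· - ·) (congrArg₂ (· * ·) p0 q1) (congrArg₂ (· * ·) p1 q0)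
    beta_reduce at n0 n1 n2
    ext i
    rw [Pi.smul_apply, hH, smul_eq_mul, div_mul_eq_mul_div, eq_div_iff hdet]
    fin_cases i
    · change x * (y ^ 3 - z ^ 3) * D = (a * d - b * c) * (A 0 0 * (v 0 * (v 1 ^ 3 - v 2 ^ 3))
        + A 0 1 * (v 1 * (v 2 ^ 3 - v 0 ^ 3)) + A 0 2 * (v 2 * (v 0 ^ 3 - v 1 ^ 3)))
      linear_combination (A 0 0 * n0 + A 0 1 * n1 + A 0 2 * n2) / 3 + x * (y ^ 3 - z ^ 3) * hd
    · change y * (z ^ 3 - x ^ 3) * D = (a * d - b * c) * (A 1 0 * (v 0 * (v 1 ^ 3 - v 2 ^ 3))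
        + A 1 1 * (v 1 * (v 2 ^ 3 - v 0 ^ 3)) + A 1 2 * (v 2 * (v 0 ^ 3 - v 1 ^ 3)))
      linear_combination (A 1 0 * n0 + A 1 1 * n1 + A 1 2 * n2) / 3 + y * (z ^ 3 - x ^ 3) * hd
    · change z * (x ^ 3 - y ^ 3) * D = (a * d - b * c) * (A 2 0 * (v 0 * (v 1 ^ 3 - v 2 ^ 3))
        + A 2 1 * (v 1 * (v 2 ^ 3 - v 0 ^ 3)) + A 2 2 * (v 2 * (v 0 ^ 3 - v 1 ^ 3)))
      linear_combination (A 2 0 * n0 + A 2 1 * n1 + A 2 2 * n2) / 3 + z * (x ^ 3 - y ^ 3) * hd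
  refine ⟨_, ?_, hfield⟩
  intro h0
  -- The factor cannot be zero, since the field does not vanish at (1, 2, 0), a vector in the image
  -- of M.
  have h := hfield (M⁻¹ • ![1, 2, 0])
  rw [h0, zero_smul, smul_inv_smul] at h
  have := congrFun h 0
  simp [hesseField] at this

theorem toHessian_surjective {ε : ℂ} (hε : ε ^ 2 + ε + 1 = 0) :
    Function.Surjective HesseLift.toHessian := by
  rintro ⟨g, hg⟩
  obtain ⟨M, rfl⟩ := hg.1
  obtain ⟨⟨a, b, h1⟩, c, d, h2⟩ := exists_hesse_smul hε hg
  obtain ⟨s, hs, h⟩ := exists_field_smul h1 h2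
  exact ⟨⟨(M, Units.mk0 s hs), hg, h⟩, rfl⟩

/-- The action of the Hessian group on the K3 surface. -/
def hessianAction {ε : ℂ} (hε : ε ^ 2 + ε + 1 = 0) : hessianGroup →* Equiv.Perm K3 :=
  HesseLift.toHessian.liftOfSurjective (toHessian_surjective hε)
    ⟨MulAction.toPermHom HesseLift K3, HesseLift.toHessian_ker⟩

theorem hessianAction_toHessian {ε : ℂ} (hε : ε ^ 2 + ε + 1 = 0) (m : HesseLift) (p : K3) :
    hessianAction hε (HesseLift.toHessian m) p = m • p := by
  have := HesseLift.toHessian.liftOfRightInverse_comp_apply _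
    (Function.rightInverse_surjInv (toHessian_surjective hε))
    ⟨MulAction.toPermHom HesseLift K3, HesseLift.toHessian_ker⟩ m
  exact congrArg (fun σ : Equiv.Perm K3 => σ p) this

theorem isHessianAction {ε : ℂ} (hε : ε ^ 2 + ε + 1 = 0) : IsHessianAction (hessianAction hε) := by
  intro g
  obtain ⟨m, rfl⟩ := toHessian_surjective hε g
  have h : ⇑(hessianAction hε (HesseLift.toHessian m)) = fun p => m • p :=
    funext (hessianAction_toHessian hε m)
  rw [h]
  exact ⟨m.isMorphism_smul, fun p => m.coverMap_smul p⟩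

/-- The elements of the Hessian group from their effect on the forms of the Hesse pencil. -/
theorem mem_hessianGroup_of_smul {M : LinearMap.GeneralLinearGroup ℂ (Fin 3 → ℂ)} {a b c d : ℂ}
    (h1 : ∀ v, fermatCubic (M • v) = a * fermatCubic v + b * coordProd v)
    (h2 : ∀ v, coordProd (M • v) = c * fermatCubic v + d * coordProd v)
    (hδ : a * d - b * c ≠ 0) : planeAction M ∈ hessianGroup := by
  have key : ∀ s t : ℂ, planeAction M ⁻¹' (zeroLocus P2 (hesseCubic s t))
      = zeroLocus P2 (hesseCubic (s * a + t * c) (s * b + t * d)) := by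
    intro s t
    ext p
    induction p using Projectivization.ind with
    | h v hv =>
      change M • Projectivization.mk ℂ v hv ∈ zeroLocus P2 (hesseCubic s t) ↔ _
      rw [Projectivization.smul_mk, mk_mem_hesse, mk_mem_hesse, h1, h2]
      exact Eq.congr (by ring) rfl
  refine ⟨⟨M, rfl⟩, ?_⟩
  change planeAction M • hessePencil = hessePencil
  apply Set.Subset.antisymm
  · rintro _ ⟨_, ⟨s, t, hst, rfl⟩, rfl⟩
    -- The parameters of the image member come from inverting the 2×2 matrix by which M acts on the
    -- pencil.
    refine ⟨(s * d - t * c) / (a * d - b * c), (t * a - s * b) / (a * d - b * c), ?_, ?_⟩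
    · intro h
      rw [Prod.mk.injEq, div_eq_zero_iff, div_eq_zero_iff, or_iff_left hδ, or_iff_left hδ] at h
      apply hst
      have e1 : s * (a * d - b * c) = 0 := by linear_combination a * h.1 + c * h.2
      have e2 : t * (a * d - b * c) = 0 := by linear_combination b * h.1 + d * h.2
      rw [(mul_eq_zero.1 e1).resolve_right hδ, (mul_eq_zero.1 e2).resolve_right hδ]
    · change planeAction M '' _ = _
      have e1 : s = (s * d - t * c) / (a * d - b * c) * a + (t * a - s * b) / (a * d - b * c) * c := by
        rw [div_mul_eq_mul_div, div_mul_eq_mul_div, ← add_div, eq_div_iff hδ]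
        ring
      have e2 : t = (s * d - t * c) / (a * d - b * c) * b + (t * a - s * b) / (a * d - b * c) * d := by
        rw [div_mul_eq_mul_div, div_mul_eq_mul_div, ← add_div, eq_div_iff hδ]
        ring
      rw [congrArg₂ hesseCubic e1 e2, ← key]
      exact Set.image_preimage_eq _ (planeAction M).surjective
  · rintro _ ⟨s, t, hst, rfl⟩
    refine ⟨_, ⟨s * a + t * c, s * b + t * d, ?_, rfl⟩, ?_⟩
    · intro h
      rw [Prod.mk.injEq] at h
      apply hst
      have e1 : s * (a * d - b * c) = 0 := by linear_combination d * h.1 - c * h.2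
      have e2 : t * (a * d - b * c) = 0 := by linear_combination a * h.2 - b * h.1
      rw [(mul_eq_zero.1 e1).resolve_right hδ, (mul_eq_zero.1 e2).resolve_right hδ]
    · change planeAction M '' _ = _
      rw [← key]
      exact Set.image_preimage_eq _ (planeAction M).surjective


/-! ### The fibration attached to the coordinate triangle -/

/-- A primitive third root of unity and a square root of three. -/
structure RootData where
  ε : ℂ
  r : ℂ
  hε : ε ^ 2 + ε + 1 = 0
  hr : r ^ 2 = 3

namespace RootData

variable (k : RootData)

theorem ε_cube : k.ε ^ 3 = 1 := by linear_combination (k.ε - 1) * k.hε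

theorem ε_ne_zero : k.ε ≠ 0 := by
  intro h
  have := k.hε
  rw [h] at this
  simp at this

theorem ε_ne_one : k.ε ≠ 1 := by
  intro h
  have := k.hε
  rw [h] at this
  norm_num at this

theorem r_ne_zero : k.r ≠ 0 := by
  intro h
  have := k.hr
  rw [h] at this
  norm_num at this

end RootData

/-- The diagonal cubic form with coefficients `c`. -/
def diagCubic (c v : Fin 3 → ℂ) : ℂ := c 0 * v 0 ^ 3 + c 1 * v 1 ^ 3 + c 2 * v 2 ^ 3

theorem diagCubic_scale {c v v' : Fin 3 → ℂ} {s : ℂ} (h : ∀ i, v' i = s * v i) :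
    diagCubic c v' = s ^ 3 * diagCubic c v := by
  simp only [diagCubic, h]
  ring

/-- The diagonal cubic form with coefficients `c`, in four variables. -/
def diagForm (c : Fin 3 → ℂ) : MvPolynomial (Fin 4) ℂ :=
  C (c 0) * X 0 ^ 3 + C (c 1) * X 1 ^ 3 + C (c 2) * X 2 ^ 3

theorem isForm_K3_X (i : Fin 3) : IsForm K3 (X i.castSucc) 1 := by
  have h := isForm_X (X := K3) i.castSucc
  fin_cases i <;> exact h

theorem isForm_diagForm (c : Fin 3 → ℂ) : IsForm K3 (diagForm c) 3 :=
  (((((isForm_K3_X 0).pow 3).C_mul _)).add (((isForm_K3_X 1).pow 3).C_mul _)).add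
    (((isForm_K3_X 2).pow 3).C_mul _)

theorem isForm_w : IsForm K3 (X 3 : MvPolynomial (Fin 4) ℂ) 3 := isForm_X (X := K3) 3

theorem evalAt_w (p : K3) : evalAt (X 3 : MvPolynomial (Fin 4) ℂ) p = p.w := evalAt_X _ _

@[simp] theorem evalAt_diagForm (c : Fin 3 → ℂ) (p : K3) :
    evalAt (diagForm c) p = diagCubic c p.xyz := by
  simp only [diagForm, evalAt_add, evalAt_mul, evalAt_C, evalAt_pow, evalAt_X]
  rfl

namespace RootData

variable (k : RootData)

/-- The sum of the cubes of the coordinates. -/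
def S (v : Fin 3 → ℂ) : ℂ := diagCubic 1 v

/-- The form `x³ + ε y³ + ε² z³`. -/
def U (v : Fin 3 → ℂ) : ℂ := diagCubic ![1, k.ε, k.ε ^ 2] v

/-- The form `x³ + ε² y³ + ε z³`. -/
def V (v : Fin 3 → ℂ) : ℂ := diagCubic ![1, k.ε ^ 2, k.ε] v

/-- In the cubes X, Y, Z of the coordinates, UV is the sum of the squares minus the sum of the
products of pairs. Subtracting 3S² from 4UV leaves coefficient 1 on squares and −4 − 6 = −10 on
products. -/
theorem sextic_eq (v : Fin 3 → ℂ) : sextic v = 4 * k.U v * k.V v - 3 * S v ^ 2 := by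
  have h := k.hε
  simp only [sextic, U, V, S, diagCubic, Pi.one_apply, Matrix.cons_val]
  generalize k.ε = ε at h
  generalize v 0 = x, v 1 = y, v 2 = z
  grind

/-- S, U, V form the discrete Fourier transform of the three cubes, which is invertible. -/
theorem eq_zero_of_forms {v : Fin 3 → ℂ} (h1 : S v = 0) (h2 : k.U v = 0) (h3 : k.V v = 0) :
    v = 0 := by
  have h := k.hε
  simp only [U, V, S, diagCubic, Pi.one_apply, Matrix.cons_val] at h1 h2 h3
  generalize k.ε = ε at h h2 h3
  have a0 : v 0 ^ 3 = 0 := by grind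
  have a1 : v 1 ^ 3 = 0 := by grind
  have a2 : v 2 ^ 3 = 0 := by grind
  ext i
  fin_cases i
  · exact pow_eq_zero_iff (three_ne_zero) |>.1 a0
  · exact pow_eq_zero_iff (three_ne_zero) |>.1 a1
  · exact pow_eq_zero_iff (three_ne_zero) |>.1 a2

/-- The first equation of a fibre. -/
def E₁ (t : Fin 2 → ℂ) (v : Fin 3 → ℂ) (w : ℂ) : ℂ := t 1 * (w - k.r * S v) - 2 * t 0 * k.U v

/-- The second equation of a fibre. -/
def E₂ (t : Fin 2 → ℂ) (v : Fin 3 → ℂ) (w : ℂ) : ℂ := t 0 * (w + k.r * S v) + 2 * t 1 * k.V v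

theorem product_eq {v : Fin 3 → ℂ} {w : ℂ} (h : w ^ 2 + sextic v = 0) :
    (w - k.r * S v) * (w + k.r * S v) = -4 * k.U v * k.V v := by
  have := k.sextic_eq v
  linear_combination h - this - S v ^ 2 * k.hr

/-- The two rows never vanish at the same point of the surface, so the fibration has no base points
and is everywhere given by one of them. -/
theorem row_ne_zero {v : Fin 3 → ℂ} {w : ℂ} (hv : v ≠ 0)
    (h : ![w - k.r * S v, 2 * k.U v] = 0) : ![-2 * k.V v, w + k.r * S v] ≠ 0 := by
  intro h'
  have h1 : w - k.r * S v = 0 := congrFun h 0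
  have h2 : 2 * k.U v = 0 := congrFun h 1
  have h3 : -2 * k.V v = 0 := congrFun h' 0
  have h4 : w + k.r * S v = 0 := congrFun h' 1
  refine hv (k.eq_zero_of_forms ?_ (by linear_combination h2 / 2) (by linear_combination -h3 / 2))
  have : k.r * S v = 0 := by linear_combination (h4 - h1) / 2
  exact (mul_eq_zero.1 this).resolve_left k.r_ne_zero

open Classical in
/-- The elliptic fibration `[w - r S : 2 U] = [-2 V : w + r S]`. -/
def fib (p : K3) : P1 :=
  if h : ![p.w - k.r * S p.xyz, 2 * k.U p.xyz] = 0 then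
    Projectivization.mk ℂ _ (k.row_ne_zero p.xyz_ne h)
  else Projectivization.mk ℂ _ h

theorem fib_eq_iff (p : K3) {t : Fin 2 → ℂ} (ht : t ≠ 0) :
    k.fib p = Projectivization.mk ℂ t ht ↔ k.E₁ t p.xyz p.w = 0 ∧ k.E₂ t p.xyz p.w = 0 := by
  have hp := k.product_eq p.equation
  unfold fib
  split_ifs with h
  · have h1 : p.w - k.r * S p.xyz = 0 := congrFun h 0
    have h2 : 2 * k.U p.xyz = 0 := congrFun h 1
    rw [P1_mk_eq_iff, and_iff_right (by unfold E₁; linear_combination t 1 * h1 - t 0 * h2)]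
    simp only [Matrix.cons_val, E₂]
    constructor <;> intro h <;> linear_combination -h
  · rw [P1_mk_eq_iff]
    simp only [Matrix.cons_val]
    constructor
    · intro h1
      have h2 : k.E₁ t p.xyz p.w = 0 := by
        unfold E₁
        linear_combination h1
      refine ⟨h2, ?_⟩
      by_contra h3
      apply h
      -- By the determinantal relation each entry of the first row times E₂ is a multiple of E₁. As
      -- the row is not zero, E₂ vanishes along with E₁.
      have h4 : (p.w - k.r * S p.xyz) * k.E₂ t p.xyz p.w = 0 := by
        have : (p.w - k.r * S p.xyz) * k.E₂ t p.xyz p.w = 2 * k.V p.xyz * k.E₁ t p.xyz p.w := by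
          unfold E₁ E₂
          linear_combination t 0 * hp
        rw [this, h2, mul_zero]
      have h5 : (2 * k.U p.xyz) * k.E₂ t p.xyz p.w = 0 := by
        have : (2 * k.U p.xyz) * k.E₂ t p.xyz p.w
            = -(p.w + k.r * S p.xyz) * k.E₁ t p.xyz p.w := by
          unfold E₁ E₂
          linear_combination t 1 * hp
        rw [this, h2, mul_zero]
      ext i
      fin_cases i
      · exact (mul_eq_zero.1 h4).resolve_right h3
      · exact (mul_eq_zero.1 h5).resolve_right h3
    · rintro ⟨h1, -⟩
      unfold E₁ at h1
      linear_combination h1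

theorem fib_point_eq_iff {v : Fin 3 → ℂ} {w : ℂ} (hv : v ≠ 0) (h : w ^ 2 + sextic v = 0)
    {t : Fin 2 → ℂ} (ht : t ≠ 0) : k.fib (K3.point v w hv h) = Projectivization.mk ℂ t ht ↔
      k.E₁ t v w = 0 ∧ k.E₂ t v w = 0 := by
  obtain ⟨s, hs, h1, h2⟩ := K3.exists_point v w hv h
  rw [fib_eq_iff]
  have e1 : k.E₁ t v w = s ^ 3 * k.E₁ t (K3.point v w hv h).xyz (K3.point v w hv h).w := by
    simp only [E₁, S, U, diagCubic_scale h1]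
    linear_combination t 1 * h2
  have e2 : k.E₂ t v w = s ^ 3 * k.E₂ t (K3.point v w hv h).xyz (K3.point v w hv h).w := by
    simp only [E₂, S, V, diagCubic_scale h1]
    linear_combination t 0 * h2
  rw [e1, e2, mul_eq_zero, mul_eq_zero, or_iff_right (pow_ne_zero 3 hs),
    or_iff_right (pow_ne_zero 3 hs)]

/-- The coefficients of the plane cubic below a fibre. -/
def coef (t : Fin 2 → ℂ) : Fin 3 → ℂ :=
  ![t 0 ^ 2 + k.r * t 0 * t 1 + t 1 ^ 2, k.ε * t 0 ^ 2 + k.r * t 0 * t 1 + k.ε ^ 2 * t 1 ^ 2,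
    k.ε ^ 2 * t 0 ^ 2 + k.r * t 0 * t 1 + k.ε * t 1 ^ 2]

theorem diagCubic_coef (t : Fin 2 → ℂ) (v : Fin 3 → ℂ) :
    diagCubic (k.coef t) v = t 0 ^ 2 * k.U v + k.r * t 0 * t 1 * S v + t 1 ^ 2 * k.V v := by
  simp only [diagCubic, coef, U, V, S, Matrix.cons_val, Pi.one_apply]
  ring

/-- The last coordinate as a cubic form on a fibre; `e` is a vector with
`t 1 * e 0 - t 0 * e 1 = 1`. -/
def wForm (t e : Fin 2 → ℂ) (v : Fin 3 → ℂ) : ℂ :=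
  e 0 * (k.r * t 1 * S v + 2 * t 0 * k.U v) + e 1 * (k.r * t 0 * S v + 2 * t 1 * k.V v)

/-- The combination t₁E₂ − t₀E₁ is free of w and equals twice the plane cubic; in e₀E₁ − e₁E₂ the
coefficient of w is t₁e₀ − t₀e₁ = 1, which solves for w as a cubic form. The vector e avoids a
distinction between the two affine charts of the line. -/
theorem fibre_equations {t e : Fin 2 → ℂ} (he : t 1 * e 0 - t 0 * e 1 = 1) {v : Fin 3 → ℂ} {w : ℂ} :
    k.E₁ t v w = 0 ∧ k.E₂ t v w = 0 ↔ diagCubic (k.coef t) v = 0 ∧ w = k.wForm t e v := by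
  rw [diagCubic_coef]
  unfold E₁ E₂ wForm
  constructor
  · rintro ⟨h1, h2⟩
    constructor
    · linear_combination (t 1 * h2 - t 0 * h1) / 2
    · linear_combination e 0 * h1 - e 1 * h2 - w * he
  · rintro ⟨h1, h2⟩
    constructor
    · linear_combination t 1 * h2 + (k.r * t 1 * S v + 2 * t 0 * k.U v) * he + 2 * e 1 * h1
    · linear_combination t 0 * h2 - (k.r * t 0 * S v + 2 * t 1 * k.V v) * he + 2 * e 0 * h1

theorem wForm_equation {t e : Fin 2 → ℂ} (he : t 1 * e 0 - t 0 * e 1 = 1) {v : Fin 3 → ℂ}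
    (h : diagCubic (k.coef t) v = 0) : k.wForm t e v ^ 2 + sextic v = 0 := by
  rw [diagCubic_coef] at h
  rw [k.sextic_eq, wForm]
  have hr := k.hr
  linear_combination (4 * e 0 ^ 2 * k.U v + 4 * k.r * e 0 * e 1 * S v + 4 * e 1 ^ 2 * k.V v) * h
    + (3 * S v ^ 2 - 4 * k.U v * k.V v) * (t 1 * e 0 - t 0 * e 1 + 1) * he
    + (e 0 * t 1 - e 1 * t 0) ^ 2 * S v ^ 2 * hr

theorem exists_complement {t : Fin 2 → ℂ} (ht : t ≠ 0) :
    ∃ e : Fin 2 → ℂ, t 1 * e 0 - t 0 * e 1 = 1 := by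
  by_cases h : t 1 = 0
  · have h0 : t 0 ≠ 0 := fun h0 => ht (by ext i; fin_cases i <;> assumption)
    exact ⟨![0, -(t 0)⁻¹], by simp [h0]⟩
  · exact ⟨![(t 1)⁻¹, 0], by simp [h]⟩

theorem fib_eq_iff' (p : K3) {t e : Fin 2 → ℂ} (ht : t ≠ 0) (he : t 1 * e 0 - t 0 * e 1 = 1) :
    k.fib p = Projectivization.mk ℂ t ht ↔
      diagCubic (k.coef t) p.xyz = 0 ∧ p.w = k.wForm t e p.xyz := by
  rw [fib_eq_iff, fibre_equations k he]

/-- The forms of the first row. -/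
def row₁ : Fin 2 → MvPolynomial (Fin 4) ℂ :=
  ![X 3 - C k.r * diagForm 1, C 2 * diagForm ![1, k.ε, k.ε ^ 2]]

/-- The forms of the second row. -/
def row₂ : Fin 2 → MvPolynomial (Fin 4) ℂ :=
  ![C (-2) * diagForm ![1, k.ε ^ 2, k.ε], X 3 + C k.r * diagForm 1]

theorem isForm_row₁ (j : Fin 2) : IsForm K3 (k.row₁ j) 3 := by
  fin_cases j
  · exact isForm_w.sub ((isForm_diagForm _).C_mul _)
  · exact (isForm_diagForm _).C_mul _

theorem isForm_row₂ (j : Fin 2) : IsForm K3 (k.row₂ j) 3 := by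
  fin_cases j
  · exact (isForm_diagForm _).C_mul _
  · exact isForm_w.add ((isForm_diagForm _).C_mul _)

theorem evalAt_row₁ (p : K3) :
    (fun j => evalAt (k.row₁ j) p) = ![p.w - k.r * S p.xyz, 2 * k.U p.xyz] := by
  ext j
  fin_cases j
  · change evalAt (X 3 - C k.r * diagForm 1) p = _
    rw [evalAt_sub, evalAt_mul, evalAt_w, evalAt_C, evalAt_diagForm]
    rfl
  · change evalAt (C 2 * diagForm _) p = _
    rw [evalAt_mul, evalAt_C, evalAt_diagForm]
    rfl

theorem evalAt_row₂ (p : K3) :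
    (fun j => evalAt (k.row₂ j) p) = ![-2 * k.V p.xyz, p.w + k.r * S p.xyz] := by
  ext j
  fin_cases j
  · change evalAt (C (-2) * diagForm _) p = _
    rw [evalAt_mul, evalAt_C, evalAt_diagForm]
    rfl
  · change evalAt (X 3 + C k.r * diagForm 1) p = _
    rw [evalAt_add, evalAt_mul, evalAt_w, evalAt_C, evalAt_diagForm]
    rfl

theorem fib_eq_row₁ {p : K3} (h : (fun j => evalAt (k.row₁ j) p) ≠ 0) :
    k.fib p = Projectivization.mk ℂ _ h := by
  rw [fib_eq_iff, evalAt_row₁]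
  have := k.product_eq p.equation
  simp only [E₁, E₂, Matrix.cons_val]
  constructor
  · ring
  · linear_combination this

theorem fib_eq_row₂ {p : K3} (h : (fun j => evalAt (k.row₂ j) p) ≠ 0) :
    k.fib p = Projectivization.mk ℂ _ h := by
  rw [fib_eq_iff, evalAt_row₂]
  have := k.product_eq p.equation
  simp only [E₁, E₂, Matrix.cons_val]
  constructor
  · linear_combination this
  · ring

/-- Near every point the fibration is given by a row of forms, one of which does not vanish. -/
theorem exists_row (p : K3) : ∃ L : Fin 2 → MvPolynomial (Fin 4) ℂ, (L = k.row₁ ∨ L = k.row₂) ∧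
    ∃ i, evalAt (L i) p ≠ 0 := by
  by_cases h : ![p.w - k.r * S p.xyz, 2 * k.U p.xyz] = 0
  · have h2 := k.row_ne_zero p.xyz_ne h
    rw [← evalAt_row₂] at h2
    exact ⟨_, Or.inr rfl, Function.ne_iff.1 h2⟩
  · rw [← evalAt_row₁] at h
    exact ⟨_, Or.inl rfl, Function.ne_iff.1 h⟩

theorem isMorphism_fib : IsMorphism k.fib := by
  refine isMorphism_toProj fun x => ?_
  obtain ⟨L, hL, i, hi⟩ := k.exists_row x
  have hform : ∀ j, IsForm K3 (L j) 3 := by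
    rcases hL with rfl | rfl
    exacts [k.isForm_row₁, k.isForm_row₂]
  refine ⟨3, L, 3, L i, hform, hform i, hi, fun y hy => ?_⟩
  have hne : (fun j => evalAt (L j) y) ≠ 0 := fun h0 => hy (congrFun h0 i)
  rcases hL with rfl | rfl
  exacts [⟨hne, k.fib_eq_row₁ hne⟩, ⟨hne, k.fib_eq_row₂ hne⟩]

end RootData


/-! ### Local parameters of the projective line -/

/-- The numerator of a local parameter. -/
def paramNum (t : Fin 2 → ℂ) : MvPolynomial (Fin 2) ℂ := C (t 1) * X 0 - C (t 0) * X 1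

theorem isForm_paramNum (t : Fin 2 → ℂ) : IsForm P1 (paramNum t) 1 :=
  ((isForm_X (X := P1) 0).C_mul _).sub ((isForm_X (X := P1) 1).C_mul _)

@[simp] theorem eval_paramNum (t u : Fin 2 → ℂ) : eval u (paramNum t) = t 1 * u 0 - t 0 * u 1 := by
  simp [paramNum]

/-- The local parameter at the point `t` of the projective line that takes the value `s` at the
point `t + s e`, where `t 1 * e 0 - t 0 * e 1 = 1`. -/
def localParam (t e : Fin 2 → ℂ) (y : P1) : ℂ := -(evalAt (paramNum t) y / evalAt (paramNum e) y)

theorem localParam_mk (t e : Fin 2 → ℂ) {u : Fin 2 → ℂ} (hu : u ≠ 0) :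
    localParam t e (Projectivization.mk ℂ u hu)
      = (t 1 * u 0 - t 0 * u 1) / (e 0 * u 1 - e 1 * u 0) := by
  obtain ⟨s, hs, h⟩ := exists_rep_mk u hu
  have h1 : ∀ i, u i = s ^ HomogeneousCoordinates.weight P1 i
      * HomogeneousCoordinates.rep (Projectivization.mk ℂ u hu) i :=
    fun i => (h i).trans (congrArg (· * _) (pow_one s).symm)
  have e1 := (isForm_paramNum t).eval_scale h1
  have e2 := (isForm_paramNum e).eval_scale h1
  rw [eval_paramNum] at e1 e2
  rw [localParam, evalAt, evalAt, ← mul_div_mul_left _ _ (pow_ne_zero 1 hs), ← e1, ← e2, ← div_neg,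
    neg_sub]

theorem isMaximal_localParam {t e : Fin 2 → ℂ} (ht : t ≠ 0) (he : t 1 * e 0 - t 0 * e 1 = 1) :
    InMaximalIdeal (localParam t e) (Projectivization.mk ℂ t ht) := by
  refine ⟨?_, by rw [localParam_mk]; ring⟩
  have h : evalAt (paramNum e) (Projectivization.mk ℂ t ht) ≠ 0 := by
    intro h0
    have : Projectivization.mk ℂ t ht ∈ zeroLocus P1 (paramNum e) := h0
    rw [mk_mem_zeroLocus (isForm_paramNum e), eval_paramNum] at this
    have h1 : (1 : ℂ) = 0 := by linear_combination -he - this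
    exact one_ne_zero h1
  exact (((RegularAt.const (-1) _).mul
    (RegularAt.quotient (isForm_paramNum t) (isForm_paramNum e) h))).congr
    (near_of_forall fun y => by rw [localParam]; ring)

/-- The maximal ideal of a point of the projective line is generated by a local parameter. -/
theorem InMaximalIdeal.exists_eq_mul {t e : Fin 2 → ℂ} {ht : t ≠ 0}
    (he : t 1 * e 0 - t 0 * e 1 = 1) {f : P1 → ℂ}
    (hf : InMaximalIdeal f (Projectivization.mk ℂ t ht)) :
    ∃ c : P1 → ℂ, RegularAt c (Projectivization.mk ℂ t ht) ∧
      Near (Projectivization.mk ℂ t ht) (fun y => f y = localParam t e y * c y) := by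
  obtain ⟨⟨d, a, b, ha, hb, hbt, hab⟩, hf0⟩ := hf
  have hτ := isMaximal_localParam ht he
  have hden : evalAt (paramNum e) (Projectivization.mk ℂ t ht) ≠ 0 := by
    intro h0
    have : Projectivization.mk ℂ t ht ∈ zeroLocus P1 (paramNum e) := h0
    rw [mk_mem_zeroLocus (isForm_paramNum e), eval_paramNum] at this
    have h1 : (1 : ℂ) = 0 := by linear_combination -he - this
    exact one_ne_zero h1
  -- Dehomogenization along s ↦ t + s e, the affine chart of the line centred at t in which the
  -- local parameter is the coordinate s.
  let L : MvPolynomial (Fin 2) ℂ →ₐ[ℂ] Polynomial ℂ :=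
    aeval fun j => Polynomial.C (t j) + Polynomial.C (e j) * Polynomial.X
  have hL : ∀ (g : MvPolynomial (Fin 2) ℂ) (s : ℂ), (L g).eval s = eval (fun j => t j + s * e j) g := by
    intro g s
    induction g using MvPolynomial.induction_on with
    | C c =>
      rw [show L (C c) = Polynomial.C c from algHom_C L c, Polynomial.eval_C, eval_C]
    | add p q hp hq => rw [map_add, Polynomial.eval_add, hp, hq, map_add]
    | mul_X p j hp =>
      rw [map_mul, Polynomial.eval_mul, hp, map_mul, eval_X,
        show L (X j) = Polynomial.C (t j) + Polynomial.C (e j) * Polynomial.X from aeval_X _ j,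
        Polynomial.eval_add, Polynomial.eval_mul, Polynomial.eval_C, Polynomial.eval_C,
        Polynomial.eval_X, mul_comm s]
  have hval : ∀ (g : MvPolynomial (Fin 2) ℂ), IsForm P1 g d → ∀ y : P1,
      evalAt (paramNum e) y ≠ 0 →
      evalAt g y = (-evalAt (paramNum e) y) ^ d * (L g).eval (localParam t e y) := by
    intro g hg y hy
    rw [hL]
    refine hg.eval_scale fun i => ?_
    have hy' := hy
    change _ = (-evalAt (paramNum e) y) ^ 1 * _
    rw [localParam]
    have : evalAt (paramNum t) y = t 1 * HomogeneousCoordinates.rep y 0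
      - t 0 * HomogeneousCoordinates.rep y 1 := eval_paramNum _ _
    have h2 : evalAt (paramNum e) y = e 1 * HomogeneousCoordinates.rep y 0
      - e 0 * HomogeneousCoordinates.rep y 1 := eval_paramNum _ _
    have h3 : HomogeneousCoordinates.rep y i
        = -evalAt (paramNum e) y * t i + evalAt (paramNum t) y * e i := by
      rw [this, h2]
      fin_cases i
      · change HomogeneousCoordinates.rep y 0 = _ * t 0 + _ * e 0
        linear_combination -HomogeneousCoordinates.rep y 0 * he
      · change HomogeneousCoordinates.rep y 1 = _ * t 1 + _ * e 1
        linear_combination -HomogeneousCoordinates.rep y 1 * he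
    rw [h3]
    field_simp
    ring
  have hb0 : (L b).eval 0 ≠ 0 := by
    intro h0
    apply hbt
    rw [hval b hb _ hden, hτ.2, h0, mul_zero]
  have ha0 : (L a).eval 0 = 0 := by
    have h1 := hab _ hbt
    rw [hf0, eq_comm, div_eq_zero_iff, or_iff_left hbt, hval a ha _ hden, hτ.2, mul_eq_zero] at h1
    exact h1.resolve_left (pow_ne_zero _ (neg_ne_zero.2 hden))
  -- Vanishing of the function at t means that the dehomogenized numerator has no constant term, so
  -- the parameter can be split off.
  obtain ⟨q, hq⟩ : Polynomial.X ∣ L a := by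
    rw [Polynomial.X_dvd_iff, Polynomial.coeff_zero_eq_eval_zero, ha0]
  refine ⟨fun y => q.eval (localParam t e y) * ((L b).eval (localParam t e y))⁻¹,
    (hτ.1.polynomial q).mul ((hτ.1.polynomial (L b)).inv (by rw [hτ.2]; exact hb0)), ?_⟩
  refine ((near_ne_zero hb hbt).and (near_ne_zero (isForm_paramNum e) hden)).mono ?_
  rintro y ⟨h1, h2⟩
  rw [hab y h1, hval a ha y h2, hval b hb y h2,
    mul_div_mul_left _ _ (pow_ne_zero _ (neg_ne_zero.2 h2)), hq, Polynomial.eval_mul,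
    Polynomial.eval_X, div_eq_mul_inv, mul_assoc]

/-! ### Curves with holomorphic parametrizations -/

section Curves

variable {X ι : Type} [HomogeneousCoordinates X ι]

/-- The curve `p` has holomorphic homogeneous coordinates `γ` near `0`. -/
structure IsCurve (p : ℂ → X) (γ : ℂ → ι → ℂ) : Prop where
  differentiable : ∀ i, DifferentiableAt ℂ (fun τ => γ τ i) 0
  scale : ∀ᶠ τ in nhds (0 : ℂ), ∃ s : ℂ, s ≠ 0 ∧
    ∀ i, γ τ i = s ^ HomogeneousCoordinates.weight X i * HomogeneousCoordinates.rep (p τ) i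

variable {p : ℂ → X} {γ : ℂ → ι → ℂ}

theorem IsCurve.differentiableAt_eval (h : IsCurve p γ) (a : MvPolynomial ι ℂ) :
    DifferentiableAt ℂ (fun τ => eval (γ τ) a) 0 := by
  induction a using MvPolynomial.induction_on with
  | C c => simp
  | add f g hf hg => simpa using hf.fun_add hg
  | mul_X f i hf => simpa using hf.fun_mul (h.differentiable i)

theorem IsCurve.eventually_ne (h : IsCurve p γ) {b : MvPolynomial ι ℂ} {e : ℕ} (hb : IsForm X b e)
    (h0 : evalAt b (p 0) ≠ 0) : ∀ᶠ τ in nhds (0 : ℂ), evalAt b (p τ) ≠ 0 := by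
  have h1 : eval (γ 0) b ≠ 0 := by
    obtain ⟨s, hs, hsc⟩ := h.scale.self_of_nhds
    rw [hb.eval_scale hsc]
    exact mul_ne_zero (pow_ne_zero _ hs) h0
  filter_upwards [h.scale, (h.differentiableAt_eval b).continuousAt.eventually_ne h1] with τ h2 h3
  obtain ⟨s, hs, hsc⟩ := h2
  rw [hb.eval_scale hsc] at h3
  exact right_ne_zero_of_mul h3

theorem IsCurve.eventually_near (h : IsCurve p γ) {P : X → Prop} (hP : Near (p 0) P) :
    ∀ᶠ τ in nhds (0 : ℂ), P (p τ) := by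
  obtain ⟨e, b, hb, hb0, hP⟩ := near_iff.1 hP
  exact (h.eventually_ne hb hb0).mono fun τ hτ => hP _ hτ

theorem IsCurve.differentiableAt (h : IsCurve p γ) {f : X → ℂ} (hf : RegularAt f (p 0)) :
    DifferentiableAt ℂ (fun τ => f (p τ)) 0 := by
  obtain ⟨e, a, b, ha, hb, hb0, hab⟩ := hf
  have h1 : eval (γ 0) b ≠ 0 := by
    obtain ⟨s, hs, hsc⟩ := h.scale.self_of_nhds
    rw [hb.eval_scale hsc]
    exact mul_ne_zero (pow_ne_zero _ hs) hb0
  refine DifferentiableAt.congr_of_eventuallyEq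
    ((h.differentiableAt_eval a).div (h.differentiableAt_eval b) h1) ?_
  filter_upwards [h.scale, h.eventually_ne hb hb0] with τ h2 h3
  obtain ⟨s, hs, hsc⟩ := h2
  rw [hab _ h3, Pi.div_apply, ha.eval_scale hsc, hb.eval_scale hsc,
    mul_div_mul_left _ _ (pow_ne_zero _ hs)]
  rfl

/-- A function that is a parameter along some curve is not in the square of the maximal ideal. -/
theorem IsCurve.not_inMaximalIdealSq (h : IsCurve p γ) {g : X → ℂ}
    (hg : ∀ᶠ τ in nhds (0 : ℂ), g (p τ) = τ) : ¬ InMaximalIdealSq g (p 0) := by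
  rintro ⟨n, a, b, hab, hn⟩
  -- By the product rule an element of the square of the maximal ideal has zero derivative along the
  -- curve, whereas τ has derivative 1.
  have h1 : HasDerivAt (fun τ => ∑ k, a k (p τ) * b k (p τ)) 0 0 := by
    have : HasDerivAt (fun τ => ∑ k, a k (p τ) * b k (p τ)) (∑ k : Fin n, 0) 0 := by
      refine HasDerivAt.fun_sum fun k _ => ?_
      have := (h.differentiableAt (hab k).1.1).hasDerivAt.fun_mul (h.differentiableAt (hab k).2.1).hasDerivAt
      simpa [(hab k).1.2, (hab k).2.2] using this
    simpa using this
  have h2 : (fun τ => ∑ k, a k (p τ) * b k (p τ)) =ᶠ[nhds 0] fun τ => τ := by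
    filter_upwards [h.eventually_near hn, hg] with τ h3 h4
    rw [← h3, h4]
  have h3 := (h1.congr_of_eventuallyEq h2.symm).unique (hasDerivAt_id' (0 : ℂ))
  exact zero_ne_one h3

end Curves

/-! ### Smooth points of the fibres -/

namespace RootData

variable (k : RootData)

theorem coef_scale (s : ℂ) {c v : Fin 3 → ℂ} (i : Fin 3) :
    diagCubic c (Function.update v i (v i * s)) = diagCubic c v + c i * v i ^ 3 * (s ^ 3 - 1) := by
  fin_cases i <;> simp [diagCubic] <;> ring

theorem differentiable_coef (t e : Fin 2 → ℂ) (i : Fin 3) :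
    Differentiable ℂ (fun τ : ℂ => k.coef (t + τ • e) i) := by
  fin_cases i <;> simp [coef] <;> fun_prop

/-- A curve transversal to the fibre is built through x: the base point moves along t + τe, two
plane coordinates stay fixed, and coordinate i follows so that the point stays on the moving cubic.
Along it the local parameter is τ. The hypothesis says that the i-th partial derivative of the cubic
does not vanish at x. -/
theorem fibreSmoothAt {x : K3} {t : Fin 2 → ℂ} (ht : t ≠ 0)
    (hx : k.fib x = Projectivization.mk ℂ t ht) {i : Fin 3} (hi : k.coef t i * x.xyz i ≠ 0) :
    FibreSmoothAt k.fib x := by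
  classical
  obtain ⟨e, he⟩ := exists_complement ht
  have hxt := (k.fib_eq_iff' x ht he).1 hx
  refine ⟨localParam t e, by rw [hx]; exact isMaximal_localParam ht he, ?_⟩
  let u : ℂ → Fin 2 → ℂ := fun τ => t + τ • e
  have hue : ∀ τ, u τ 1 * e 0 - u τ 0 * e 1 = 1 := fun τ => by
    simp only [u, Pi.add_apply, Pi.smul_apply, smul_eq_mul]
    linear_combination he
  have hu : ∀ τ, u τ ≠ 0 := fun τ h0 => by
    have := hue τ
    rw [h0] at this
    simp at this
  have hu0 : u 0 = t := by simp [u]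
  -- The cube of the factor by which coordinate i has to be multiplied, solved from the equation of
  -- the moving cubic. It equals 1 at τ = 0, so the principal cube root is holomorphic there.
  let g : ℂ → ℂ := fun τ => 1 - diagCubic (k.coef (u τ)) x.xyz / (k.coef (u τ) i * x.xyz i ^ 3)
  have hxi : x.xyz i ≠ 0 := right_ne_zero_of_mul hi
  have hci : k.coef (u 0) i ≠ 0 := by
    rw [hu0]
    exact left_ne_zero_of_mul hi
  have hg0 : g 0 = 1 := by simp [g, hu0, hxt.1]
  have hcd : ∀ j, Differentiable ℂ (fun τ => k.coef (u τ) j) := fun j => k.differentiable_coef t e j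
  have hgd : DifferentiableAt ℂ g 0 := by
    refine (differentiableAt_const _).sub (DifferentiableAt.fun_div ?_ ?_ ?_)
    · have h0 := hcd 0 0
      have h1 := hcd 1 0
      have h2 := hcd 2 0
      simp only [diagCubic]
      fun_prop
    · exact (hcd i 0).mul_const _
    · exact mul_ne_zero hci (pow_ne_zero 3 hxi)
  let v : ℂ → Fin 3 → ℂ := fun τ => Function.update x.xyz i (x.xyz i * g τ ^ (1 / 3 : ℂ))
  have hrd : DifferentiableAt ℂ (fun τ => g τ ^ (1 / 3 : ℂ)) 0 := by
    refine hgd.cpow_const ?_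
    rw [hg0]
    exact Complex.one_mem_slitPlane
  have hv0 : v 0 = x.xyz := by simp [v, hg0]
  have hvd : ∀ j, DifferentiableAt ℂ (fun τ => v τ j) 0 := by
    intro j
    by_cases hj : j = i
    · subst hj
      simpa [v] using (hrd.const_mul (x.xyz j))
    · simp [v, Function.update_of_ne hj]
  let w : ℂ → ℂ := fun τ => k.wForm (u τ) e (v τ)
  have hw0 : w 0 = x.w := by
    simp only [w, hu0, hv0]
    exact hxt.2.symm
  have hwd : DifferentiableAt ℂ w 0 := by
    have h0 := hvd 0
    have h1 := hvd 1
    have h2 := hvd 2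
    simp only [w, wForm, S, U, V, diagCubic, u, Pi.add_apply, Pi.smul_apply, smul_eq_mul,
      Matrix.cons_val, Pi.one_apply]
    fun_prop
  have hev : ∀ᶠ τ in nhds (0 : ℂ), v τ ≠ 0 ∧ diagCubic (k.coef (u τ)) (v τ) = 0 := by
    have h1 : ∀ᶠ τ in nhds (0 : ℂ), v τ ≠ 0 := by
      have : v 0 i ≠ 0 := by rwa [hv0]
      filter_upwards [(hvd i).continuousAt.eventually_ne this] with τ h h0
      exact h (congrFun h0 i)
    filter_upwards [h1, (hcd i 0).continuousAt.eventually_ne hci] with τ h2 h3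
    refine ⟨h2, ?_⟩
    have h4 : (g τ ^ (1 / 3 : ℂ)) ^ 3 = g τ := by
      rw [← Complex.cpow_nat_mul]
      norm_num
    rw [coef_scale, h4]
    simp only [g]
    field_simp
    ring
  -- The default value x is irrelevant: the condition holds for all τ near 0.
  let p : ℂ → K3 := fun τ =>
    if h : v τ ≠ 0 ∧ w τ ^ 2 + sextic (v τ) = 0 then K3.point (v τ) (w τ) h.1 h.2 else x
  have hp : ∀ τ (h : v τ ≠ 0 ∧ w τ ^ 2 + sextic (v τ) = 0), p τ = K3.point (v τ) (w τ) h.1 h.2 :=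
    fun τ h => dif_pos h
  have hp0 : p 0 = x := by
    rw [hp 0 (by rw [hv0, hw0]; exact ⟨x.xyz_ne, x.equation⟩)]
    simp only [hv0, hw0]
    exact x.point_self
  have hcurve : IsCurve p (fun τ => ![v τ 0, v τ 1, v τ 2, w τ]) := by
    refine ⟨fun j => ?_, ?_⟩
    · fin_cases j
      exacts [hvd 0, hvd 1, hvd 2, hwd]
    · filter_upwards [hev] with τ hτ
      have h := And.intro hτ.1 (k.wForm_equation (hue τ) hτ.2)
      obtain ⟨s, hs, h1, h2⟩ := K3.exists_point (v τ) (w τ) h.1 h.2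
      refine ⟨s, hs, fun j => ?_⟩
      rw [hp τ h]
      fin_cases j
      · exact (h1 0).trans (congrArg (· * _) (pow_one s).symm)
      · exact (h1 1).trans (congrArg (· * _) (pow_one s).symm)
      · exact (h1 2).trans (congrArg (· * _) (pow_one s).symm)
      · exact h2
  rw [← hp0]
  refine hcurve.not_inMaximalIdealSq ?_
  filter_upwards [hev] with τ hτ
  have h := And.intro hτ.1 (k.wForm_equation (hue τ) hτ.2)
  have h2 : k.fib (p τ) = Projectivization.mk ℂ (u τ) (hu τ) := by
    rw [hp τ h, fib_point_eq_iff, fibre_equations k (hue τ)]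
    exact ⟨hτ.2, rfl⟩
  rw [Function.comp_apply, h2, localParam_mk]
  have h3 : e 0 * u τ 1 - e 1 * u τ 0 = 1 := by linear_combination hue τ
  rw [h3, div_one]
  simp only [u, Pi.add_apply, Pi.smul_apply, smul_eq_mul]
  linear_combination τ * he

end RootData


/-! ### Divisibility of polynomials -/

/-- A polynomial differs from its value at a point by an element of the ideal of the point. -/
theorem exists_point_division {σ : Type} [Fintype σ] (a : σ → ℂ) (g : MvPolynomial σ ℂ) :
    ∃ q : σ → MvPolynomial σ ℂ, g = C (eval a g) + ∑ i, (X i - C (a i)) * q i := by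
  classical
  induction g using MvPolynomial.induction_on with
  | C c => exact ⟨0, by simp⟩
  | add f g hf hg =>
    obtain ⟨p, hp⟩ := hf
    obtain ⟨q, hq⟩ := hg
    refine ⟨fun i => p i + q i, ?_⟩
    simp only [mul_add, Finset.sum_add_distrib, map_add]
    linear_combination hp + hq
  | mul_X f j hf =>
    obtain ⟨p, hp⟩ := hf
    refine ⟨fun i => p i * X j + (if i = j then C (eval a f) else 0), ?_⟩
    simp only [mul_add, Finset.sum_add_distrib, mul_ite, mul_zero, Finset.sum_ite_eq',
      Finset.mem_univ, if_true, ← mul_assoc, ← Finset.sum_mul, map_mul, eval_X]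
    linear_combination X j * hp

/-- The diagonal cubic form with coefficients `c`, in three variables. -/
def diagPoly (c : Fin 3 → ℂ) : MvPolynomial (Fin 3) ℂ :=
  C (c 0) * X 0 ^ 3 + C (c 1) * X 1 ^ 3 + C (c 2) * X 2 ^ 3

/-- The part of a diagonal cubic form that does not involve the first variable. -/
def diagTail (c : Fin 3 → ℂ) : MvPolynomial (Fin 2) ℂ :=
  C (c 1 / c 0) * X 0 ^ 3 + C (c 2 / c 0) * X 1 ^ 3

theorem eval_diagPoly (c v : Fin 3 → ℂ) : eval v (diagPoly c) = diagCubic c v := by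
  simp [diagPoly, diagCubic]

theorem rename_diagPoly (c : Fin 3 → ℂ) : rename Fin.castSucc (diagPoly c) = diagForm c := by
  simp [diagPoly, diagForm]

theorem finSuccEquiv_diagPoly {c : Fin 3 → ℂ} (h0 : c 0 ≠ 0) :
    finSuccEquiv ℂ 2 (diagPoly c)
      = Polynomial.C (C (c 0)) * (Polynomial.X ^ 3 + Polynomial.C (diagTail c)) := by
  have h1 : finSuccEquiv ℂ 2 (X 1) = Polynomial.C (X 0) := finSuccEquiv_X_succ (j := 0)
  have h2 : finSuccEquiv ℂ 2 (X 2) = Polynomial.C (X 1) := finSuccEquiv_X_succ (j := 1)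
  have hC : ∀ a : ℂ, finSuccEquiv ℂ 2 (C a) = Polynomial.C (C a) := fun a => by
    rw [← MvPolynomial.algebraMap_eq, AlgEquiv.commutes]
    rfl
  have hT : C (c 0) * diagTail c = C (c 1) * X 0 ^ 3 + C (c 2) * X 1 ^ 3 := by
    rw [diagTail, mul_add, ← mul_assoc, ← mul_assoc, ← C_mul, ← C_mul,
      show c 0 * (c 1 / c 0) = c 1 by field_simp, show c 0 * (c 2 / c 0) = c 2 by field_simp]
  rw [mul_add, ← Polynomial.C_mul, hT, diagPoly]
  simp only [map_add, map_mul, map_pow, finSuccEquiv_X_zero, h1, h2, hC]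
  ring

theorem diagTail_ne_zero {c : Fin 3 → ℂ} (h0 : c 0 ≠ 0) (h1 : c 1 ≠ 0) : diagTail c ≠ 0 := by
  intro h
  have := congrArg (eval ![1, 0]) h
  simp [diagTail, h0, h1] at this

/-- A polynomial that vanishes on a reduced diagonal cubic is divisible by its equation. -/
theorem diagPoly_dvd (k : RootData) {c : Fin 3 → ℂ} (h0 : c 0 ≠ 0) (h1 : c 1 ≠ 0)
    {G : MvPolynomial (Fin 3) ℂ} (hG : ∀ v, v ≠ 0 → diagCubic c v = 0 → eval v G = 0) :
    diagPoly c ∣ G := by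
  set P : Polynomial (MvPolynomial (Fin 2) ℂ) := Polynomial.X ^ 3 + Polynomial.C (diagTail c)
  have hP : P.Monic := Polynomial.monic_X_pow_add_C _ three_ne_zero
  have hPd : P.natDegree = 3 := Polynomial.natDegree_X_pow_add_C
  -- In the first variable the cubic is a unit times a monic polynomial of degree three, so
  -- divisibility means that the remainder, of degree below three, is zero.
  have hr : finSuccEquiv ℂ 2 G %ₘ P = 0 := by
    set R := finSuccEquiv ℂ 2 G %ₘ P with hR
    have hdeg : R.natDegree < 3 := by
      rw [← hPd]
      refine Polynomial.natDegree_modByMonic_lt _ hP ?_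
      intro h
      rw [h] at hPd
      simp at hPd
    have hGR : finSuccEquiv ℂ 2 G = R + P * (finSuccEquiv ℂ 2 G /ₘ P) :=
      (Polynomial.modByMonic_add_div _ P).symm
    -- Where the tail is nonzero, the specialized cubic has three distinct roots, all of them roots
    -- of the specialized remainder. The last coefficient of c may vanish, so three concurrent lines
    -- are covered.
    have hs : ∀ s : Fin 2 → ℂ, eval s (diagTail c) ≠ 0 → R.map (eval s) = 0 := by
      intro s hs
      obtain ⟨ξ, hξ⟩ := IsAlgClosed.exists_pow_nat_eq (-(eval s (diagTail c))) (n := 3) (by norm_num)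
      have hξ0 : ξ ≠ 0 := by
        rintro rfl
        apply hs
        linear_combination hξ
      have hroot : ∀ ζ : ℂ, ζ ^ 3 = 1 → (R.map (eval s)).eval (ζ * ξ) = 0 := by
        intro ζ hζ
        have h3 : (ζ * ξ) ^ 3 + eval s (diagTail c) = 0 := by
          rw [mul_pow, hζ, hξ]
          ring
        have h4 : diagCubic c (Fin.cons (ζ * ξ) s) = 0 := by
          have : diagCubic c (Fin.cons (ζ * ξ) s)
              = c 0 * ((ζ * ξ) ^ 3 + eval s (diagTail c)) := by
            simp only [diagCubic, diagTail, map_add, map_mul, map_pow, eval_C, eval_X]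
            change c 0 * (ζ * ξ) ^ 3 + c 1 * s 0 ^ 3 + c 2 * s 1 ^ 3 = _
            field_simp
            ring
          rw [this, h3, mul_zero]
        have h5 := hG _ (fun h => by
          have h6 : ζ * ξ = 0 := congrFun h 0
          have hζ0 : ζ ≠ 0 := by
            rintro rfl
            simp at hζ
          exact mul_ne_zero hζ0 hξ0 h6) h4
        rw [eval_eq_eval_mv_eval', hGR] at h5
        simp only [Polynomial.map_add, Polynomial.map_mul, Polynomial.eval_add,
          Polynomial.eval_mul, P, Polynomial.map_pow, Polynomial.map_X, Polynomial.map_C,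
          Polynomial.eval_pow, Polynomial.eval_X, Polynomial.eval_C] at h5
        rw [← h5]
        rw [h3, zero_mul, add_zero]
      have hinj : Function.Injective ![1 * ξ, k.ε * ξ, k.ε ^ 2 * ξ] := by
        have e1 := k.ε_ne_one
        have e0 := k.ε_ne_zero
        have e2 : k.ε ^ 2 ≠ 1 := by
          intro h
          have h3 := k.ε_cube
          exact e1 (by linear_combination h3 - k.ε * h)
        have e3 : k.ε ^ 2 ≠ k.ε := by
          intro h
          have : k.ε * (k.ε - 1) = 0 := by linear_combination h
          rcases mul_eq_zero.1 this with h | h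
          exacts [e0 h, e1 (sub_eq_zero.1 h)]
        intro i j hij
        fin_cases i <;> fin_cases j <;>
          simp [hξ0, e1, e2, e3, e3.symm] at hij ⊢
      refine Polynomial.eq_zero_of_natDegree_lt_card_of_eval_eq_zero _ hinj (fun i => ?_) ?_
      · have c3 : (k.ε ^ 2) ^ 3 = 1 := by rw [← pow_mul, mul_comm, pow_mul, k.ε_cube, one_pow]
        fin_cases i
        exacts [hroot 1 (one_pow 3), hroot k.ε k.ε_cube, hroot _ c3]
      · exact lt_of_le_of_lt Polynomial.natDegree_map_le (by simpa using hdeg)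
    ext1 n
    -- Multiplication by the tail removes the exceptional values of s: the product vanishes at every
    -- point, and the tail is a nonzero polynomial.
    have : R.coeff n * diagTail c = 0 := by
      apply MvPolynomial.funext
      intro s
      rw [map_mul, map_zero]
      by_cases h : eval s (diagTail c) = 0
      · rw [h, mul_zero]
      · have := congrArg (fun p => Polynomial.coeff p n) (hs s h)
        simp only [Polynomial.coeff_map, Polynomial.coeff_zero] at this
        rw [this, zero_mul]
    rw [Polynomial.coeff_zero]
    exact (mul_eq_zero.1 this).resolve_right (diagTail_ne_zero h0 h1)
  have hdvd := (Polynomial.modByMonic_eq_zero_iff_dvd hP).1 hr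
  have h2 : finSuccEquiv ℂ 2 (diagPoly c) ∣ finSuccEquiv ℂ 2 G := by
    rw [finSuccEquiv_diagPoly h0]
    refine (IsUnit.mul_left_dvd ?_).2 hdvd
    exact ((isUnit_iff_ne_zero.2 h0).map (C (σ := Fin 2))).map Polynomial.C
  exact (map_dvd_iff (finSuccEquiv ℂ 2)).1 h2

/-- An inhomogeneous division of a form by forms of equal degree becomes a homogeneous one on
passing to weighted components. Local functions require quotients of forms, so this is needed for
reducedness. -/
theorem exists_forms_of_sum {X ι : Type} [HomogeneousCoordinates X ι] {P P' c c' g : MvPolynomial ι ℂ}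
    {d m : ℕ} (hP : IsForm X P d) (hP' : IsForm X P' d) (hg : IsForm X g (d + m))
    (h : g = P * c + P' * c') :
    ∃ q q' : MvPolynomial ι ℂ, IsForm X q m ∧ IsForm X q' m ∧ g = P * q + P' * q' := by
  classical
  let _ := weightedGradedAlgebra ℂ (HomogeneousCoordinates.weight X)
  have key : ∀ (P c : MvPolynomial ι ℂ), IsForm X P d →
      weightedHomogeneousComponent (HomogeneousCoordinates.weight X) (d + m) (P * c)
        = P * weightedHomogeneousComponent (HomogeneousCoordinates.weight X) m c := by
    intro P c hP
    have := DirectSum.coe_decompose_mul_add_of_left_mem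
      (weightedHomogeneousSubmodule ℂ (HomogeneousCoordinates.weight X)) (i := d) (j := m) (a := P)
      (b := c) hP
    have e : ∀ (f : MvPolynomial ι ℂ) (n : ℕ), ((DirectSum.decompose (weightedHomogeneousSubmodule ℂ
        (HomogeneousCoordinates.weight X)) f n : _) : MvPolynomial ι ℂ)
        = weightedHomogeneousComponent (HomogeneousCoordinates.weight X) n f :=
      fun f n => weightedDecomposition.decompose'_apply _ _ _ _
    rwa [e, e] at this
  refine ⟨_, _, weightedHomogeneousComponent_isWeightedHomogeneous m c,
    weightedHomogeneousComponent_isWeightedHomogeneous m c', ?_⟩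
  rw [← key P c hP, ← key P' c' hP', ← map_add, ← h]
  exact (IsWeightedHomogeneous.weightedHomogeneousComponent_same hg).symm


/-! ### The local equation of a fibre -/

theorem RegularAt.eval {X ι σ : Type} [HomogeneousCoordinates X ι] {x : X}
    {F : σ → X → ℂ} (hF : ∀ i, RegularAt (F i) x) (g : MvPolynomial σ ℂ) :
    RegularAt (fun y => MvPolynomial.eval (fun i => F i y) g) x := by
  induction g using MvPolynomial.induction_on with
  | C c => simpa using RegularAt.const c x
  | add f g hf hg => simpa using hf.add hg
  | mul_X f i hf => simpa using hf.mul (hF i)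

namespace RootData

variable (k : RootData)

/-- The cubic form on the surface that vanishes at `p` if the row of forms `L` takes the
value `t` at `p`. -/
def rowDet (L : Fin 2 → MvPolynomial (Fin 4) ℂ) (t : Fin 2 → ℂ) : MvPolynomial (Fin 4) ℂ :=
  C (t 1) * L 0 - C (t 0) * L 1

theorem evalAt_rowDet (L : Fin 2 → MvPolynomial (Fin 4) ℂ) (t : Fin 2 → ℂ) (p : K3) :
    evalAt (rowDet L t) p = t 1 * evalAt (L 0) p - t 0 * evalAt (L 1) p := by
  rw [rowDet, evalAt_sub, evalAt_mul, evalAt_mul, evalAt_C, evalAt_C]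

theorem isForm_rowDet {L : Fin 2 → MvPolynomial (Fin 4) ℂ} (hL : ∀ j, IsForm K3 (L j) 3)
    (t : Fin 2 → ℂ) : IsForm K3 (rowDet L t) 3 :=
  ((hL 0).C_mul _).sub ((hL 1).C_mul _)

theorem evalAt_rowDet₁ (t : Fin 2 → ℂ) (p : K3) :
    evalAt (rowDet k.row₁ t) p = k.E₁ t p.xyz p.w := by
  have h := k.evalAt_row₁ p
  have h0 := congrFun h 0
  have h1 := congrFun h 1
  simp only [Matrix.cons_val] at h0 h1
  rw [evalAt_rowDet, h0, h1, E₁]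
  ring

theorem evalAt_rowDet₂ (t : Fin 2 → ℂ) (p : K3) :
    evalAt (rowDet k.row₂ t) p = -k.E₂ t p.xyz p.w := by
  have h := k.evalAt_row₂ p
  have h0 := congrFun h 0
  have h1 := congrFun h 1
  simp only [Matrix.cons_val] at h0 h1
  rw [evalAt_rowDet, h0, h1, E₂]
  ring

theorem rows_proportional (p : K3) (i j : Fin 2) :
    evalAt (k.row₁ i) p * evalAt (k.row₂ j) p = evalAt (k.row₁ j) p * evalAt (k.row₂ i) p := by
  have h := k.evalAt_row₁ p
  have h0 := congrFun h 0
  have h1 := congrFun h 1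
  have h' := k.evalAt_row₂ p
  have h2 := congrFun h' 0
  have h3 := congrFun h' 1
  have h4 := k.product_eq p.equation
  simp only [Matrix.cons_val] at h0 h1 h2 h3
  fin_cases i <;> fin_cases j <;> simp only [Fin.zero_eta, Fin.mk_one, h0, h1, h2, h3]
  · linear_combination h4
  · linear_combination -h4

/-- The pull-back of a local parameter of the line, as a quotient of cubic forms. -/
theorem exists_param_quotient {x : K3} {t e : Fin 2 → ℂ} {ht : t ≠ 0}
    (he : t 1 * e 0 - t 0 * e 1 = 1) (hx : k.fib x = Projectivization.mk ℂ t ht) :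
    ∃ L : Fin 2 → MvPolynomial (Fin 4) ℂ, (L = k.row₁ ∨ L = k.row₂) ∧ (∃ i, evalAt (L i) x ≠ 0) ∧
      (∀ j, IsForm K3 (L j) 3) ∧ evalAt (rowDet L e) x ≠ 0 ∧ Near x (fun y =>
        localParam t e (k.fib y) = -(evalAt (rowDet L t) y / evalAt (rowDet L e) y)) := by
  obtain ⟨L, hL, i, hi⟩ := k.exists_row x
  have hform : ∀ j, IsForm K3 (L j) 3 := by
    rcases hL with rfl | rfl
    exacts [k.isForm_row₁, k.isForm_row₂]
  have hfib : ∀ y : K3, evalAt (L i) y ≠ 0 → ∃ hne, k.fib y = Projectivization.mk ℂ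
      (fun j => evalAt (L j) y) hne := fun y hy => by
    have hne : (fun j => evalAt (L j) y) ≠ 0 := fun h0 => hy (congrFun h0 i)
    rcases hL with rfl | rfl
    exacts [⟨hne, k.fib_eq_row₁ hne⟩, ⟨hne, k.fib_eq_row₂ hne⟩]
  refine ⟨L, hL, ⟨i, hi⟩, hform, ?_, (near_ne_zero (hform i) hi).mono fun y hy => ?_⟩
  · intro h0
    obtain ⟨hne, h⟩ := hfib x hi
    rw [hx, P1_mk_eq_iff] at h
    rw [evalAt_rowDet] at h0
    apply hi
    have e0 : evalAt (L 0) x = 0 := by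
      linear_combination -(evalAt (L 0) x) * he - e 0 * h - t 0 * h0
    have e1 : evalAt (L 1) x = 0 := by
      linear_combination -(evalAt (L 1) x) * he - e 1 * h - t 1 * h0
    fin_cases i
    exacts [e0, e1]
  · obtain ⟨hne, h⟩ := hfib y hy
    rw [h, localParam_mk, evalAt_rowDet, evalAt_rowDet, ← div_neg]
    congr 1
    ring

/-- Both equations of a fibre are locally multiples of the pull-back of a local parameter. -/
theorem exists_equation_multiple {x : K3} {t e : Fin 2 → ℂ} {ht : t ≠ 0}
    (he : t 1 * e 0 - t 0 * e 1 = 1) (hx : k.fib x = Projectivization.mk ℂ t ht) :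
    ∃ D : MvPolynomial (Fin 4) ℂ, IsForm K3 D 3 ∧ evalAt D x ≠ 0 ∧
      ∃ c₁ c₂ : K3 → ℂ, RegularAt c₁ x ∧ RegularAt c₂ x ∧ Near x (fun y =>
        k.E₁ t y.xyz y.w / evalAt D y = c₁ y * localParam t e (k.fib y) ∧
        k.E₂ t y.xyz y.w / evalAt D y = c₂ y * localParam t e (k.fib y)) := by
  obtain ⟨L, hL, ⟨i, hi⟩, hform, hD, hn⟩ := k.exists_param_quotient he hx
  refine ⟨rowDet L e, isForm_rowDet hform e, hD, ?_⟩
  rcases hL with rfl | rfl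
  -- In the first row the parameter is −E₁ over the denominator; E₂ then follows since the two rows
  -- are proportional, with a regular factor where entry i of the first row is nonzero.
  · refine ⟨fun _ => -1, fun y => evalAt (k.row₂ i) y / evalAt (k.row₁ i) y, RegularAt.const _ _,
      RegularAt.quotient (k.isForm_row₂ i) (hform i) hi, ?_⟩
    refine (hn.and (near_ne_zero (hform i) hi)).mono ?_
    rintro y ⟨h, hy⟩
    rw [h, ← evalAt_rowDet₁]
    refine ⟨by ring, ?_⟩
    have h2 := k.evalAt_rowDet₂ t y
    have : k.E₂ t y.xyz y.w
        = -(evalAt (k.row₂ i) y / evalAt (k.row₁ i) y) * evalAt (rowDet k.row₁ t) y := by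
      rw [evalAt_rowDet] at h2 ⊢
      field_simp
      linear_combination evalAt (k.row₁ i) y * h2 - t 1 * k.rows_proportional y i 0
        + t 0 * k.rows_proportional y i 1
    rw [this]
    ring
  · refine ⟨fun y => -(evalAt (k.row₁ i) y / evalAt (k.row₂ i) y), fun _ => 1, ?_,
      RegularAt.const _ _, ?_⟩
    · exact ((RegularAt.const (-1) x).mul (RegularAt.quotient (k.isForm_row₁ i) (hform i) hi)).congr
        (near_of_forall fun y => by ring)
    refine (hn.and (near_ne_zero (hform i) hi)).mono ?_
    rintro y ⟨h, hy⟩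
    have h1 := k.evalAt_rowDet₁ t y
    have h2 := k.evalAt_rowDet₂ t y
    have : k.E₁ t y.xyz y.w
        = (evalAt (k.row₁ i) y / evalAt (k.row₂ i) y) * evalAt (rowDet k.row₂ t) y := by
      rw [evalAt_rowDet] at h1 ⊢
      field_simp
      linear_combination -evalAt (k.row₂ i) y * h1 - t 1 * k.rows_proportional y i 0
        + t 0 * k.rows_proportional y i 1
    rw [h, this, h2]
    constructor <;> ring

/-- The coefficients of the cubic form `wForm`. -/
def wCoef (t e : Fin 2 → ℂ) : Fin 3 → ℂ := fun j =>
  e 0 * (k.r * t 1 + 2 * t 0 * ![1, k.ε, k.ε ^ 2] j)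
    + e 1 * (k.r * t 0 + 2 * t 1 * ![1, k.ε ^ 2, k.ε] j)

theorem diagCubic_wCoef (t e : Fin 2 → ℂ) (v : Fin 3 → ℂ) :
    diagCubic (k.wCoef t e) v = k.wForm t e v := by
  simp only [diagCubic, wCoef, wForm, S, U, V, Matrix.cons_val, Pi.one_apply]
  ring

/-- The coefficients of the quotient of `wForm ^ 2 + Φ₆` by the equation of the plane cubic. -/
def quotCoef (e : Fin 2 → ℂ) : Fin 3 → ℂ := fun j =>
  4 * (e 0 ^ 2 * ![1, k.ε, k.ε ^ 2] j + k.r * e 0 * e 1 + e 1 ^ 2 * ![1, k.ε ^ 2, k.ε] j)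

theorem diagCubic_quotCoef (e : Fin 2 → ℂ) (v : Fin 3 → ℂ) : diagCubic (k.quotCoef e) v
    = 4 * e 0 ^ 2 * k.U v + 4 * k.r * e 0 * e 1 * S v + 4 * e 1 ^ 2 * k.V v := by
  simp only [diagCubic, quotCoef, S, U, V, Matrix.cons_val, Pi.one_apply]
  ring

theorem wForm_sq {t e : Fin 2 → ℂ} (he : t 1 * e 0 - t 0 * e 1 = 1) (v : Fin 3 → ℂ) :
    k.wForm t e v ^ 2 + sextic v = diagCubic (k.coef t) v * diagCubic (k.quotCoef e) v := by
  rw [diagCubic_coef, diagCubic_quotCoef, k.sextic_eq, wForm]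
  have hr := k.hr
  linear_combination
    (3 * S v ^ 2 - 4 * k.U v * k.V v) * (t 1 * e 0 - t 0 * e 1 + 1) * he
    + (e 0 * t 1 - e 1 * t 0) ^ 2 * S v ^ 2 * hr

/-- Together with `E₂_eq` this inverts the elimination: a matrix of determinant 2 relates the two
fibre equations to w − `wForm` and the plane cubic, so both pairs generate the same ideal. -/
theorem E₁_eq {t e : Fin 2 → ℂ} (he : t 1 * e 0 - t 0 * e 1 = 1) (v : Fin 3 → ℂ) (w : ℂ) :
    k.E₁ t v w = t 1 * (w - k.wForm t e v) + 2 * e 1 * diagCubic (k.coef t) v := by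
  rw [diagCubic_coef]
  unfold E₁ wForm
  linear_combination (k.r * t 1 * S v + 2 * t 0 * k.U v) * he

theorem E₂_eq {t e : Fin 2 → ℂ} (he : t 1 * e 0 - t 0 * e 1 = 1) (v : Fin 3 → ℂ) (w : ℂ) :
    k.E₂ t v w = t 0 * (w - k.wForm t e v) + 2 * e 0 * diagCubic (k.coef t) v := by
  rw [diagCubic_coef]
  unfold E₂ wForm
  linear_combination -(k.r * t 0 * S v + 2 * t 1 * k.V v) * he

/-- Any two of the three binary quadratic forms are without common zero on the line. A singular
fibre thus lies over three distinct lines, never over a multiple one. -/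
theorem coef_unique {t : Fin 2 → ℂ} (ht : t ≠ 0) {i j : Fin 3} (hi : k.coef t i = 0)
    (hj : k.coef t j = 0) : i = j := by
  have hr := k.hr
  have hε := k.hε
  have key : ∀ i j : Fin 3, i < j → k.coef t i = 0 → k.coef t j = 0 → False := by
    intro i j hij h h'
    apply ht
    -- Two binary quadratic forms without common zero generate all binary forms of degree at least
    -- three, in particular these fourth powers.
    have : t 0 ^ 4 = 0 ∧ t 1 ^ 4 = 0 := by
      clear ht hi hj
      fin_cases i <;> fin_cases j <;> simp [coef] at hij h h' <;>
        generalize k.ε = ε at h h' hε <;> generalize k.r = r at h h' hr <;>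
        generalize t 0 = a at h h' ⊢ <;> generalize t 1 = b at h h' ⊢ <;> clear hij <;>
        constructor <;> grind
    ext i
    fin_cases i
    exacts [pow_eq_zero_iff four_ne_zero |>.1 this.1, pow_eq_zero_iff four_ne_zero |>.1 this.2]
  rcases lt_trichotomy i j with h | h | h
  exacts [(key _ _ h hi hj).elim, h, (key _ _ h hj hi).elim]

end RootData


/-! ### Singular points of the fibres -/

namespace RootData

variable (k : RootData)

/-- The ratio of two plane coordinates. -/
def ratio (i j : Fin 3) (p : K3) : ℂ := p.xyz j / p.xyz i

theorem evalAt_xyz (i : Fin 3) (p : K3) : evalAt (X i.castSucc) p = p.xyz i := by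
  rw [evalAt_X]
  fin_cases i <;> rfl

theorem regularAt_ratio {i : Fin 3} (j : Fin 3) {x : K3} (hx : x.xyz i ≠ 0) :
    RegularAt (ratio i j) x := by
  have h := RegularAt.quotient (x := x) (isForm_K3_X j) (isForm_K3_X i) (by rwa [evalAt_xyz])
  exact h.congr (near_of_forall fun y => by rw [evalAt_xyz, evalAt_xyz, ratio])

theorem near_xyz_ne {i : Fin 3} {x : K3} (hx : x.xyz i ≠ 0) : Near x (fun y => y.xyz i ≠ 0) :=
  (near_ne_zero (isForm_K3_X i) (by rwa [evalAt_xyz])).mono fun y hy => by rwa [evalAt_xyz] at hy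

theorem w_sub_wForm_mul {t e : Fin 2 → ℂ} (he : t 1 * e 0 - t 0 * e 1 = 1) (p : K3) :
    (p.w - k.wForm t e p.xyz) * (p.w + k.wForm t e p.xyz)
      = -(diagCubic (k.coef t) p.xyz * diagCubic (k.quotCoef e) p.xyz) := by
  have h1 := k.wForm_sq he p.xyz
  linear_combination p.equation - h1

/-- Near a point with `w ≠ 0` the pull-back of a local parameter is a multiple of the
equation of the plane cubic. -/
theorem exists_param_eq_mul_cubic {x : K3} {t e : Fin 2 → ℂ} {ht : t ≠ 0}
    (he : t 1 * e 0 - t 0 * e 1 = 1) (hx : k.fib x = Projectivization.mk ℂ t ht) (hw : x.w ≠ 0)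
    {i : Fin 3} (hi : x.xyz i ≠ 0) :
    ∃ h : K3 → ℂ, RegularAt h x ∧ Near x (fun y => localParam t e (k.fib y)
      = h y * (diagCubic (k.coef t) y.xyz / y.xyz i ^ 3)) := by
  obtain ⟨L, hL, -, hform, hD, hn⟩ := k.exists_param_quotient he hx
  have hxw : x.w = k.wForm t e x.xyz := ((k.fib_eq_iff' x ht he).1 hx).2
  obtain ⟨a, b, hab⟩ : ∃ a b : ℂ, ∀ y : K3, evalAt (rowDet L t) y
      = a * (y.w - k.wForm t e y.xyz) + b * diagCubic (k.coef t) y.xyz := by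
    rcases hL with rfl | rfl
    · exact ⟨t 1, 2 * e 1, fun y => by rw [evalAt_rowDet₁, k.E₁_eq he]⟩
    · exact ⟨-t 0, -(2 * e 0), fun y => by rw [evalAt_rowDet₂, k.E₂_eq he]; ring⟩
  set W := X 3 + diagForm (k.wCoef t e) with hW
  have hWf : IsForm K3 W 3 := isForm_w.add (isForm_diagForm _)
  have hWv : ∀ y : K3, evalAt W y = y.w + k.wForm t e y.xyz := fun y => by
    rw [hW, evalAt_add, evalAt_w, evalAt_diagForm, diagCubic_wCoef]
  have hWx : evalAt W x ≠ 0 := by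
    rw [hWv, ← hxw, ← two_mul]
    exact mul_ne_zero two_ne_zero hw
  have hDW := (isForm_rowDet hform e).mul hWf
  have hDWx : evalAt (rowDet L e * W) x ≠ 0 := by
    rw [evalAt_mul]
    exact mul_ne_zero hD hWx
  set N := C a * diagForm (k.quotCoef e) - C b * W with hN
  have hNf : IsForm K3 N 3 := ((isForm_diagForm _).C_mul _).sub (hWf.C_mul _)
  refine ⟨_, RegularAt.quotient (((isForm_K3_X i).pow 3).mul hNf) hDW hDWx, ?_⟩
  refine ((hn.and (near_ne_zero hDW hDWx)).and (near_xyz_ne hi)).mono ?_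
  rintro y ⟨⟨h1, h2⟩, h3⟩
  rw [evalAt_mul, mul_ne_zero_iff] at h2
  obtain ⟨h2, h4⟩ := h2
  rw [h1, evalAt_mul, evalAt_mul, evalAt_pow, evalAt_xyz, hab y]
  have h5 : evalAt N y = a * diagCubic (k.quotCoef e) y.xyz - b * evalAt W y := by
    rw [hN, evalAt_sub, evalAt_mul, evalAt_mul, evalAt_C, evalAt_C, evalAt_diagForm]
  have h6 := k.w_sub_wForm_mul he y
  rw [← hWv] at h6
  rw [h5]
  field_simp
  linear_combination -a * h6

/-- At a point over a vertex w ≠ 0, so any pulled-back parameter is a regular multiple of the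
dehomogenized cubic. With coefficient i equal to zero, only cubes of the two ratios vanishing there
remain. -/
theorem not_fibreSmoothAt {x : K3} {t : Fin 2 → ℂ} (ht : t ≠ 0)
    (hx : k.fib x = Projectivization.mk ℂ t ht) {i : Fin 3} (hi : k.coef t i = 0)
    (hj : ∀ j, j ≠ i → x.xyz j = 0) : ¬ FibreSmoothAt k.fib x := by
  rintro ⟨f, hf, hfsq⟩
  apply hfsq
  obtain ⟨e, he⟩ := exists_complement ht
  have hxi : x.xyz i ≠ 0 := fun h0 => x.xyz_ne (by
    ext j
    by_cases h : j = i
    · rw [h, h0]; rfl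
    · exact hj j h)
  have hw : x.w ≠ 0 := by
    intro h0
    have h1 := x.equation
    rw [h0] at h1
    have h2 : sextic x.xyz = x.xyz i ^ 6 := by
      rw [sextic]
      fin_cases i
      · rw [hj 1 (by decide), hj 2 (by decide)]; simp
      · rw [hj 0 (by decide), hj 2 (by decide)]; simp
      · rw [hj 0 (by decide), hj 1 (by decide)]; simp
    rw [h2] at h1
    exact hxi (pow_eq_zero_iff (n := 6) (by norm_num) |>.1 (by linear_combination h1))
  rw [hx] at hf
  obtain ⟨c, hc, hn⟩ := hf.exists_eq_mul he
  rw [← hx] at hc hn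
  obtain ⟨h, hh, hn'⟩ := k.exists_param_eq_mul_cubic he hx hw hxi
  refine ⟨3, fun j y => k.coef t j * ratio i j y,
    -- The factor c⁻¹c is 1 for a nonzero coefficient and 0 for j = i. It makes the i-th term lie in
    -- the maximal ideal although the ratio of coordinate i to itself is 1.
    fun j y => ((k.coef t j)⁻¹ * k.coef t j) * (ratio i j y * (ratio i j y * (h y * c (k.fib y)))),
    fun j => ⟨⟨(RegularAt.const _ x).mul (regularAt_ratio j hxi), ?_⟩,
      (RegularAt.const _ x).mul ((regularAt_ratio j hxi).mul ((regularAt_ratio j hxi).mul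
        (hh.mul (k.isMorphism_fib x c hc)))), ?_⟩, ?_⟩
  · by_cases hji : j = i
    · simp [hji, hi]
    · simp [ratio, hj j hji]
  · by_cases hji : j = i
    · simp [hji, hi]
    · simp [ratio, hj j hji]
  · refine (((k.isMorphism_fib.near hn).and hn').and (near_xyz_ne hxi)).mono ?_
    rintro y ⟨⟨h1, h2⟩, h3⟩
    have hsum : diagCubic (k.coef t) y.xyz / y.xyz i ^ 3
        = ∑ j, k.coef t j * ratio i j y ^ 3 := by
      simp only [Fin.sum_univ_three, ratio, diagCubic]
      field_simp
    rw [Function.comp_apply, h1, h2, hsum, Finset.mul_sum, Finset.sum_mul]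
    refine Finset.sum_congr rfl fun j _ => ?_
    by_cases h0 : k.coef t j = 0
    · simp [h0]
    · field_simp

/-! ### Reducedness of the fibres -/

/-- The restriction of a polynomial to the graph of `wForm`. -/
def fibreSubst (t e : Fin 2 → ℂ) : MvPolynomial (Fin 4) ℂ →ₐ[ℂ] MvPolynomial (Fin 3) ℂ :=
  aeval ![X 0, X 1, X 2, diagPoly (k.wCoef t e)]

theorem fibreSubst_X (t e : Fin 2 → ℂ) (i : Fin 4) : k.fibreSubst t e (X i)
    = (![X 0, X 1, X 2, diagPoly (k.wCoef t e)] : Fin 4 → MvPolynomial (Fin 3) ℂ) i :=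
  aeval_X _ i

theorem eval_fibreSubst (t e : Fin 2 → ℂ) (v : Fin 3 → ℂ) (g : MvPolynomial (Fin 4) ℂ) :
    eval v (k.fibreSubst t e g) = eval ![v 0, v 1, v 2, k.wForm t e v] g := by
  induction g using MvPolynomial.induction_on with
  | C c => rw [show k.fibreSubst t e (C c) = C c from algHom_C _ c, eval_C, eval_C]
  | add p q hp hq => rw [map_add, map_add, map_add, hp, hq]
  | mul_X p i hp =>
    rw [map_mul, map_mul, map_mul, hp, fibreSubst_X, eval_X]
    congr 1
    fin_cases i
    · simp
    · simp
    · simp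
    · exact (eval_diagPoly _ _).trans (k.diagCubic_wCoef t e v)

theorem eval_xyz_fibreSubst {t e : Fin 2 → ℂ} {p : K3} (hp : p.w = k.wForm t e p.xyz)
    (g : MvPolynomial (Fin 4) ℂ) : eval p.xyz (k.fibreSubst t e g) = evalAt g p := by
  rw [eval_fibreSubst, ← hp, evalAt]
  congr 2
  ext i
  fin_cases i <;> rfl

theorem exists_fibre_point {t e : Fin 2 → ℂ} (ht : t ≠ 0) (he : t 1 * e 0 - t 0 * e 1 = 1)
    {v : Fin 3 → ℂ} (hv : v ≠ 0) (hvc : diagCubic (k.coef t) v = 0) :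
    ∃ p, k.fib p = Projectivization.mk ℂ t ht ∧ ∃ s, s ≠ 0 ∧
      ∀ g n, IsForm K3 g n → eval v (k.fibreSubst t e g) = s ^ n * evalAt g p := by
  have heq := k.wForm_equation he hvc
  obtain ⟨s, hs, h1, h2⟩ := K3.exists_point v _ hv heq
  refine ⟨K3.point v _ hv heq,
    (k.fib_point_eq_iff hv heq ht).2 ((k.fibre_equations he).2 ⟨hvc, rfl⟩), s, hs,
    fun g n hg => ?_⟩
  rw [eval_fibreSubst]
  refine hg.eval_scale fun i => ?_
  fin_cases i
  · exact (h1 0).trans (congrArg (· * _) (pow_one s).symm)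
  · exact (h1 1).trans (congrArg (· * _) (pow_one s).symm)
  · exact (h1 2).trans (congrArg (· * _) (pow_one s).symm)
  · exact h2

/-- Modulo w − `wForm` a form becomes a polynomial in the plane coordinates. It vanishes on the
plane cubic because each of its points lifts to the fibre, so the cubic divides it. -/
theorem exists_division {t e : Fin 2 → ℂ} (ht : t ≠ 0) (he : t 1 * e 0 - t 0 * e 1 = 1)
    (h0 : k.coef t 0 ≠ 0) (h1 : k.coef t 1 ≠ 0) {g : MvPolynomial (Fin 4) ℂ} {n : ℕ}
    (hg : IsForm K3 g n)
    (hv : ∀ p, k.fib p = Projectivization.mk ℂ t ht → evalAt g p = 0) :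
    ∃ c c', g = (X 3 - diagForm (k.wCoef t e)) * c + diagForm (k.coef t) * c' := by
  have hdvd : ∀ g, X 3 - diagForm (k.wCoef t e) ∣ g - rename Fin.castSucc (k.fibreSubst t e g) := by
    intro g
    induction g using MvPolynomial.induction_on with
    | C c =>
      rw [show k.fibreSubst t e (C c) = C c from algHom_C _ c, rename_C, sub_self]
      exact dvd_zero _
    | add p q hp hq =>
      rw [map_add, map_add, add_sub_add_comm]
      exact dvd_add hp hq
    | mul_X p i hp =>
      rw [map_mul, map_mul, fibreSubst_X]
      have h2 : X 3 - diagForm (k.wCoef t e) ∣ X i - rename Fin.castSucc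
          ((![X 0, X 1, X 2, diagPoly (k.wCoef t e)] : Fin 4 → MvPolynomial (Fin 3) ℂ) i) := by
        fin_cases i
        · simp
        · simp
        · simp
        · simp [rename_diagPoly]
      have : p * X i - rename Fin.castSucc (k.fibreSubst t e p) * rename Fin.castSucc
          ((![X 0, X 1, X 2, diagPoly (k.wCoef t e)] : Fin 4 → MvPolynomial (Fin 3) ℂ) i)
          = (p - rename Fin.castSucc (k.fibreSubst t e p)) * X i + rename Fin.castSucc (k.fibreSubst t e p) *
            (X i - rename Fin.castSucc
          ((![X 0, X 1, X 2, diagPoly (k.wCoef t e)] : Fin 4 → MvPolynomial (Fin 3) ℂ) i)) := by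
        ring
      rw [this]
      exact dvd_add (hp.mul_right _) (h2.mul_left _)
  obtain ⟨c', hc'⟩ : diagPoly (k.coef t) ∣ k.fibreSubst t e g := by
    refine diagPoly_dvd k h0 h1 fun v hv0 hvc => ?_
    obtain ⟨p, hp, s, -, h4⟩ := k.exists_fibre_point ht he hv0 hvc
    rw [h4 g n hg, hv p hp, mul_zero]
  obtain ⟨c, hc⟩ := hdvd g
  refine ⟨c, rename Fin.castSucc c', ?_⟩
  rw [← hc, ← rename_diagPoly, ← map_mul, ← hc']
  ring

/-- The numerator of a function vanishing on the fibre, multiplied by suitable denominators, is a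
combination of the two fibre equations; locally both are regular multiples of a pulled-back
parameter. -/
theorem fibreReducedAt {x : K3} {t : Fin 2 → ℂ} (ht : t ≠ 0)
    (hx : k.fib x = Projectivization.mk ℂ t ht) (h0 : k.coef t 0 ≠ 0) (h1 : k.coef t 1 ≠ 0) :
    FibreReducedAt k.fib x := by
  obtain ⟨e, he⟩ := exists_complement ht
  rintro f ⟨⟨d, a, b, ha, hb, hbx, hab⟩, hf⟩
  obtain ⟨n, b₀, hb₀, hb₀x, hvan⟩ := near_iff.1 hf
  obtain ⟨D, hD, hDx, c₁, c₂, hc₁, hc₂, hn⟩ := k.exists_equation_multiple he hx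
  -- The factors b and b₀ extend the vanishing from a neighbourhood to the whole fibre. The cubic
  -- form D makes the quotients have the degree of b²b₀, so that they become regular functions, and
  -- it is the denominator of the fibre equations.
  have hg : IsForm K3 (D * (a * b * b₀)) (3 + (d + d + n)) := hD.mul ((ha.mul hb).mul hb₀)
  have hgv : ∀ p, k.fib p = Projectivization.mk ℂ t ht → evalAt (D * (a * b * b₀)) p = 0 := by
    intro p hp
    rw [evalAt_mul, evalAt_mul, evalAt_mul]
    by_cases hbp : evalAt b p = 0
    · rw [hbp]; ring
    by_cases hb₀p : evalAt b₀ p = 0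
    · rw [hb₀p]; ring
    have h2 := hvan p hb₀p (by rw [Set.mem_preimage, hp, hx]; rfl)
    rw [hab p hbp, div_eq_zero_iff, or_iff_left hbp] at h2
    rw [h2]; ring
  obtain ⟨c, c', hcc⟩ := k.exists_division ht he h0 h1 hg hgv
  obtain ⟨q, q', hq, hq', hqq⟩ := exists_forms_of_sum
    (isForm_w.sub (isForm_diagForm _)) (isForm_diagForm _) hg hcc
  have hB : IsForm K3 (b * b * b₀) (d + d + n) := (hb.mul hb).mul hb₀
  have hBx : evalAt (b * b * b₀) x ≠ 0 := by
    rw [evalAt_mul, evalAt_mul]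
    exact mul_ne_zero (mul_ne_zero hbx hbx) hb₀x
  have hr := RegularAt.quotient hq hB hBx
  have hr' := RegularAt.quotient hq' hB hBx
  refine ⟨localParam t e, _, by rw [hx]; exact isMaximal_localParam ht he,
    ((((RegularAt.const (e 0) x).mul hc₁).sub ((RegularAt.const (e 1) x).mul hc₂)).mul hr).add
    (((((RegularAt.const (t 1 / 2) x).mul hc₂).sub ((RegularAt.const (t 0 / 2) x).mul hc₁))).mul hr'),
    ?_⟩
  refine ((hn.and (near_ne_zero hB hBx)).and (near_ne_zero hD hDx)).mono ?_
  rintro y ⟨⟨⟨e1, e2⟩, hy⟩, hDy⟩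
  have hby : evalAt b y ≠ 0 := fun h => hy (by rw [evalAt_mul, evalAt_mul, h]; ring)
  have hb₀y : evalAt b₀ y ≠ 0 := fun h => hy (by rw [evalAt_mul, h]; ring)
  have h2 := congrArg (fun g => evalAt g y) hqq
  simp only [evalAt_mul, evalAt_add, evalAt_sub, evalAt_w, evalAt_diagForm, diagCubic_wCoef] at h2
  have h3 : y.w - k.wForm t e y.xyz = e 0 * k.E₁ t y.xyz y.w - e 1 * k.E₂ t y.xyz y.w := by
    rw [k.E₁_eq he, k.E₂_eq he]
    linear_combination -(y.w - k.wForm t e y.xyz) * he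
  have h4 : diagCubic (k.coef t) y.xyz
      = t 1 / 2 * k.E₂ t y.xyz y.w - t 0 / 2 * k.E₁ t y.xyz y.w := by
    rw [k.E₁_eq he, k.E₂_eq he]
    linear_combination -diagCubic (k.coef t) y.xyz * he
  rw [div_eq_iff hDy] at e1 e2
  rw [h3, h4, e1, e2] at h2
  rw [hab y hby]
  simp only [evalAt_mul]
  field_simp
  field_simp at h2
  linear_combination h2

end RootData


/-! ### The reducible fibres -/

namespace RootData

variable (k : RootData)

/-- The curve on the surface over the line `x = κ y` on which the last coordinate is `wForm`. -/
def lineOver (t e : Fin 2 → ℂ) (κ : ℂ) : Set K3 :=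
  {p | p.w = k.wForm t e p.xyz ∧ p.xyz 0 = κ * p.xyz 1}

theorem isClosed_lineOver (t e : Fin 2 → ℂ) (κ : ℂ) :
    @IsClosed K3 (zariskiTopology K3) (k.lineOver t e κ) := by
  let _ := zariskiTopology K3
  have h1 := isClosed_zeroLocus (X := K3) (isForm_w.sub (isForm_diagForm (k.wCoef t e)))
  have h2 := isClosed_zeroLocus (X := K3) ((isForm_K3_X 0).sub ((isForm_K3_X 1).C_mul κ))
  convert h1.inter h2 using 1
  ext p
  change _ ↔ evalAt _ p = 0 ∧ evalAt _ p = 0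
  rw [evalAt_sub, evalAt_sub, evalAt_mul, evalAt_C, evalAt_w, evalAt_diagForm, diagCubic_wCoef,
    evalAt_xyz, evalAt_xyz, sub_eq_zero, sub_eq_zero]
  rfl

section

variable {k} {t e : Fin 2 → ℂ} (ht : t ≠ 0)

theorem lineOver_subset_fibre {κ : ℂ} (hκ : k.coef t 0 * κ ^ 3 + k.coef t 1 = 0)
    (he : t 1 * e 0 - t 0 * e 1 = 1) (h2 : k.coef t 2 = 0) {p : K3}
    (hp : p ∈ k.lineOver t e κ) : k.fib p = Projectivization.mk ℂ t ht := by
  rw [k.fib_eq_iff' p ht he]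
  refine ⟨?_, hp.1⟩
  rw [diagCubic, h2, hp.2]
  linear_combination p.xyz 1 ^ 3 * hκ

/-- The vector over the point `u` of the line `x = κ y`. -/
def lineVec (κ : ℂ) (u : Fin 2 → ℂ) : Fin 3 → ℂ := ![κ * u 0, u 0, u 1]

theorem lineVec_ne_zero (κ : ℂ) {u : Fin 2 → ℂ} (hu : u ≠ 0) : lineVec κ u ≠ 0 := by
  intro h
  apply hu
  ext i
  fin_cases i
  exacts [congrFun h 1, congrFun h 2]

theorem lineVec_equation {κ : ℂ} (hκ : k.coef t 0 * κ ^ 3 + k.coef t 1 = 0)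
    (he : t 1 * e 0 - t 0 * e 1 = 1) (h2 : k.coef t 2 = 0) (u : Fin 2 → ℂ) :
    k.wForm t e (lineVec κ u) ^ 2 + sextic (lineVec κ u) = 0 := by
  refine k.wForm_equation he ?_
  simp only [diagCubic, h2, lineVec, Matrix.cons_val]
  linear_combination u 0 ^ 3 * hκ

theorem lineVec_scale {κ : ℂ} {u u' : Fin 2 → ℂ} {s : ℂ} (h : ∀ i, u' i = s * u i) (i) :
    lineVec κ u' i = s * lineVec κ u i := by
  fin_cases i
  · simp [lineVec, h, mul_left_comm]
  · simp [lineVec, h]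
  · simp [lineVec, h]

theorem wForm_scale {v v' : Fin 3 → ℂ} {s : ℂ} (h : ∀ i, v' i = s * v i) :
    k.wForm t e v' = s ^ 3 * k.wForm t e v := by
  rw [← diagCubic_wCoef, ← diagCubic_wCoef, diagCubic_scale h]

/-- The curve projects isomorphically to the coordinates (y, z); the inverse sets x = κy and lets w
be the cubic form `wForm`. -/
theorem isIsomorphic_lineOver {κ : ℂ} (hκ : k.coef t 0 * κ ^ 3 + k.coef t 1 = 0)
    (he : t 1 * e 0 - t 0 * e 1 = 1) (h2 : k.coef t 2 = 0) :
    IsIsomorphic (k.lineOver t e κ) P1 := by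
  have hne : ∀ p : k.lineOver t e κ, ![p.1.xyz 1, p.1.xyz 2] ≠ 0 := by
    intro p h
    have e1 : p.1.xyz 1 = 0 := congrFun h 0
    have e2 : p.1.xyz 2 = 0 := congrFun h 1
    have e0 := p.2.2
    rw [e1, mul_zero] at e0
    exact p.1.xyz_ne (by ext i; fin_cases i <;> assumption)
  let φ : k.lineOver t e κ → P1 := fun p => Projectivization.mk ℂ _ (hne p)
  let ψ₀ : P1 → K3 := fun u => K3.point (lineVec κ (HomogeneousCoordinates.rep u))
    (k.wForm t e (lineVec κ (HomogeneousCoordinates.rep u))) (lineVec_ne_zero κ u.rep_nonzero)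
    (lineVec_equation hκ he h2 _)
  have hψ₀ : ∀ u, ψ₀ u ∈ k.lineOver t e κ := by
    intro u
    obtain ⟨s, hs, h3, h4⟩ := K3.exists_point (lineVec κ (HomogeneousCoordinates.rep u))
      (k.wForm t e (lineVec κ (HomogeneousCoordinates.rep u))) (lineVec_ne_zero κ u.rep_nonzero)
      (lineVec_equation hκ he h2 _)
    constructor
    · have h5 := wForm_scale (k := k) (t := t) (e := e) h3
      exact (mul_left_cancel₀ (pow_ne_zero 3 hs) (h5.symm.trans h4)).symm
    · have e0 : κ * HomogeneousCoordinates.rep u 0 = s * (ψ₀ u).xyz 0 := h3 0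
      have e1 : HomogeneousCoordinates.rep u 0 = s * (ψ₀ u).xyz 1 := h3 1
      exact mul_left_cancel₀ hs (by linear_combination κ * e1 - e0)
  let ψ : P1 → k.lineOver t e κ := fun u => ⟨ψ₀ u, hψ₀ u⟩
  refine ⟨⟨φ, ψ, fun p => ?_, fun u => ?_⟩, ?_, ?_⟩
  · apply Subtype.ext
    obtain ⟨s, hs, h3⟩ := exists_rep_mk _ (hne p)
    have h4 : ∀ i, p.1.xyz i = s * lineVec κ (HomogeneousCoordinates.rep (φ p)) i := by
      intro i
      rw [← lineVec_scale h3]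
      fin_cases i
      · exact p.2.2
      · rfl
      · rfl
    change ψ₀ (φ p) = p.1
    rw [← p.1.point_self]
    refine K3.point_eq s hs h4 ?_
    rw [← wForm_scale h4]
    exact p.2.1
  · obtain ⟨s, hs, h3, h4⟩ := K3.exists_point (lineVec κ (HomogeneousCoordinates.rep u))
      (k.wForm t e (lineVec κ (HomogeneousCoordinates.rep u))) (lineVec_ne_zero κ u.rep_nonzero)
      (lineVec_equation hκ he h2 _)
    conv_rhs => rw [← proj_mk_rep u]
    refine proj_mk_eq s fun i => ?_
    fin_cases i
    · exact h3 1
    · exact h3 2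
  · refine isMorphism_toProj fun x => ⟨1, ![X 1, X 2], 0, 1, fun j => ?_, isForm_one, by simp,
      fun y _ => ?_⟩
    · fin_cases j
      exacts [isForm_K3_X 1, isForm_K3_X 2]
    · have : (fun j => evalAt (![X 1, X 2] j : MvPolynomial (Fin 4) ℂ) y) = ![y.1.xyz 1, y.1.xyz 2] := by
        ext j
        fin_cases j
        exacts [evalAt_xyz 1 y.1, evalAt_xyz 2 y.1]
      refine ⟨by rw [this]; exact hne y, ?_⟩
      simp only [this]
      rfl
  · refine IsMorphism.codRestrict (φ := ψ₀) ?_ hψ₀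
    let P : Fin 3 → MvPolynomial (Fin 2) ℂ := ![C κ * X 0, X 0, X 1]
    have hPf : ∀ j, IsForm P1 (P j) 1 := by
      intro j
      fin_cases j
      · exact (isForm_X (X := P1) 0).C_mul _
      · exact isForm_X (X := P1) 0
      · exact isForm_X (X := P1) 1
    have hPv : ∀ u : P1, (fun j => evalAt (P j) u) = lineVec κ (HomogeneousCoordinates.rep u) := by
      intro u
      ext j
      fin_cases j
      · change evalAt (C κ * X 0) u = _
        rw [evalAt_mul, evalAt_C, evalAt_X]
        rfl
      · exact evalAt_X 0 u
      · exact evalAt_X 1 u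
    let R : MvPolynomial (Fin 2) ℂ := C (k.wCoef t e 0) * P 0 ^ 3 + C (k.wCoef t e 1) * P 1 ^ 3
      + C (k.wCoef t e 2) * P 2 ^ 3
    have hRf : IsForm P1 R (1 * 3) :=
      (((((hPf 0).pow 3).C_mul _).add (((hPf 1).pow 3).C_mul _)).add (((hPf 2).pow 3).C_mul _))
    have hRv : ∀ u : P1, evalAt R u = k.wForm t e (lineVec κ (HomogeneousCoordinates.rep u)) := by
      intro u
      rw [← hPv, ← diagCubic_wCoef]
      simp only [R, evalAt_add, evalAt_mul, evalAt_C, evalAt_pow]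
      rfl
    refine isMorphism_toK3 fun x => ⟨1, P, R, 0, 1, hPf, hRf, isForm_one, by simp, fun u _ => ?_⟩
    refine ⟨by rw [hPv]; exact lineVec_ne_zero κ u.rep_nonzero,
      by rw [hPv, hRv]; exact lineVec_equation hκ he h2 _, ?_⟩
    simp only [hPv, hRv]
    rfl

end

/-- The functions that vanish at a point over a vertex belong to the ideal generated by the
two plane coordinates that vanish there. -/
theorem exists_eq_ratio {p : K3} (h0 : p.xyz 0 = 0) (h1 : p.xyz 1 = 0) {f : K3 → ℂ}
    (hf : InMaximalIdeal f p) : ∃ a b : K3 → ℂ, RegularAt a p ∧ RegularAt b p ∧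
      Near p (fun y => f y = a y * ratio 2 0 y + b y * ratio 2 1 y) := by
  have hp2 : p.xyz 2 ≠ 0 := fun h2 => p.xyz_ne (by ext i; fin_cases i <;> assumption)
  obtain ⟨⟨d, a, b, ha, hb, hbp, hab⟩, hf0⟩ := hf
  let ω : K3 → ℂ := fun y => y.w / y.xyz 2 ^ 3
  have hω : RegularAt ω p := by
    have h := RegularAt.quotient (x := p) isForm_w ((isForm_K3_X 2).pow 3)
      (by rw [evalAt_pow, evalAt_xyz]; exact pow_ne_zero 3 hp2)
    exact h.congr (near_of_forall fun y => by rw [evalAt_w, evalAt_pow, evalAt_xyz])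
  let F : Fin 4 → K3 → ℂ := ![ratio 2 0, ratio 2 1, ratio 2 2, ω]
  have hF : ∀ i, RegularAt (F i) p := by
    intro i
    fin_cases i
    exacts [regularAt_ratio 0 hp2, regularAt_ratio 1 hp2, regularAt_ratio 2 hp2, hω]
  have hval : ∀ g, IsForm K3 g d → ∀ y : K3, y.xyz 2 ≠ 0 →
      evalAt g y = y.xyz 2 ^ d * eval (fun i => F i y) g := by
    intro g hg y hy
    refine hg.eval_scale fun i => ?_
    fin_cases i
    · change y.xyz 0 = y.xyz 2 ^ 1 * (y.xyz 0 / y.xyz 2)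
      field_simp
    · change y.xyz 1 = y.xyz 2 ^ 1 * (y.xyz 1 / y.xyz 2)
      field_simp
    · change y.xyz 2 = y.xyz 2 ^ 1 * (y.xyz 2 / y.xyz 2)
      field_simp
    · change y.w = y.xyz 2 ^ 3 * (y.w / y.xyz 2 ^ 3)
      field_simp
  obtain ⟨q, hq⟩ := exists_point_division (fun i => F i p) a
  have ha0 : eval (fun i => F i p) a = 0 := by
    have h3 := hab p hbp
    rw [hf0, eq_comm, div_eq_zero_iff, or_iff_left hbp, hval a ha p hp2, mul_eq_zero] at h3
    exact h3.resolve_left (pow_ne_zero _ hp2)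
  have hF0 : F 0 p = 0 := by
    change p.xyz 0 / p.xyz 2 = 0
    rw [h0, zero_div]
  have hF1 : F 1 p = 0 := by
    change p.xyz 1 / p.xyz 2 = 0
    rw [h1, zero_div]
  have hωp : ω p ^ 2 = -1 := by
    have h3 := p.equation
    rw [sextic, h0, h1] at h3
    simp only [ω]
    field_simp
    linear_combination h3
  -- Over the vertex the affine last coordinate ω satisfies ω² = −1. Hence ω + ω(p) is a unit at p,
  -- and ω − ω(p) can be recovered from ω² − ω(p)².
  have hω0 : ω p + ω p ≠ 0 := by
    intro h
    have : ω p = 0 := by linear_combination h / 2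
    rw [this] at hωp
    norm_num at hωp
  have hωy : ∀ y : K3, y.xyz 2 ≠ 0 → ω y ^ 2 = -(1 + ratio 2 0 y ^ 6 + ratio 2 1 y ^ 6
      - 10 * (ratio 2 0 y ^ 3 * ratio 2 1 y ^ 3 + ratio 2 0 y ^ 3 + ratio 2 1 y ^ 3)) := by
    intro y hy
    have h3 := y.equation
    rw [sextic] at h3
    simp only [ω, ratio]
    field_simp
    linear_combination h3
  have hωr : RegularAt (fun y => (ω y + ω p)⁻¹) p := (hω.add (RegularAt.const _ p)).inv hω0
  have hr0 : RegularAt (ratio 2 0) p := regularAt_ratio 0 hp2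
  have hr1 : RegularAt (ratio 2 1) p := regularAt_ratio 1 hp2
  have hA : ∀ g : MvPolynomial (Fin 4) ℂ, RegularAt (fun y => eval (fun i => F i y) g) p :=
    fun g => RegularAt.eval hF g
  have hB : RegularAt (fun y => (eval (fun i => F i y) b)⁻¹) p := by
    refine (hA b).inv fun h => hbp ?_
    rw [hval b hb p hp2, h, mul_zero]
  -- With a, b the two vanishing ratios, the equation of the surface reads ω² + 1 = a u₀ + b u₁.
  -- This eliminates ω as a third generator of the maximal ideal.
  let u₀ : MvPolynomial (Fin 4) ℂ := -(X 0 ^ 5 - C 10 * (X 0 ^ 2 * X 1 ^ 3 + X 0 ^ 2))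
  let u₁ : MvPolynomial (Fin 4) ℂ := -(X 1 ^ 5 - C 10 * X 1 ^ 2)
  refine ⟨fun y => (eval (fun i => F i y) (q 0) + eval (fun i => F i y) (u₀ * q 3)
      * (ω y + ω p)⁻¹) * (eval (fun i => F i y) b)⁻¹,
    fun y => (eval (fun i => F i y) (q 1) + eval (fun i => F i y) (u₁ * q 3)
      * (ω y + ω p)⁻¹) * (eval (fun i => F i y) b)⁻¹,
    ((hA _).add ((hA _).mul hωr)).mul hB, ((hA _).add ((hA _).mul hωr)).mul hB, ?_⟩
  refine (((near_ne_zero hb hbp).and (near_xyz_ne hp2)).and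
    ((hω.add (RegularAt.const _ p)).near_ne_zero hω0)).mono ?_
  rintro y ⟨⟨hby, hy2⟩, hωy0⟩
  have hFb : eval (fun i => F i y) b ≠ 0 := by
    intro h
    apply hby
    rw [hval b hb y hy2, h, mul_zero]
  rw [hab y hby, hval a ha y hy2, hval b hb y hy2, mul_div_mul_left _ _ (pow_ne_zero _ hy2)]
  have hFa : eval (fun i => F i y) a = ratio 2 0 y * eval (fun i => F i y) (q 0)
      + ratio 2 1 y * eval (fun i => F i y) (q 1) + (ω y - ω p) * eval (fun i => F i y) (q 3) := by
    conv_lhs => rw [hq, ha0]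
    have e2 : ∀ y : K3, y.xyz 2 ≠ 0 → F 2 y = 1 := fun y hy => div_self hy
    simp only [map_add, map_zero, map_mul, map_sub, eval_X, eval_C, zero_add,
      Fin.sum_univ_four, hF0, hF1, e2 y hy2, e2 p hp2, sub_self, zero_mul, sub_zero, add_zero]
    rfl
  have hω1 : ω y - ω p = (ratio 2 0 y * eval (fun i => F i y) u₀
      + ratio 2 1 y * eval (fun i => F i y) u₁) * (ω y + ω p)⁻¹ := by
    rw [eq_mul_inv_iff_mul_eq₀ hωy0]
    have h3 := hωy y hy2
    simp only [u₀, u₁, map_neg, map_sub, map_add, map_mul, map_pow, eval_X, eval_C]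
    change _ = ratio 2 0 y * -(ratio 2 0 y ^ 5 - 10 * (ratio 2 0 y ^ 2 * ratio 2 1 y ^ 3
      + ratio 2 0 y ^ 2)) + ratio 2 1 y * -(ratio 2 1 y ^ 5 - 10 * ratio 2 1 y ^ 2)
    linear_combination h3 - hωp
  rw [hFa, hω1, div_eq_mul_inv]
  simp only [map_mul]
  ring

theorem exists_cube_roots (k : RootData) {a b : ℂ} (ha : a ≠ 0) (hb : b ≠ 0) : ∃ κ : Fin 3 → ℂ,
    Function.Injective κ ∧ (∀ j, a * κ j ^ 3 + b = 0) ∧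
      ∀ x y : ℂ, a * x ^ 3 + b * y ^ 3 = 0 → ∃ j, x = κ j * y := by
  obtain ⟨c, hc⟩ := IsAlgClosed.exists_pow_nat_eq (-(b / a)) (n := 3) (by norm_num)
  have hc' : a * c ^ 3 + b = 0 := by
    rw [hc]
    field_simp
    ring
  have hc0 : c ≠ 0 := by
    rintro rfl
    apply hb
    linear_combination hc'
  have e1 := k.ε_ne_one
  have e0 := k.ε_ne_zero
  have e3 := k.ε_cube
  have hε := k.hε
  refine ⟨![c, k.ε * c, k.ε ^ 2 * c], ?_, ?_, ?_⟩
  · have e2 : k.ε ^ 2 ≠ 1 := by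
      intro h
      exact e1 (by linear_combination e3 - k.ε * h)
    have e4 : k.ε ^ 2 ≠ k.ε := by
      intro h
      have : k.ε * (k.ε - 1) = 0 := by linear_combination h
      rcases mul_eq_zero.1 this with h | h
      exacts [e0 h, e1 (sub_eq_zero.1 h)]
    intro i j hij
    fin_cases i <;> fin_cases j <;> simp [hc0, e1, e2, e4, e4.symm] at hij ⊢
  · intro j
    fin_cases j
    · exact hc'
    · change a * (k.ε * c) ^ 3 + b = 0
      linear_combination hc' + a * c ^ 3 * e3
    · change a * (k.ε ^ 2 * c) ^ 3 + b = 0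
      linear_combination hc' + a * c ^ 3 * (k.ε ^ 3 + 1) * e3
  · intro x y h
    have : (x - c * y) * ((x - k.ε * c * y) * (x - k.ε ^ 2 * c * y)) = 0 := by
      have h5 : a * ((x - c * y) * ((x - k.ε * c * y) * (x - k.ε ^ 2 * c * y))) = 0 := by
        linear_combination h - y ^ 3 * hc' + (-(a * c * x ^ 2 * y) + a * c ^ 2 * y ^ 2 * x * k.ε) * hε
          - a * c ^ 3 * y ^ 3 * e3
      exact (mul_eq_zero.1 h5).resolve_left ha
    rcases mul_eq_zero.1 this with h | h
    · exact ⟨0, sub_eq_zero.1 h⟩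
    rcases mul_eq_zero.1 h with h | h
    · exact ⟨1, sub_eq_zero.1 h⟩
    · exact ⟨2, sub_eq_zero.1 h⟩

/-- Here the plane cubic is c₀x³ + c₁y³, three distinct lines x = κⱼy through (0 : 0 : 1). The two
ratios x/z, y/z generate the maximal ideal at the point above, and so do any two of the linear forms
x/z − κⱼ y/z. -/
theorem isTypeIV_of_coef {t : Fin 2 → ℂ} (ht : t ≠ 0) (h2 : k.coef t 2 = 0) :
    IsTypeIV k.fib (Projectivization.mk ℂ t ht) := by
  have h0 : k.coef t 0 ≠ 0 := fun h => absurd (k.coef_unique ht h h2) (by decide)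
  have h1 : k.coef t 1 ≠ 0 := fun h => absurd (k.coef_unique ht h h2) (by decide)
  obtain ⟨e, he⟩ := exists_complement ht
  obtain ⟨κ, hκi, hκ, hκr⟩ := k.exists_cube_roots h0 h1
  refine ⟨fun x hx => k.fibreReducedAt ht hx h0 h1, fun j => k.lineOver t e (κ j), ?_⟩
  have hv : (![0, 0, 1] : Fin 3 → ℂ) ≠ 0 := fun h => one_ne_zero (congrFun h 2)
  have hvc : diagCubic (k.coef t) ![0, 0, 1] = 0 := by simp [diagCubic, h2]
  refine ⟨K3.point ![0, 0, 1] (k.wForm t e ![0, 0, 1]) hv (k.wForm_equation he hvc), ?_, ?_, ?_⟩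
  · ext p
    rw [Set.mem_preimage, Set.mem_singleton_iff, Set.mem_iUnion]
    constructor
    · intro hp
      obtain ⟨hp1, hp2⟩ := (k.fib_eq_iff' p ht he).1 hp
      rw [diagCubic, h2, zero_mul, add_zero] at hp1
      obtain ⟨j, hj⟩ := hκr _ _ hp1
      exact ⟨j, hp2, hj⟩
    · rintro ⟨j, hj⟩
      exact lineOver_subset_fibre ht (hκ j) he h2 hj
  · exact fun j => ⟨k.isClosed_lineOver t e _, isIsomorphic_lineOver (hκ j) he h2⟩
  · obtain ⟨s, hs, hs1, hs2⟩ := K3.exists_point ![0, 0, 1] (k.wForm t e ![0, 0, 1]) hv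
      (k.wForm_equation he hvc)
    set p := K3.point ![0, 0, 1] (k.wForm t e ![0, 0, 1]) hv (k.wForm_equation he hvc)
    have hp0 : p.xyz 0 = 0 := by
      have := hs1 0
      exact (mul_eq_zero.1 this.symm).resolve_left hs
    have hp1 : p.xyz 1 = 0 := by
      have := hs1 1
      exact (mul_eq_zero.1 this.symm).resolve_left hs
    have hp2 : p.xyz 2 ≠ 0 := fun h2 => p.xyz_ne (by ext i; fin_cases i <;> assumption)
    have hpw : p.w = k.wForm t e p.xyz := by
      rw [wForm_scale hs1] at hs2
      exact (mul_left_cancel₀ (pow_ne_zero 3 hs) hs2).symm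
    intro i j hij
    have hij' : κ i - κ j ≠ 0 := sub_ne_zero.2 fun h => hij (hκi h)
    refine ⟨?_, ?_⟩
    · ext y
      rw [Set.mem_singleton_iff]
      constructor
      · rintro ⟨⟨hw, h3⟩, -, h4⟩
        have hy1 : y.xyz 1 = 0 := by
          have : (κ i - κ j) * y.xyz 1 = 0 := by linear_combination h4 - h3
          exact (mul_eq_zero.1 this).resolve_left hij'
        have hy0 : y.xyz 0 = 0 := by rw [h3, hy1, mul_zero]
        have hy2 : y.xyz 2 ≠ 0 := fun h2 => y.xyz_ne (by ext i; fin_cases i <;> assumption)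
        have hsc : ∀ i, p.xyz i = (p.xyz 2 / y.xyz 2) * y.xyz i := by
          intro i
          fin_cases i
          · simp [hp0, hy0]
          · simp [hp1, hy1]
          · simp [hy2]
        refine K3.ext_of_scale (p.xyz 2 / y.xyz 2) (div_ne_zero hp2 hy2) hsc ?_
        rw [hpw, hw, wForm_scale hsc]
      · rintro rfl
        exact ⟨⟨hpw, by rw [hp0, hp1, mul_zero]⟩, hpw, by rw [hp0, hp1, mul_zero]⟩
    · intro f hf
      obtain ⟨a, b, ha, hb, hn⟩ := exists_eq_ratio hp0 hp1 hf
      have hr0 : RegularAt (ratio 2 0) p := regularAt_ratio 0 hp2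
      have hr1 : RegularAt (ratio 2 1) p := regularAt_ratio 1 hp2
      have hl : ∀ j, RegularAt (fun y => ratio 2 0 y - κ j * ratio 2 1 y) p :=
        fun j => hr0.sub ((RegularAt.const _ p).mul hr1)
      have hz : ∀ j, ∀ y ∈ k.lineOver t e (κ j), ratio 2 0 y - κ j * ratio 2 1 y = 0 := by
        rintro j y ⟨-, hy⟩
        rw [ratio, ratio, hy]
        ring
      -- These two coefficients rewrite a x + b y as a combination of x − κᵢy and x − κⱼy.
      have hc : RegularAt (fun y => (κ i - κ j)⁻¹ * (a y * (-κ j) - b y)) p :=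
        (RegularAt.const _ p).mul ((ha.mul (RegularAt.const _ p)).sub hb)
      have hc' : RegularAt (fun y => (κ i - κ j)⁻¹ * (a y * κ i + b y)) p :=
        (RegularAt.const _ p).mul ((ha.mul (RegularAt.const _ p)).add hb)
      refine ⟨_, _, ⟨hc.mul (hl i), near_of_forall fun y hy => ?_⟩,
        ⟨hc'.mul (hl j), near_of_forall fun y hy => ?_⟩, hn.mono fun y hy => ?_⟩
      · rw [hz i y hy, mul_zero]
      · rw [hz j y hy, mul_zero]
      · rw [hy]
        field_simp
        ring

end RootData


/-! ### The irreducible fibres -/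

/-- A smooth diagonal cubic form is a prime polynomial. -/
theorem prime_diagPoly {c : Fin 3 → ℂ} (hc : ∀ i, c i ≠ 0) : Prime (diagPoly c) := by
  rw [← irreducible_iff_prime, ← MulEquiv.irreducible_iff (finSuccEquiv ℂ 2),
    finSuccEquiv_diagPoly (hc 0), irreducible_isUnit_mul
      (Polynomial.isUnit_C.2 ((isUnit_iff_ne_zero.2 (hc 0)).map C))]
  obtain ⟨κ, hκ⟩ := IsAlgClosed.exists_pow_nat_eq (-(c 2 / c 1)) (n := 3) (by norm_num)
  have hκ0 : κ ≠ 0 := by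
    rintro rfl
    have := hc 1
    have := hc 2
    rw [zero_pow three_ne_zero, eq_comm, neg_eq_zero, div_eq_zero_iff] at hκ
    tauto
  let φ : MvPolynomial (Fin 2) ℂ →+* ℂ := eval ![κ, 1]
  have hφ : RingHom.ker φ ≠ ⊤ := RingHom.ker_ne_top φ
  have hcoeff : ∀ n : ℕ, n < 3 → (Polynomial.X ^ 3 + Polynomial.C (diagTail c)).coeff n
      = if n = 0 then diagTail c else 0 := by
    intro n hn
    rw [Polynomial.coeff_add, Polynomial.coeff_X_pow, Polynomial.coeff_C, if_neg hn.ne, zero_add]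
  have hdeg : (Polynomial.X ^ 3 + Polynomial.C (diagTail c)).degree = 3 :=
    Polynomial.degree_X_pow_add_C (by norm_num) _
  have hmonic : (Polynomial.X ^ 3 + Polynomial.C (diagTail c)).Monic :=
    Polynomial.monic_X_pow_add_C _ (by norm_num)
  have hD : φ (diagTail c) = 0 := by
    have h0 := hc 0
    have h1 := hc 1
    simp only [φ, diagTail, map_add, map_mul, map_pow, eval_C, eval_X, Matrix.cons_val, hκ]
    field_simp
    ring
  -- Eisenstein's criterion in the first variable, at the prime ideal of the point (κ, 1), which is
  -- a simple zero of the tail.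
  refine Polynomial.irreducible_of_eisenstein_criterion (RingHom.ker_isPrime φ) ?_ ?_ ?_ ?_
    hmonic.isPrimitive
  · rw [hmonic.leadingCoeff]
    exact (Ideal.ne_top_iff_one _).1 hφ
  · intro n hn
    rw [hdeg] at hn
    rw [hcoeff n (by exact_mod_cast hn)]
    split_ifs
    · exact hD
    · exact zero_mem _
  · rw [hdeg]
    norm_num
  · rw [hcoeff 0 (by norm_num), if_pos rfl]
    intro h
    -- Elements of the squared ideal have zero derivative at the point, but the derivative of the
    -- tail there is a nonzero multiple of κ².
    have key : ∀ f ∈ RingHom.ker φ ^ 2, φ (pderiv 0 f) = 0 := by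
      intro f hf
      rw [pow_two] at hf
      refine Submodule.mul_induction_on hf (fun a ha b hb => ?_) fun a b ha hb => ?_
      · rw [pderiv_mul, map_add, map_mul, map_mul, (RingHom.mem_ker).1 ha, (RingHom.mem_ker).1 hb,
          mul_zero, zero_mul, add_zero]
      · rw [map_add, map_add, ha, hb, add_zero]
    have h1 := key _ h
    simp [φ, diagTail, hκ0, hc 0, hc 1, pderiv_X] at h1

namespace RootData

variable (k : RootData)

/-- If two nonempty open subsets of the fibre were disjoint, the product of the defining forms,
restricted to the graph, would be divisible by the plane cubic. This cubic is prime and divides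
neither factor. -/
theorem isIrreducible_fibre {t : Fin 2 → ℂ} (ht : t ≠ 0) (hc : ∀ i, k.coef t i ≠ 0) :
    ¬ IsReducibleFibre k.fib (Projectivization.mk ℂ t ht) := by
  obtain ⟨e, he⟩ := exists_complement ht
  rw [IsReducibleFibre, not_not]
  let _ := zariskiTopology K3
  constructor
  · obtain ⟨κ, -, hκ, -⟩ := k.exists_cube_roots (hc 0) (hc 1)
    obtain ⟨p, hp, -⟩ := k.exists_fibre_point ht he (v := ![κ 0, 1, 0])
      (fun h => one_ne_zero (congrFun h 1)) (by simpa [diagCubic] using hκ 0)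
    exact ⟨p, hp⟩
  · rintro u u' hu hu' ⟨x, hx, hxu⟩ ⟨x', hx', hxu'⟩
    obtain ⟨d, b, hb, hbx, hbu⟩ := hu x hxu
    obtain ⟨d', b', hb', hbx', hbu'⟩ := hu' x' hxu'
    by_contra hne
    have hdvd : diagPoly (k.coef t) ∣ k.fibreSubst t e b * k.fibreSubst t e b' := by
      refine diagPoly_dvd k (hc 0) (hc 1) fun v hv0 hvc => ?_
      obtain ⟨p, hp, s, -, h4⟩ := k.exists_fibre_point ht he hv0 hvc
      rw [map_mul, h4 b d hb, h4 b' d' hb']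
      by_contra h5
      exact hne ⟨p, hp, hbu p fun h => h5 (by rw [h]; ring), hbu' p fun h => h5 (by rw [h]; ring)⟩
    have hno : ∀ (x : K3) (b : MvPolynomial (Fin 4) ℂ), k.fib x = Projectivization.mk ℂ t ht →
        evalAt b x ≠ 0 → ¬ diagPoly (k.coef t) ∣ k.fibreSubst t e b := by
      rintro x b hx hbx ⟨q, hq⟩
      obtain ⟨h1, h2⟩ := (k.fib_eq_iff' x ht he).1 hx
      apply hbx
      rw [← k.eval_xyz_fibreSubst h2, hq, map_mul, eval_diagPoly, h1, zero_mul]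
    rcases (prime_diagPoly hc).dvd_or_dvd hdvd with h | h
    exacts [hno x b hx hbx h, hno x' b' hx' hbx' h]

/-- The Weierstrass curve `Y² + Y = X³`. -/
def weierstrass : WeierstrassCurve ℂ := ⟨0, 0, 1, 0, 0⟩

theorem weierstrass_Δ : weierstrass.Δ = -27 := by
  simp [weierstrass, WeierstrassCurve.Δ, WeierstrassCurve.b₂, WeierstrassCurve.b₄,
    WeierstrassCurve.b₆, WeierstrassCurve.b₈]

instance isElliptic_weierstrass : weierstrass.IsElliptic :=
  ⟨by rw [weierstrass_Δ]; exact isUnit_iff_ne_zero.2 (by norm_num)⟩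

theorem weierstrass_j : weierstrass.j = 0 := by
  rw [WeierstrassCurve.j, mul_eq_zero]
  right
  simp [weierstrass, WeierstrassCurve.c₄, WeierstrassCurve.b₂, WeierstrassCurve.b₄]

theorem evalAt_weierstrass (q : P2) : evalAt weierstrass.toProjective.polynomial q
    = HomogeneousCoordinates.rep q 1 ^ 2 * HomogeneousCoordinates.rep q 2
      + HomogeneousCoordinates.rep q 1 * HomogeneousCoordinates.rep q 2 ^ 2
      - HomogeneousCoordinates.rep q 0 ^ 3 := by
  rw [evalAt, WeierstrassCurve.Projective.eval_polynomial]
  simp [weierstrass]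

/-- A change of coordinates that takes a diagonal cubic with coefficients `a i ^ 3` to the
Weierstrass cubic. -/
def toWeierstrass (a v : Fin 3 → ℂ) : Fin 3 → ℂ :=
  ![a 2 * v 2, a 0 * v 0 + a 1 * v 1, k.ε * (a 0 * v 0) + k.ε ^ 2 * (a 1 * v 1)]

/-- The inverse of `toWeierstrass`. -/
def ofWeierstrass (a u : Fin 3 → ℂ) : Fin 3 → ℂ :=
  ![(k.ε ^ 2 * u 1 - u 2) / (a 0 * (k.ε ^ 2 - k.ε)), (u 2 - k.ε * u 1) / (a 1 * (k.ε ^ 2 - k.ε)),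
    u 0 / a 2]

theorem ε_sq_sub_ne_zero : k.ε ^ 2 - k.ε ≠ 0 := by
  intro h
  have : k.ε * (k.ε - 1) = 0 := by linear_combination h
  rcases mul_eq_zero.1 this with h | h
  exacts [k.ε_ne_zero h, k.ε_ne_one (sub_eq_zero.1 h)]

theorem ofWeierstrass_toWeierstrass {a : Fin 3 → ℂ} (ha : ∀ i, a i ≠ 0) (v : Fin 3 → ℂ) :
    k.ofWeierstrass a (k.toWeierstrass a v) = v := by
  have h := k.ε_sq_sub_ne_zero
  have h0 := ha 0
  have h1 := ha 1
  have h2 := ha 2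
  ext i
  fin_cases i
  · change (k.ε ^ 2 * (a 0 * v 0 + a 1 * v 1) - (k.ε * (a 0 * v 0) + k.ε ^ 2 * (a 1 * v 1)))
      / (a 0 * (k.ε ^ 2 - k.ε)) = v 0
    rw [div_eq_iff (mul_ne_zero h0 h)]
    ring
  · change (k.ε * (a 0 * v 0) + k.ε ^ 2 * (a 1 * v 1) - k.ε * (a 0 * v 0 + a 1 * v 1))
      / (a 1 * (k.ε ^ 2 - k.ε)) = v 1
    rw [div_eq_iff (mul_ne_zero h1 h)]
    ring
  · change a 2 * v 2 / a 2 = v 2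
    field_simp

theorem toWeierstrass_ofWeierstrass {a : Fin 3 → ℂ} (ha : ∀ i, a i ≠ 0) (u : Fin 3 → ℂ) :
    k.toWeierstrass a (k.ofWeierstrass a u) = u := by
  have h := k.ε_sq_sub_ne_zero
  have h0 := ha 0
  have h1 := ha 1
  have h2 := ha 2
  have e0 : a 0 * ((k.ε ^ 2 * u 1 - u 2) / (a 0 * (k.ε ^ 2 - k.ε)))
      = (k.ε ^ 2 * u 1 - u 2) / (k.ε ^ 2 - k.ε) := by
    rw [← mul_div_assoc, mul_div_mul_left _ _ h0]
  have e1 : a 1 * ((u 2 - k.ε * u 1) / (a 1 * (k.ε ^ 2 - k.ε)))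
      = (u 2 - k.ε * u 1) / (k.ε ^ 2 - k.ε) := by
    rw [← mul_div_assoc, mul_div_mul_left _ _ h1]
  ext i
  fin_cases i
  · change a 2 * (u 0 / a 2) = u 0
    field_simp
  · change a 0 * ((k.ε ^ 2 * u 1 - u 2) / (a 0 * (k.ε ^ 2 - k.ε)))
      + a 1 * ((u 2 - k.ε * u 1) / (a 1 * (k.ε ^ 2 - k.ε))) = u 1
    rw [e0, e1, ← add_div, div_eq_iff h]
    ring
  · change k.ε * (a 0 * ((k.ε ^ 2 * u 1 - u 2) / (a 0 * (k.ε ^ 2 - k.ε))))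
      + k.ε ^ 2 * (a 1 * ((u 2 - k.ε * u 1) / (a 1 * (k.ε ^ 2 - k.ε)))) = u 2
    rw [e0, e1, ← mul_div_assoc, ← mul_div_assoc, ← add_div, div_eq_iff h]
    ring

theorem toWeierstrass_scale {a v v' : Fin 3 → ℂ} {s : ℂ} (h : ∀ i, v' i = s * v i) (i : Fin 3) :
    k.toWeierstrass a v' i = s * k.toWeierstrass a v i := by
  fin_cases i <;> simp [toWeierstrass, h] <;> ring

theorem ofWeierstrass_scale {a v v' : Fin 3 → ℂ} {s : ℂ} (h : ∀ i, v' i = s * v i) (i : Fin 3) :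
    k.ofWeierstrass a v' i = s * k.ofWeierstrass a v i := by
  fin_cases i <;> simp [ofWeierstrass, h] <;> ring

/-- With A = a₀x, B = a₁y, the relation 1 + ε = −ε² gives u₁ + u₂ = −(ε²A + εB). Hence u₁u₂(u₁ + u₂)
= −(A³ + B³), the three factors being those of a sum of cubes. -/
theorem toWeierstrass_eq {c a : Fin 3 → ℂ} (ha : ∀ i, a i ^ 3 = c i) (v : Fin 3 → ℂ) :
    k.toWeierstrass a v 1 ^ 2 * k.toWeierstrass a v 2 + k.toWeierstrass a v 1
      * k.toWeierstrass a v 2 ^ 2 - k.toWeierstrass a v 0 ^ 3 = -diagCubic c v := by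
  have hε := k.hε
  simp only [toWeierstrass, diagCubic, Matrix.cons_val, ← ha]
  generalize k.ε = ε at hε
  generalize a 0 = a₀, a 1 = a₁, a 2 = a₂, v 0 = x, v 1 = y, v 2 = z
  grind

theorem toWeierstrass_ne_zero {a : Fin 3 → ℂ} (ha : ∀ i, a i ≠ 0) {v : Fin 3 → ℂ} (hv : v ≠ 0) :
    k.toWeierstrass a v ≠ 0 := by
  intro h
  apply hv
  rw [← k.ofWeierstrass_toWeierstrass ha v, h]
  ext i
  fin_cases i <;> simp [ofWeierstrass]

theorem ofWeierstrass_ne_zero {a : Fin 3 → ℂ} (ha : ∀ i, a i ≠ 0) {u : Fin 3 → ℂ} (hu : u ≠ 0) :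
    k.ofWeierstrass a u ≠ 0 := by
  intro h
  apply hu
  rw [← k.toWeierstrass_ofWeierstrass ha u, h]
  ext i
  fin_cases i <;> simp [toWeierstrass]

theorem diagCubic_ofWeierstrass {c a : Fin 3 → ℂ} (ha : ∀ i, a i ^ 3 = c i) (ha0 : ∀ i, a i ≠ 0)
    {u : Fin 3 → ℂ} (hu : u 1 ^ 2 * u 2 + u 1 * u 2 ^ 2 - u 0 ^ 3 = 0) :
    diagCubic c (k.ofWeierstrass a u) = 0 := by
  have h := k.toWeierstrass_eq ha (k.ofWeierstrass a u)
  rw [k.toWeierstrass_ofWeierstrass ha0, hu] at h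
  linear_combination h

theorem isEllipticCurve_fibre {t : Fin 2 → ℂ} (ht : t ≠ 0) (hc : ∀ i, k.coef t i ≠ 0) :
    IsEllipticCurveWithJ (k.fib ⁻¹' {Projectivization.mk ℂ t ht}) 0 := by
  refine ⟨weierstrass, isElliptic_weierstrass, weierstrass_j, ?_⟩
  obtain ⟨e, he⟩ := exists_complement ht
  choose a ha using fun i => IsAlgClosed.exists_pow_nat_eq (k.coef t i) (n := 3) (by norm_num)
  have ha0 : ∀ i, a i ≠ 0 := fun i h => hc i (by rw [← ha, h, zero_pow three_ne_zero])
  set F := k.fib ⁻¹' {Projectivization.mk ℂ t ht} with hF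
  have hFp : ∀ p : F, diagCubic (k.coef t) p.1.xyz = 0 ∧ p.1.w = k.wForm t e p.1.xyz :=
    fun p => (k.fib_eq_iff' p.1 ht he).1 p.2
  let φ₀ : F → P2 := fun p => Projectivization.mk ℂ _ (k.toWeierstrass_ne_zero ha0 p.1.xyz_ne)
  have hφ₀ : ∀ p, φ₀ p ∈ zeroLocus P2 weierstrass.toProjective.polynomial := by
    intro p
    obtain ⟨s, hs, h1⟩ := exists_rep_mk _ (k.toWeierstrass_ne_zero ha0 p.1.xyz_ne)
    change evalAt _ _ = 0
    have h2 := k.toWeierstrass_eq ha p.1.xyz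
    rw [(hFp p).1, h1 0, h1 1, h1 2] at h2
    rw [evalAt_weierstrass]
    exact mul_left_cancel₀ (pow_ne_zero 3 hs) (by linear_combination h2)
  let ψv : P2 → Fin 3 → ℂ := fun u => k.ofWeierstrass a (HomogeneousCoordinates.rep u)
  have hψv : ∀ u, ψv u ≠ 0 := fun u => k.ofWeierstrass_ne_zero ha0 u.rep_nonzero
  have hψc : ∀ u ∈ zeroLocus P2 weierstrass.toProjective.polynomial,
      diagCubic (k.coef t) (ψv u) = 0 := by
    intro u hu
    refine k.diagCubic_ofWeierstrass ha ha0 ?_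
    rw [← evalAt_weierstrass]
    exact hu
  let ψ₀ : zeroLocus P2 weierstrass.toProjective.polynomial → K3 := fun u =>
    K3.point (ψv u) (k.wForm t e (ψv u)) (hψv u) (k.wForm_equation he (hψc u u.2))
  have hψ₀ : ∀ u, ψ₀ u ∈ F := fun u =>
    (k.fib_point_eq_iff _ _ ht).2 ((k.fibre_equations he).2 ⟨hψc u u.2, rfl⟩)
  refine ⟨⟨fun p => ⟨φ₀ p, hφ₀ p⟩, fun u => ⟨ψ₀ u, hψ₀ u⟩, fun p => ?_, fun u => ?_⟩, ?_, ?_⟩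
  · apply Subtype.ext
    obtain ⟨s, hs, h3⟩ := exists_rep_mk _ (k.toWeierstrass_ne_zero ha0 p.1.xyz_ne)
    have h4 : ∀ i, p.1.xyz i = s * ψv (φ₀ p) i := by
      intro i
      rw [← k.ofWeierstrass_scale h3, k.ofWeierstrass_toWeierstrass ha0]
    change ψ₀ ⟨φ₀ p, hφ₀ p⟩ = p.1
    rw [← p.1.point_self]
    refine K3.point_eq s hs h4 ?_
    rw [← wForm_scale h4]
    exact (hFp p).2
  · apply Subtype.ext
    obtain ⟨s, hs, h3, h4⟩ := K3.exists_point (ψv u) (k.wForm t e (ψv u)) (hψv u)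
      (k.wForm_equation he (hψc u u.2))
    change φ₀ ⟨ψ₀ u, hψ₀ u⟩ = u.1
    conv_rhs => rw [← proj_mk_rep u.1]
    refine proj_mk_eq s fun i => ?_
    rw [← k.toWeierstrass_scale h3, k.toWeierstrass_ofWeierstrass ha0]
  · refine IsMorphism.codRestrict (φ := φ₀) ?_ hφ₀
    let P : Fin 3 → MvPolynomial (Fin 4) ℂ := ![C (a 2) * X 2, C (a 0) * X 0 + C (a 1) * X 1,
      C k.ε * (C (a 0) * X 0) + C (k.ε ^ 2) * (C (a 1) * X 1)]
    have hP : ∀ y : F, (fun j => evalAt (P j) y) = k.toWeierstrass a y.1.xyz := by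
      intro y
      ext j
      fin_cases j
      · change evalAt (C (a 2) * X 2) y.1 = _
        rw [evalAt_mul, evalAt_C, evalAt_X]
        rfl
      · change evalAt (C (a 0) * X 0 + C (a 1) * X 1) y.1 = _
        rw [evalAt_add, evalAt_mul, evalAt_mul, evalAt_C, evalAt_C, evalAt_X, evalAt_X]
        rfl
      · change evalAt (C k.ε * (C (a 0) * X 0) + C (k.ε ^ 2) * (C (a 1) * X 1)) y.1 = _
        simp only [evalAt_add, evalAt_mul, evalAt_C, evalAt_X]
        rfl
    refine isMorphism_toProj fun x => ⟨1, P, 0, 1, fun j => ?_, isForm_one, by simp,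
      fun y _ => ?_⟩
    · fin_cases j
      · exact (isForm_K3_X 2).C_mul _
      · exact ((isForm_K3_X 0).C_mul _).add ((isForm_K3_X 1).C_mul _)
      · exact (((isForm_K3_X 0).C_mul _).C_mul _).add (((isForm_K3_X 1).C_mul _).C_mul _)
    · refine ⟨by rw [hP]; exact k.toWeierstrass_ne_zero ha0 y.1.xyz_ne, ?_⟩
      simp only [hP]
      rfl
  · refine IsMorphism.codRestrict (φ := ψ₀) ?_ hψ₀
    let P : Fin 3 → MvPolynomial (Fin 3) ℂ :=
      ![C (a 0 * (k.ε ^ 2 - k.ε))⁻¹ * (C (k.ε ^ 2) * X 1 - X 2),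
        C (a 1 * (k.ε ^ 2 - k.ε))⁻¹ * (X 2 - C k.ε * X 1), C (a 2)⁻¹ * X 0]
    have hX : ∀ i : Fin 3, IsForm P2 (X i : MvPolynomial (Fin 3) ℂ) 1 :=
      fun i => isForm_X (X := P2) i
    have hPf : ∀ j, IsForm P2 (P j) 1 := by
      intro j
      fin_cases j
      · exact (((hX 1).C_mul _).sub (hX 2)).C_mul _
      · exact ((hX 2).sub ((hX 1).C_mul _)).C_mul _
      · exact (hX 0).C_mul _
    have hPv : ∀ u : zeroLocus P2 weierstrass.toProjective.polynomial,
        (fun j => evalAt (P j) u) = ψv u := by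
      intro u
      ext j
      fin_cases j
      · change evalAt (C (a 0 * (k.ε ^ 2 - k.ε))⁻¹ * (C (k.ε ^ 2) * X 1 - X 2)) u.1 = _
        rw [evalAt_mul, evalAt_sub, evalAt_mul, evalAt_C, evalAt_C, evalAt_X, evalAt_X, mul_comm]
        exact (div_eq_mul_inv _ _).symm
      · change evalAt (C (a 1 * (k.ε ^ 2 - k.ε))⁻¹ * (X 2 - C k.ε * X 1)) u.1 = _
        rw [evalAt_mul, evalAt_sub, evalAt_mul, evalAt_C, evalAt_C, evalAt_X, evalAt_X, mul_comm]
        exact (div_eq_mul_inv _ _).symm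
      · change evalAt (C (a 2)⁻¹ * X 0) u.1 = _
        rw [evalAt_mul, evalAt_C, evalAt_X, mul_comm]
        exact (div_eq_mul_inv _ _).symm
    let R : MvPolynomial (Fin 3) ℂ := C (k.wCoef t e 0) * P 0 ^ 3 + C (k.wCoef t e 1) * P 1 ^ 3
      + C (k.wCoef t e 2) * P 2 ^ 3
    have hRf : IsForm P2 R (1 * 3) :=
      (((((hPf 0).pow 3).C_mul _).add (((hPf 1).pow 3).C_mul _)).add (((hPf 2).pow 3).C_mul _))
    have hRv : ∀ u : zeroLocus P2 weierstrass.toProjective.polynomial,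
        evalAt R u = k.wForm t e (ψv u) := by
      intro u
      rw [← hPv, ← diagCubic_wCoef]
      simp only [R, evalAt_add, evalAt_mul, evalAt_C, evalAt_pow]
      rfl
    refine isMorphism_toK3 fun x => ⟨1, P, R, 0, 1, hPf, hRf, isForm_one, by simp, fun u _ => ?_⟩
    refine ⟨by rw [hPv]; exact hψv u, by rw [hPv, hRv]; exact k.wForm_equation he (hψc u u.2), ?_⟩
    simp only [hPv, hRv]
    rfl

/-- The vector over the point `t` in the section given by a cube root `κ` of `-2`. -/
def secVec (κ : ℂ) (t : Fin 2 → ℂ) : Fin 3 → ℂ :=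
  ![-3 * t 0 + (κ ^ 2 + κ + 1) * (k.r * t 1),
    -3 * t 0 + (κ ^ 2 + k.ε * κ + k.ε ^ 2) * (k.r * t 1),
    -3 * t 0 + (κ ^ 2 + k.ε ^ 2 * κ + k.ε) * (k.r * t 1)]

/-- The last coordinate of the section. -/
def secW (κ : ℂ) (t : Fin 2 → ℂ) : ℂ :=
  -3 * k.r * ((-3 * t 0 + κ ^ 2 * (k.r * t 1)) ^ 3 + 5 * (k.r * t 1) ^ 3)

/-- With m = rt₁ and a = −3t₀ + κ²m, the plane coordinates are the discrete Fourier transform of (a,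
κm, m). They trace a line on which the sextic is minus the square of `secW`, and κ³ = −2 is what
makes its point with parameter t lie in the fibre over t. -/
theorem sec_equations {κ : ℂ} (hκ : κ ^ 3 = -2) (t : Fin 2 → ℂ) :
    k.E₁ t (k.secVec κ t) (k.secW κ t) = 0 ∧ k.E₂ t (k.secVec κ t) (k.secW κ t) = 0 := by
  have hε := k.hε
  have hr := k.hr
  simp only [E₁, E₂, secVec, secW, S, U, V, diagCubic, Matrix.cons_val, Pi.one_apply]
  generalize k.ε = ε at hε ⊢
  generalize k.r = r at hr ⊢
  generalize t 0 = l, t 1 = m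
  constructor <;> grind

end RootData


/-! ### Transport of fibrations along automorphisms -/

/-- The fibration `h'` arises from `h` by the automorphism `α` of the surface and the automorphism
`A` of the projective line. -/
structure IsTransport (h h' : K3 → P1) (α : K3 ≃ K3)
    (A : LinearMap.GeneralLinearGroup ℂ (Fin 2 → ℂ)) : Prop where
  morphism : IsMorphism α
  morphism_symm : IsMorphism α.symm
  eq : ∀ x, h' x = A • h (α x)

namespace IsTransport

variable {h h' : K3 → P1} {α : K3 ≃ K3} {A : LinearMap.GeneralLinearGroup ℂ (Fin 2 → ℂ)}

theorem symm (T : IsTransport h h' α A) : IsTransport h' h α.symm A⁻¹ :=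
  ⟨T.morphism_symm, T.morphism, fun x => by rw [T.eq, α.apply_symm_apply, inv_smul_smul]⟩

theorem inv_smul_eq (T : IsTransport h h' α A) (x : K3) : A⁻¹ • h' x = h (α x) := by
  rw [T.eq, inv_smul_smul]

theorem preimage (T : IsTransport h h' α A) (t : P1) : h' ⁻¹' {A • t} = α ⁻¹' (h ⁻¹' {t}) := by
  ext x
  simp only [Set.mem_preimage, Set.mem_singleton_iff, T.eq, smul_left_cancel_iff]

theorem param_comp (T : IsTransport h h' α A) {x : K3} {t : P1 → ℂ}
    (ht : InMaximalIdeal t (h (α x))) : InMaximalIdeal (fun y => t (A⁻¹ • y)) (h' x) := by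
  rw [← T.inv_smul_eq] at ht
  exact ht.comp (isMorphism_smul A⁻¹)

theorem fibreSmoothAt (T : IsTransport h h' α A) {x : K3} (hx : FibreSmoothAt h (α x)) :
    FibreSmoothAt h' x := by
  obtain ⟨t, ht, hsq⟩ := hx
  refine ⟨_, T.param_comp ht, fun h1 => hsq ?_⟩
  rw [← α.symm_apply_apply x] at h1
  have h2 := h1.comp T.morphism_symm
  convert h2 using 1
  ext y
  simp [T.inv_smul_eq]

theorem fibreSmoothAt_iff (T : IsTransport h h' α A) {x : K3} :
    FibreSmoothAt h' x ↔ FibreSmoothAt h (α x) :=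
  ⟨fun hx => T.symm.fibreSmoothAt (by rwa [α.symm_apply_apply]), T.fibreSmoothAt⟩

theorem fibreReducedAt (T : IsTransport h h' α A) {x : K3} (hx : FibreReducedAt h (α x)) :
    FibreReducedAt h' x := by
  intro f hf
  rw [← α.symm_apply_apply x] at hf
  have h1 := hf.comp T.morphism_symm
  have h2 : α.symm ⁻¹' (h' ⁻¹' {h' (α.symm (α x))}) = h ⁻¹' {h (α x)} := by
    ext y
    simp [T.eq]
  rw [h2] at h1
  obtain ⟨t, c, ht, hc, hn⟩ := hx _ h1
  refine ⟨_, c ∘ α, T.param_comp ht, T.morphism x c hc, (T.morphism.near hn).mono fun y hy => ?_⟩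
  simpa [T.inv_smul_eq] using hy

theorem isSmoothFibre (T : IsTransport h h' α A) {t : P1} (ht : IsSmoothFibre h t) :
    IsSmoothFibre h' (A • t) := by
  intro x hx
  refine T.fibreSmoothAt (ht _ ?_)
  rw [← T.inv_smul_eq, hx, inv_smul_smul]

theorem isReducibleFibre (T : IsTransport h h' α A) {t : P1} (ht : IsReducibleFibre h t) :
    IsReducibleFibre h' (A • t) := by
  intro h1
  apply ht
  let _ := zariskiTopology K3
  have h2 := h1.image α T.morphism.continuous.continuousOn
  rwa [T.preimage, Set.image_preimage_eq _ α.surjective] at h2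

theorem isReducibleFibre_iff (T : IsTransport h h' α A) {t : P1} :
    IsReducibleFibre h' (A • t) ↔ IsReducibleFibre h t :=
  ⟨fun ht => by simpa using T.symm.isReducibleFibre ht, T.isReducibleFibre⟩

theorem isTypeIV (T : IsTransport h h' α A) {t : P1} (ht : IsTypeIV h t) :
    IsTypeIV h' (A • t) := by
  obtain ⟨hred, D, p, hD, hD1, hD2⟩ := ht
  refine ⟨fun x hx => T.fibreReducedAt (hred _ ?_), fun i => α ⁻¹' D i, α.symm p, ?_, fun i => ?_,
    fun i j hij => ?_⟩
  · rw [← T.inv_smul_eq, hx, inv_smul_smul]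
  · rw [T.preimage, hD, Set.preimage_iUnion]
  · let _ := zariskiTopology K3
    exact ⟨(hD1 i).1.preimage T.morphism.continuous,
      (isIsomorphic_preimage α T.morphism T.morphism_symm _).trans (hD1 i).2⟩
  · obtain ⟨h1, h2⟩ := hD2 i j hij
    refine ⟨?_, fun f hf => ?_⟩
    · rw [← Set.preimage_inter, h1]
      ext x
      simp [Equiv.eq_symm_apply]
    · obtain ⟨a, b, ha, hb, hn⟩ := h2 _ (hf.comp T.morphism_symm)
      rw [← α.apply_symm_apply p] at ha hb hn
      refine ⟨a ∘ α, b ∘ α, ha.comp T.morphism, hb.comp T.morphism,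
        (T.morphism.near hn).mono fun y hy => ?_⟩
      simpa using hy

theorem isEllipticCurve (T : IsTransport h h' α A) {t : P1} {j : ℂ}
    (ht : IsEllipticCurveWithJ (h ⁻¹' {t}) j) : IsEllipticCurveWithJ (h' ⁻¹' {A • t}) j := by
  obtain ⟨W, hW, hj, hi⟩ := ht
  rw [T.preimage]
  exact ⟨W, hW, hj, (isIsomorphic_preimage α T.morphism T.morphism_symm _).trans hi⟩

theorem isEllipticFibration (T : IsTransport h h' α A) (hh : IsEllipticFibration h) :
    IsEllipticFibration h' where
  morphism := by
    have : h' = (fun t => A • t) ∘ h ∘ α := funext T.eq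
    rw [this]
    exact (isMorphism_smul A).comp (hh.morphism.comp T.morphism)
  surjective t := by
    obtain ⟨x, hx⟩ := hh.surjective (A⁻¹ • t)
    exact ⟨α.symm x, by rw [T.eq, α.apply_symm_apply, hx, smul_inv_smul]⟩
  generic := by
    refine (hh.generic.image fun t => A • t).subset fun t ht => ⟨A⁻¹ • t, fun h1 => ht ?_,
      smul_inv_smul _ _⟩
    have h2 := T.isSmoothFibre h1.1
    obtain ⟨j, hj⟩ := h1.2
    have h3 := T.isEllipticCurve hj
    rw [smul_inv_smul] at h2 h3
    exact ⟨h2, j, h3⟩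

theorem isJacobian (T : IsTransport h h' α A) (hh : IsJacobian h) : IsJacobian h' := by
  obtain ⟨s, hs, hst⟩ := hh
  refine ⟨α.symm ∘ s ∘ fun t => A⁻¹ • t, T.morphism_symm.comp (hs.comp (isMorphism_smul A⁻¹)),
    fun t => ?_⟩
  simp [T.eq, hst]

theorem setOf_isReducibleFibre (T : IsTransport h h' α A) :
    {t | IsReducibleFibre h' t} = (fun t => A • t) '' {t | IsReducibleFibre h t} := by
  ext t
  constructor
  · intro ht
    exact ⟨A⁻¹ • t, T.symm.isReducibleFibre ht, smul_inv_smul _ _⟩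
  · rintro ⟨t, ht, rfl⟩
    exact T.isReducibleFibre ht

theorem singularPoints (T : IsTransport h h' α A) :
    reducibleFibreSingularPoints h' = α ⁻¹' reducibleFibreSingularPoints h := by
  ext x
  change IsReducibleFibre h' (h' x) ∧ ¬ FibreSmoothAt h' x
    ↔ IsReducibleFibre h (h (α x)) ∧ ¬ FibreSmoothAt h (α x)
  rw [T.fibreSmoothAt_iff, T.eq, T.isReducibleFibre_iff]

end IsTransport

/-- A fibre of type IV is reducible. -/
theorem IsTypeIV.isReducibleFibre {h : K3 → P1} {t : P1} (ht : IsTypeIV h t) :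
    IsReducibleFibre h t := by
  obtain ⟨-, D, p, hD, hD1, hD2⟩ := ht
  intro hirr
  let _ := zariskiTopology K3
  -- A component is in bijection with the projective line, which has more than one point.
  have hnot : ∀ i, ¬ D i ⊆ {p} := by
    intro i hi
    obtain ⟨φ, -, -⟩ := (hD1 i).2
    have h1 : φ.symm (Projectivization.mk ℂ ![1, 0] fun h => one_ne_zero (congrFun h 0))
        = φ.symm (Projectivization.mk ℂ ![0, 1] fun h => one_ne_zero (congrFun h 1)) :=
      Subtype.ext ((hi (φ.symm _).2).trans (hi (φ.symm _).2).symm)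
    have h2 := P1_mk_eq_iff.1 (φ.symm.injective h1)
    simp at h2
  have hsub : h ⁻¹' {t} ⊆ D 0 ∪ (D 1 ∪ D 2) := by
    rw [hD]
    refine Set.iUnion_subset fun i => ?_
    fin_cases i
    exacts [Set.subset_union_left, Set.subset_union_left.trans Set.subset_union_right,
      Set.subset_union_right.trans Set.subset_union_right]
  have hle : ∀ i, D i ⊆ h ⁻¹' {t} := fun i => hD ▸ Set.subset_iUnion D i
  -- If the fibre were irreducible, it would lie in D₀ or in D₁ ∪ D₂. Then D₁ or D₀ would be
  -- contained in an intersection of components, which is the point p.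
  rcases isPreirreducible_iff_isClosed_union_isClosed.1 hirr.2 _ _ (hD1 0).1
    ((hD1 1).1.union (hD1 2).1) hsub with h0 | h0
  · refine hnot 1 fun x hx => ?_
    rw [← (hD2 0 1 (by decide)).1]
    exact ⟨h0 (hle 1 hx), hx⟩
  · refine hnot 0 fun x hx => ?_
    rcases h0 (hle 0 hx) with h1 | h1
    · rw [← (hD2 0 1 (by decide)).1]
      exact ⟨hx, h1⟩
    · rw [← (hD2 0 2 (by decide)).1]
      exact ⟨hx, h1⟩


/-! ### The covering involution -/

theorem coveringInvolution_eq (p : K3) : coveringInvolution p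
    = K3.point p.xyz (-p.w) p.xyz_ne (by rw [neg_sq]; exact p.equation) := rfl

theorem coveringInvolution_point (v : Fin 3 → ℂ) (w : ℂ) (hv : v ≠ 0) (h : w ^ 2 + sextic v = 0) :
    coveringInvolution (K3.point v w hv h)
      = K3.point v (-w) hv (by rw [neg_sq]; exact h) := by
  obtain ⟨s, hs, h1, h2⟩ := K3.exists_point v w hv h
  refine K3.point_eq (v := (K3.point v w hv h).xyz) (w := -(K3.point v w hv h).w)
    (hv := K3.xyz_ne _) (h := by rw [neg_sq]; exact K3.equation _) s hs h1 ?_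
  rw [mul_neg, ← h2]

theorem coveringInvolution_involutive : Function.Involutive coveringInvolution := by
  intro p
  obtain ⟨v, w, hv, h, rfl⟩ := p.exists_eq_point
  rw [coveringInvolution_point, coveringInvolution_point]
  simp only [neg_neg]

theorem coverMap_coveringInvolution (p : K3) : coverMap (coveringInvolution p) = coverMap p := by
  obtain ⟨v, w, hv, h, rfl⟩ := p.exists_eq_point
  rw [coveringInvolution_point, coverMap_point, coverMap_point]

theorem isMorphism_coveringInvolution : IsMorphism coveringInvolution := by
  have h1 : ∀ y : K3, (fun j : Fin 3 => evalAt (X j.castSucc : MvPolynomial (Fin 4) ℂ) y)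
      = y.xyz := by
    intro y
    ext j
    rw [RootData.evalAt_xyz]
  have h2 : ∀ y : K3, evalAt (C (-1) * X 3) y = -y.w := fun y => by
    rw [evalAt_mul, evalAt_C, evalAt_w, neg_one_mul]
  refine isMorphism_toK3 fun x => ⟨1, fun i => X i.castSucc, C (-1) * X 3, 0, 1, isForm_K3_X,
    isForm_w.C_mul _, isForm_one, ?_, fun y _ => ⟨?_, ?_, ?_⟩⟩
  · rw [← C_1, evalAt_C]
    exact one_ne_zero
  · rw [h1]
    exact y.xyz_ne
  · rw [h1, h2, neg_sq]
    exact y.equation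
  · rw [coveringInvolution_eq]
    simp only [h1, h2]

theorem isTransport_coveringInvolution (h : K3 → P1) :
    IsTransport h (h ∘ coveringInvolution) coveringInvolution_involutive.toPerm 1 where
  morphism := isMorphism_coveringInvolution
  morphism_symm := isMorphism_coveringInvolution
  eq _ := (one_smul _ _).symm

namespace HesseLift

theorem smul_coveringInvolution (m : HesseLift) (p : K3) :
    m • coveringInvolution p = coveringInvolution (m • p) := by
  obtain ⟨v, w, hv, h, rfl⟩ := p.exists_eq_point
  rw [coveringInvolution_point, smul_point, smul_point, coveringInvolution_point]
  simp only [mul_neg]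

theorem isTransport (m : HesseLift) (h : K3 → P1) :
    IsTransport h (fun p => h (m • p)) (MulAction.toPerm m) 1 where
  morphism := m.isMorphism_smul
  morphism_symm := m⁻¹.isMorphism_smul
  eq _ := (one_smul _ _).symm

theorem isTransport_of_smul {m : HesseLift} {h : K3 → P1}
    {A : LinearMap.GeneralLinearGroup ℂ (Fin 2 → ℂ)} (hA : ∀ p, h (m • p) = A • h p) :
    IsTransport h h (MulAction.toPerm m) A⁻¹ where
  morphism := m.isMorphism_smul
  morphism_symm := m⁻¹.isMorphism_smul
  eq x := by
    rw [MulAction.toPerm_apply, hA, inv_smul_smul]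

theorem exists_of_smul {M : LinearMap.GeneralLinearGroup ℂ (Fin 3 → ℂ)} {a b c d : ℂ}
    (h1 : ∀ v, fermatCubic (M • v) = a * fermatCubic v + b * coordProd v)
    (h2 : ∀ v, coordProd (M • v) = c * fermatCubic v + d * coordProd v)
    (hδ : a * d - b * c ≠ 0) : ∃ m : HesseLift, m.lin = M := by
  obtain ⟨s, hs, h⟩ := exists_field_smul h1 h2
  exact ⟨⟨(M, Units.mk0 s hs), mem_hessianGroup_of_smul h1 h2 hδ, h⟩, rfl⟩

end HesseLift

/-! ### Monomial lifts -/

/-- The invertible linear map with matrix `A` and inverse matrix `B`. -/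
def glOfMatrix {n : ℕ} (A B : Matrix (Fin n) (Fin n) ℂ) (h : A * B = 1) :
    LinearMap.GeneralLinearGroup ℂ (Fin n → ℂ) where
  val := A.toLin'
  inv := B.toLin'
  val_inv := by rw [Module.End.mul_eq_comp, ← Matrix.toLin'_mul, h, Matrix.toLin'_one]; rfl
  inv_val := by
    rw [Module.End.mul_eq_comp, ← Matrix.toLin'_mul, mul_eq_one_comm.1 h, Matrix.toLin'_one]; rfl

theorem glOfMatrix_smul {n : ℕ} {A B : Matrix (Fin n) (Fin n) ℂ} (h : A * B = 1) (v : Fin n → ℂ) :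
    glOfMatrix A B h • v = A.mulVec v := Matrix.toLin'_apply A v

theorem hesseField_apply (v : Fin 3 → ℂ) (i : Fin 3) :
    hesseField v i = v i * (v (i + 1) ^ 3 - v (i + 2) ^ 3) := by
  fin_cases i <;> rfl

theorem fin_three_add (s i : Fin 3) : i + 2 + 1 = i ∧ i + 2 + 2 = i + 1 ∧
    s + (i + 2) + 1 = s + i ∧ s + (i + 2) + 2 = s + (i + 1) ∧ s + (i + 2) ≠ s + (i + 1) ∧
      s + i ≠ s + (i + 1) := by
  revert s i
  decide

theorem fin_three_sub (s i : Fin 3) : i + 2 + 1 = i ∧ i + 2 + 2 = i + 1 ∧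
    s - (i + 2) + 1 = s - (i + 1) ∧ s - (i + 2) + 2 = s - i ∧ s - (i + 2) ≠ s - (i + 1) ∧
      s - i ≠ s - (i + 1) := by
  revert s i
  decide

theorem fin_three_add_cases (s : Fin 3) :
    (s.val = 0 ∧ s + 0 = 0 ∧ s + 1 = 1 ∧ s + 2 = 2) ∨
    (s.val = 1 ∧ s + 0 = 1 ∧ s + 1 = 2 ∧ s + 2 = 0) ∨
    (s.val = 2 ∧ s + 0 = 2 ∧ s + 1 = 0 ∧ s + 2 = 1) := by
  revert s
  decide

theorem fin_three_sub_cases (s : Fin 3) :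
    (s.val = 0 ∧ s - 0 = 0 ∧ s - 1 = 2 ∧ s - 2 = 1) ∨
    (s.val = 1 ∧ s - 0 = 1 ∧ s - 1 = 0 ∧ s - 2 = 2) ∨
    (s.val = 2 ∧ s - 0 = 2 ∧ s - 1 = 1 ∧ s - 2 = 0) := by
  revert s
  decide

theorem injective_fin_three (p : Fin 3 → Fin 3) (hp : Function.Injective p) :
    (∃ s, ∀ i, p i = s + i) ∨ ∃ s, ∀ i, p i = s - i := by
  revert p
  decide

namespace RootData

variable (k : RootData)

/-- Since w and S are multiplied by the same scalar, w ± rS are too, and the only effect on the rows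
is that the second coordinate on the line is multiplied by η. -/
theorem exists_smul_fib_of_forms {m : HesseLift} {η : ℂ} (hη : η ^ 3 = 1)
    (hS : ∀ v : Fin 3 → ℂ, S (m.lin • v) = m.scalar * S v)
    (hU : ∀ v : Fin 3 → ℂ, k.U (m.lin • v) = m.scalar * η * k.U v)
    (hV : ∀ v : Fin 3 → ℂ, k.V (m.lin • v) = m.scalar * η ^ 2 * k.V v) :
    ∃ A : LinearMap.GeneralLinearGroup ℂ (Fin 2 → ℂ), ∀ p, k.fib (m • p) = A • k.fib p := by
  refine ⟨glOfMatrix !![1, 0; 0, η] !![1, 0; 0, η ^ 2] ?_, fun p => ?_⟩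
  · simp [← pow_succ', hη, Matrix.one_fin_two]
  · obtain ⟨t, ht, e⟩ : ∃ t, ∃ ht : t ≠ 0, k.fib p = Projectivization.mk ℂ t ht :=
      ⟨_, _, (proj_mk_rep _).symm⟩
    rw [e, Projectivization.smul_mk]
    obtain ⟨h1, h2⟩ := (k.fib_eq_iff p ht).1 e
    refine (k.fib_point_eq_iff _ _ _).2 ?_
    simp only [E₁, E₂] at h1 h2 ⊢
    rw [hS, hU, hV, glOfMatrix_smul]
    simp only [Matrix.mulVec, dotProduct, Fin.sum_univ_two, Matrix.of_apply, Matrix.cons_val]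
    constructor
    · linear_combination m.scalar * η * h1
    · linear_combination m.scalar * h2 + 2 * m.scalar * t 1 * k.V p.xyz * hη

/-- Here w and S acquire opposite signs, so w − rS and w + rS are exchanged. As U and V are
exchanged as well, the two rows change places and the same fibration results, not its conjugate. -/
theorem exists_smul_fib_of_swapped_forms {m : HesseLift} {η : ℂ} (hη : η ^ 3 = 1)
    (hS : ∀ v : Fin 3 → ℂ, S (m.lin • v) = -m.scalar * S v)
    (hU : ∀ v : Fin 3 → ℂ, k.U (m.lin • v) = -m.scalar * η * k.V v)
    (hV : ∀ v : Fin 3 → ℂ, k.V (m.lin • v) = -m.scalar * η ^ 2 * k.U v) :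
    ∃ A : LinearMap.GeneralLinearGroup ℂ (Fin 2 → ℂ), ∀ p, k.fib (m • p) = A • k.fib p := by
  refine ⟨glOfMatrix !![0, 1; η, 0] !![0, η ^ 2; 1, 0] ?_, fun p => ?_⟩
  · simp [← pow_succ', hη, Matrix.one_fin_two]
  · obtain ⟨t, ht, e⟩ : ∃ t, ∃ ht : t ≠ 0, k.fib p = Projectivization.mk ℂ t ht :=
      ⟨_, _, (proj_mk_rep _).symm⟩
    rw [e, Projectivization.smul_mk]
    obtain ⟨h1, h2⟩ := (k.fib_eq_iff p ht).1 e
    refine (k.fib_point_eq_iff _ _ _).2 ?_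
    simp only [E₁, E₂] at h1 h2 ⊢
    rw [hS, hU, hV, glOfMatrix_smul]
    simp only [Matrix.mulVec, dotProduct, Fin.sum_univ_two, Matrix.of_apply, Matrix.cons_val]
    constructor
    · linear_combination m.scalar * η * h2
    · linear_combination m.scalar * h1 - 2 * m.scalar * t 0 * k.U p.xyz * hη

/-- The covariance of the field forces the cubes of all matrix entries to equal the scalar that
multiplies w. The cyclic shift then makes S, U, V eigenforms. -/
theorem exists_smul_fib_of_cyclic {m : HesseLift} {a : Fin 3 → ℂ} {s : Fin 3} (ha : ∀ i, a i ≠ 0)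
    (hm : ∀ (v : Fin 3 → ℂ) i, (m.lin • v) i = a i * v (s + i)) :
    ∃ A : LinearMap.GeneralLinearGroup ℂ (Fin 2 → ℂ), ∀ p, k.fib (m • p) = A • k.fib p := by
  have hc : ∀ i, a i ^ 3 = m.scalar := by
    intro i
    -- The test vector has a single zero, placed so that in component i + 2 of the transformed field
    -- only the cube of entry i survives.
    have h := congrFun (m.field_smul fun j => if j = s + (i + 1) then 0 else 1) (i + 2)
    obtain ⟨e1, e2, e3, e4, e5, e6⟩ := fin_three_add s i
    rw [Pi.smul_apply, hm, hesseField_apply, hesseField_apply, hm, hm, hm, e1, e2, e3, e4,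
      if_pos rfl, if_neg e5, if_neg e6] at h
    refine mul_left_cancel₀ (ha (i + 2)) ?_
    rw [smul_eq_mul] at h
    linear_combination h
  have h0 := hc 0
  have h1 := hc 1
  have h2 := hc 2
  have hε := k.ε_cube
  refine k.exists_smul_fib_of_forms (η := k.ε ^ (2 * s.val)) ?_ (fun v => ?_) (fun v => ?_)
    fun v => ?_
  · rw [← pow_mul, mul_comm, pow_mul, hε, one_pow]
  · simp only [S, diagCubic, hm, mul_pow, h0, h1, h2, Pi.one_apply]
    rcases fin_three_add_cases s with ⟨-, e0, e1, e2⟩ | ⟨-, e0, e1, e2⟩ | ⟨-, e0, e1, e2⟩ <;>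
      rw [e0, e1, e2] <;> ring
  · simp only [U, diagCubic, hm, mul_pow, h0, h1, h2, Matrix.cons_val]
    generalize k.ε = ε at hε
    rcases fin_three_add_cases s with ⟨e, e0, e1, e2⟩ | ⟨e, e0, e1, e2⟩ | ⟨e, e0, e1, e2⟩ <;>
      rw [e, e0, e1, e2] <;> grind
  · simp only [V, diagCubic, hm, mul_pow, h0, h1, h2, Matrix.cons_val]
    generalize k.ε = ε at hε
    rcases fin_three_add_cases s with ⟨e, e0, e1, e2⟩ | ⟨e, e0, e1, e2⟩ | ⟨e, e0, e1, e2⟩ <;>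
      rw [e, e0, e1, e2] <;> grind

/-- An odd permutation reverses the differences of cubes in the field, so the cubes of the entries
are minus the scalar. This sign decides that the fibration goes to itself and not to its conjugate.
-/
theorem exists_smul_fib_of_anticyclic {m : HesseLift} {a : Fin 3 → ℂ} {s : Fin 3}
    (ha : ∀ i, a i ≠ 0) (hm : ∀ (v : Fin 3 → ℂ) i, (m.lin • v) i = a i * v (s - i)) :
    ∃ A : LinearMap.GeneralLinearGroup ℂ (Fin 2 → ℂ), ∀ p, k.fib (m • p) = A • k.fib p := by
  have hc : ∀ i, a i ^ 3 = -m.scalar := by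
    intro i
    have h := congrFun (m.field_smul fun j => if j = s - (i + 1) then 0 else 1) (i + 2)
    obtain ⟨e1, e2, e3, e4, e5, e6⟩ := fin_three_sub s i
    rw [Pi.smul_apply, hm, hesseField_apply, hesseField_apply, hm, hm, hm, e1, e2, e3, e4,
      if_pos rfl, if_neg e5, if_neg e6] at h
    refine mul_left_cancel₀ (ha (i + 2)) ?_
    rw [smul_eq_mul] at h
    linear_combination h
  have h0 := hc 0
  have h1 := hc 1
  have h2 := hc 2
  have hε := k.ε_cube
  refine k.exists_smul_fib_of_swapped_forms (η := k.ε ^ s.val) ?_ (fun v => ?_) (fun v => ?_)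
    fun v => ?_
  · rw [← pow_mul, mul_comm, pow_mul, hε, one_pow]
  · simp only [S, diagCubic, hm, mul_pow, h0, h1, h2, Pi.one_apply]
    rcases fin_three_sub_cases s with ⟨-, e0, e1, e2⟩ | ⟨-, e0, e1, e2⟩ | ⟨-, e0, e1, e2⟩ <;>
      rw [e0, e1, e2] <;> ring
  · simp only [U, V, diagCubic, hm, mul_pow, h0, h1, h2, Matrix.cons_val]
    generalize k.ε = ε at hε
    rcases fin_three_sub_cases s with ⟨e, e0, e1, e2⟩ | ⟨e, e0, e1, e2⟩ | ⟨e, e0, e1, e2⟩ <;>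
      rw [e, e0, e1, e2] <;> grind
  · simp only [U, V, diagCubic, hm, mul_pow, h0, h1, h2, Matrix.cons_val]
    generalize k.ε = ε at hε
    rcases fin_three_sub_cases s with ⟨e, e0, e1, e2⟩ | ⟨e, e0, e1, e2⟩ | ⟨e, e0, e1, e2⟩ <;>
      rw [e, e0, e1, e2] <;> grind

/-- The lifts of the stabilizer of the coordinate triangle preserve the fibration. -/
theorem exists_smul_fib {m : HesseLift}
    (hm : ∀ j, ∃ i, ∀ l, l ≠ i → (m.lin • (Pi.single j 1 : Fin 3 → ℂ)) l = 0) :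
    ∃ A : LinearMap.GeneralLinearGroup ℂ (Fin 2 → ℂ), ∀ p, k.fib (m • p) = A • k.fib p := by
  choose q hq using hm
  have hv : ∀ v : Fin 3 → ℂ, ∀ l, (m.lin • v) l
      = ∑ j, v j * (m.lin • (Pi.single j 1 : Fin 3 → ℂ)) l := by
    intro v l
    conv_lhs => rw [pi_eq_sum_univ' v]
    change (m.lin.1 (∑ j, v j • _)) l = _
    rw [map_sum, Finset.sum_apply]
    refine Finset.sum_congr rfl fun j _ => ?_
    rw [map_smul]
    rfl
  -- Each column is supported in one row. Invertibility excludes a zero row, so the matrix is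
  -- monomial; its permutation is a cyclic shift or a reflection.
  have hsurj : Function.Surjective q := by
    intro i
    by_contra hi
    push Not at hi
    have h1 := congrFun (smul_inv_smul m.lin (Pi.single i 1 : Fin 3 → ℂ)) i
    rw [hv, Finset.sum_eq_zero fun j _ => by rw [hq j i (hi j).symm, mul_zero]] at h1
    simp at h1
  have hbij : Function.Bijective q := Finite.surjective_iff_bijective.1 hsurj
  let π := Equiv.ofBijective q hbij
  let a : Fin 3 → ℂ := fun i => (m.lin • (Pi.single (π.symm i) 1 : Fin 3 → ℂ)) i
  have hπ : ∀ (v : Fin 3 → ℂ) i, (m.lin • v) i = a i * v (π.symm i) := by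
    intro v i
    rw [hv, Finset.sum_eq_single (π.symm i), mul_comm]
    · intro j _ hj
      rw [hq j i, mul_zero]
      rintro rfl
      exact hj (π.symm_apply_apply j).symm
    · simp
  have ha : ∀ i, a i ≠ 0 := by
    intro i hi
    have h1 := congrFun (smul_inv_smul m.lin (Pi.single i 1 : Fin 3 → ℂ)) i
    rw [hπ, hi, zero_mul] at h1
    simp at h1
  rcases injective_fin_three _ π.symm.injective with ⟨s, hs⟩ | ⟨s, hs⟩
  · exact k.exists_smul_fib_of_cyclic ha fun v i => by rw [hπ, hs]
  · exact k.exists_smul_fib_of_anticyclic ha fun v i => by rw [hπ, hs]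

end RootData


/-! ### The four triangles -/

/-- The vector is a multiple of a coordinate vector. -/
def IsVertex (v : Fin 3 → ℂ) : Prop := ∃ i, ∀ l, l ≠ i → v l = 0

theorem isVertex_iff {v : Fin 3 → ℂ} :
    IsVertex v ↔ v 1 * v 2 = 0 ∧ v 0 * v 2 = 0 ∧ v 0 * v 1 = 0 := by
  constructor
  · rintro ⟨i, hi⟩
    fin_cases i
    · simp [hi 1, hi 2]
    · simp [hi 0, hi 2]
    · simp [hi 0, hi 1]
  · rintro ⟨h1, h2, h3⟩
    by_cases h0 : v 0 = 0
    · rcases mul_eq_zero.1 h1 with h | h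
      · exact ⟨2, fun l hl => by fin_cases l <;> simp_all⟩
      · exact ⟨1, fun l hl => by fin_cases l <;> simp_all⟩
    · exact ⟨0, fun l hl => by fin_cases l <;> simp_all⟩

theorem isVertex_scale {v v' : Fin 3 → ℂ} {s : ℂ} (hs : s ≠ 0) (h : ∀ i, v' i = s * v i) :
    IsVertex v' ↔ IsVertex v := by
  simp [IsVertex, h, hs]

theorem eval_pderiv_hesseCubic (a b : ℂ) (v : Fin 3 → ℂ) (j : Fin 3) :
    eval v (pderiv j (hesseCubic a b)) = 3 * a * v j ^ 2 + b * (v (j + 1) * v (j + 2)) := by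
  fin_cases j <;> simp [hesseCubic, pderiv_X] <;> ring

namespace RootData

variable (k : RootData)

/-- A linear map that takes a triangle of the Hesse pencil to the coordinate triangle. -/
def hesseGl (η : ℂ) (hη : η ^ 3 = 1) : LinearMap.GeneralLinearGroup ℂ (Fin 3 → ℂ) :=
  glOfMatrix !![1, 1, η; 1, k.ε, k.ε ^ 2 * η; 1, k.ε ^ 2, k.ε * η]
    !![1 / 3, 1 / 3, 1 / 3; 1 / 3, k.ε ^ 2 / 3, k.ε / 3;
      η ^ 2 / 3, k.ε * η ^ 2 / 3, k.ε ^ 2 * η ^ 2 / 3] (by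
    have hε := k.hε
    generalize k.ε = ε at hε
    ext i j
    fin_cases i <;> fin_cases j <;> simp [Matrix.mul_apply, Fin.sum_univ_three] <;> grind)

theorem hesseGl_smul {η : ℂ} (hη : η ^ 3 = 1) (v : Fin 3 → ℂ) : k.hesseGl η hη • v
    = ![v 0 + v 1 + η * v 2, v 0 + k.ε * v 1 + k.ε ^ 2 * η * v 2,
      v 0 + k.ε ^ 2 * v 1 + k.ε * η * v 2] := by
  rw [hesseGl, glOfMatrix_smul]
  ext i
  fin_cases i <;> simp [Matrix.mulVec, dotProduct, Fin.sum_univ_three]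

theorem fermatCubic_hesseGl_smul {η : ℂ} (hη : η ^ 3 = 1) (v : Fin 3 → ℂ) :
    fermatCubic (k.hesseGl η hη • v) = 3 * fermatCubic v + 18 * η * coordProd v := by
  have hε := k.hε
  rw [hesseGl_smul]
  simp only [fermatCubic, coordProd, Matrix.cons_val]
  generalize k.ε = ε at hε
  generalize v 0 = x, v 1 = y, v 2 = z
  grind

theorem coordProd_hesseGl_smul {η : ℂ} (hη : η ^ 3 = 1) (v : Fin 3 → ℂ) :
    coordProd (k.hesseGl η hη • v) = 1 * fermatCubic v + -3 * η * coordProd v := by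
  have hε := k.hε
  rw [hesseGl_smul]
  simp only [fermatCubic, coordProd, Matrix.cons_val]
  generalize k.ε = ε at hε
  generalize v 0 = x, v 1 = y, v 2 = z
  grind

theorem exists_lift_hesseGl {η : ℂ} (hη : η ^ 3 = 1) : ∃ m : HesseLift, m.lin = k.hesseGl η hη := by
  have h0 : η ≠ 0 := by
    rintro rfl
    norm_num at hη
  refine HesseLift.exists_of_smul (k.fermatCubic_hesseGl_smul hη) (k.coordProd_hesseGl_smul hη) ?_
  ring_nf
  simpa using h0

/-- The product of the three linear forms of the map is the equation of the triangle, by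
`coordProd_hesseGl_smul`. Its singular points are the points where two of these independent forms
vanish. -/
theorem isVertex_hesseGl_iff {η : ℂ} (hη : η ^ 3 = 1) (v : Fin 3 → ℂ) :
    IsVertex (k.hesseGl η hη • v) ↔
      ∀ j, eval v (pderiv j (hesseCubic 1 (-3 * η))) = 0 := by
  have hε := k.hε
  simp only [eval_pderiv_hesseCubic, Fin.forall_fin_succ, isVertex_iff, hesseGl_smul]
  simp
  generalize k.ε = ε at hε
  generalize v 0 = x, v 1 = y, v 2 = z
  constructor
  · rintro ⟨h1, h2, h3⟩
    refine ⟨?_, ?_, ?_⟩ <;> grind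
  · rintro ⟨h1, h2, h3⟩
    refine ⟨?_, ?_, ?_⟩ <;> grind

theorem ε_sq_cube : (k.ε ^ 2) ^ 3 = 1 := by rw [← pow_mul, mul_comm, pow_mul, k.ε_cube, one_pow]

/-- The linear maps that take the four triangles to the coordinate triangle. -/
def liftLin : Fin 4 → LinearMap.GeneralLinearGroup ℂ (Fin 3 → ℂ) :=
  ![1, k.hesseGl 1 (one_pow 3), k.hesseGl k.ε k.ε_cube,
    k.hesseGl (k.ε ^ 2) k.ε_sq_cube]

theorem exists_lift (i : Fin 4) : ∃ m : HesseLift, m.lin = k.liftLin i := by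
  fin_cases i
  · exact ⟨1, rfl⟩
  · exact k.exists_lift_hesseGl (one_pow 3)
  · exact k.exists_lift_hesseGl k.ε_cube
  · exact k.exists_lift_hesseGl k.ε_sq_cube

/-- Lifts that take the four triangles to the coordinate triangle. -/
def lift (i : Fin 4) : HesseLift := (k.exists_lift i).choose

theorem lift_lin (i : Fin 4) : (k.lift i).lin = k.liftLin i := (k.exists_lift i).choose_spec

theorem mem_triangleVertices_iff (i : Fin 4) (p : P2) : p ∈ triangleVertices k.ε i ↔
    IsVertex (k.liftLin i • HomogeneousCoordinates.rep p) := by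
  change (∀ j, eval (HomogeneousCoordinates.rep p) (pderiv j (triangle k.ε i)) = 0) ↔ _
  fin_cases i
  · change (∀ j, eval _ (pderiv j (hesseCubic 0 1)) = 0) ↔
      IsVertex ((1 : LinearMap.GeneralLinearGroup ℂ (Fin 3 → ℂ)) • _)
    rw [one_smul, isVertex_iff]
    simp only [eval_pderiv_hesseCubic, Fin.forall_fin_succ]
    simp [mul_comm]
  · have := k.isVertex_hesseGl_iff (one_pow 3) (HomogeneousCoordinates.rep p)
    rw [mul_one] at this
    exact this.symm
  · exact (k.isVertex_hesseGl_iff k.ε_cube _).symm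
  · exact (k.isVertex_hesseGl_iff k.ε_sq_cube _).symm

theorem smul_mem_triangleVertices_iff (i : Fin 4) (p : P2) :
    (k.lift i).lin • p ∈ triangleVertices k.ε 0 ↔ p ∈ triangleVertices k.ε i := by
  rw [mem_triangleVertices_iff, mem_triangleVertices_iff, lift_lin]
  change IsVertex ((1 : LinearMap.GeneralLinearGroup ℂ (Fin 3 → ℂ)) • _) ↔ _
  rw [one_smul]
  conv_lhs => rw [← proj_mk_rep p, Projectivization.smul_mk]
  obtain ⟨s, hs, h⟩ := exists_rep_mk (k.liftLin i • HomogeneousCoordinates.rep p)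
    ((smul_ne_zero_iff_ne _).2 p.rep_nonzero)
  exact (isVertex_scale hs h).symm

theorem mk_mem_triangleVertices_iff {v : Fin 3 → ℂ} (hv : v ≠ 0) (i : Fin 4) :
    Projectivization.mk ℂ v hv ∈ triangleVertices k.ε i ↔ IsVertex (k.liftLin i • v) := by
  rw [mem_triangleVertices_iff]
  obtain ⟨s, hs, h⟩ := exists_rep_mk v hv
  refine (isVertex_scale hs fun l => ?_).symm
  conv_lhs => rw [show v = s • HomogeneousCoordinates.rep (Projectivization.mk ℂ v hv)
    from funext h]
  exact congrFun (((k.liftLin i) : (Fin 3 → ℂ) →ₗ[ℂ] (Fin 3 → ℂ)).map_smul s _) l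

theorem liftLin_succ (i : Fin 3) : ∃ hη : (![1, k.ε, k.ε ^ 2] : Fin 3 → ℂ) i ^ 3 = 1,
    k.liftLin i.succ = k.hesseGl (![1, k.ε, k.ε ^ 2] i) hη := by
  fin_cases i
  exacts [⟨one_pow 3, rfl⟩, ⟨k.ε_cube, rfl⟩, ⟨k.ε_sq_cube, rfl⟩]

theorem roots_injective : Function.Injective (![1, k.ε, k.ε ^ 2] : Fin 3 → ℂ) := by
  have e1 := k.ε_ne_one
  have e2 := k.ε_sq_sub_ne_zero
  have e3 : k.ε ^ 2 ≠ 1 := by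
    intro h
    exact e1 (by linear_combination k.ε_cube - k.ε * h)
  have e4 : k.ε ^ 2 ≠ k.ε := sub_ne_zero.1 e2
  intro i j hij
  fin_cases i <;> fin_cases j <;>
    first
    | rfl
    | exact absurd hij e1
    | exact absurd hij.symm e1
    | exact absurd hij e3
    | exact absurd hij.symm e3
    | exact absurd hij e4
    | exact absurd hij.symm e4

theorem triangleVertices_injective : Function.Injective (triangleVertices k.ε) := by
  have hne : ∀ i : Fin 3, triangleVertices k.ε 0 ≠ triangleVertices k.ε i.succ := by
    intro i h
    have h1 : Projectivization.mk ℂ ![1, 0, 0] (fun h => one_ne_zero (congrFun h 0))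
        ∈ triangleVertices k.ε 0 := by
      rw [mk_mem_triangleVertices_iff]
      change IsVertex ((1 : LinearMap.GeneralLinearGroup ℂ (Fin 3 → ℂ)) • _)
      rw [one_smul, isVertex_iff]
      simp
    obtain ⟨hη, e⟩ := k.liftLin_succ i
    rw [h, mk_mem_triangleVertices_iff, e, isVertex_hesseGl_iff] at h1
    have h2 := h1 0
    rw [eval_pderiv_hesseCubic] at h2
    norm_num at h2
  intro i j hij
  induction i using Fin.cases with
  | zero =>
    induction j using Fin.cases with
    | zero => rfl
    | succ j => exact absurd hij (hne j)
  | succ i =>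
    induction j using Fin.cases with
    | zero => exact absurd hij.symm (hne i)
    | succ j =>
      obtain ⟨hη, e⟩ := k.liftLin_succ i
      obtain ⟨hη', e'⟩ := k.liftLin_succ j
      congr 1
      apply k.roots_injective
      generalize (![1, k.ε, k.ε ^ 2] : Fin 3 → ℂ) i = η at hη e
      generalize (![1, k.ε, k.ε ^ 2] : Fin 3 → ℂ) j = η' at hη' e'
      -- This vertex of the triangle with parameter η determines the parameter: the first partial
      -- derivative for η' vanishes there only if η'η² = 1.
      have h1 : Projectivization.mk ℂ ![1, 1, η ^ 2] (fun h => one_ne_zero (congrFun h 0))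
          ∈ triangleVertices k.ε i.succ := by
        rw [mk_mem_triangleVertices_iff, e, isVertex_hesseGl_iff]
        intro l
        rw [eval_pderiv_hesseCubic]
        fin_cases l <;> simp <;> grind
      rw [hij, mk_mem_triangleVertices_iff, e', isVertex_hesseGl_iff] at h1
      have h2 := h1 0
      rw [eval_pderiv_hesseCubic] at h2
      simp at h2
      linear_combination η * h2 / 3 + η' * hη

theorem eq_root_of_cube {η : ℂ} (hη : η ^ 3 = 1) : η = 1 ∨ η = k.ε ∨ η = k.ε ^ 2 := by
  have : (η - 1) * ((η - k.ε) * (η - k.ε ^ 2)) = 0 := by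
    linear_combination hη - k.ε_cube + (-η ^ 2 + η * k.ε) * k.hε + k.hε * 0
  rcases mul_eq_zero.1 this with h | h
  · exact Or.inl (sub_eq_zero.1 h)
  rcases mul_eq_zero.1 h with h | h
  exacts [Or.inr (Or.inl (sub_eq_zero.1 h)), Or.inr (Or.inr (sub_eq_zero.1 h))]

/-- Every element of the Hessian group takes one of the four triangles to the coordinate
triangle, vertices to vertices. -/
theorem exists_isVertex_lift (m : HesseLift) :
    ∃ i, ∀ j, IsVertex ((k.lift i * m).lin • (Pi.single j 1 : Fin 3 → ℂ)) := by
  obtain ⟨⟨a, b, hF⟩, ⟨c, d, hG⟩⟩ := exists_hesse_smul k.hε m.2.1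
  set u : Fin 3 → Fin 3 → ℂ := fun j => m.lin • (Pi.single j 1 : Fin 3 → ℂ) with hu
  have hu0 : ∀ j, u j ≠ 0 := fun j => (smul_ne_zero_iff_ne _).2 (by simp)
  -- The field vanishes at the vertices of the triangles, where the gradients of the pencil are
  -- dependent, and covariance carries its zeros to zeros. The generators take the same values a and
  -- c at all three images, so these belong to one triangle.
  have hfield : ∀ j, hesseField (u j) = 0 := by
    intro j
    have h0 : hesseField (Pi.single j 1 : Fin 3 → ℂ) = 0 := by
      ext l
      fin_cases j <;> fin_cases l <;> simp [hesseField]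
    simp only [hu, m.field_smul, h0, smul_zero]
  have hFu : ∀ j, fermatCubic (u j) = a := by
    intro j
    refine (hF _).trans ?_
    fin_cases j <;> simp [fermatCubic, coordProd]
  have hGu : ∀ j, coordProd (u j) = c := by
    intro j
    refine (hG _).trans ?_
    fin_cases j <;> simp [fermatCubic, coordProd]
  have hlin : ∀ i j, (k.lift i * m).lin • (Pi.single j 1 : Fin 3 → ℂ) = k.liftLin i • u j := by
    intro i j
    rw [← lift_lin, hu, smul_smul]
    rfl
  simp only [hlin]
  have hx : ∀ j, u j 0 * (u j 1 ^ 3 - u j 2 ^ 3) = 0 := fun j => congrFun (hfield j) 0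
  have hy : ∀ j, u j 1 * (u j 2 ^ 3 - u j 0 ^ 3) = 0 := fun j => congrFun (hfield j) 1
  have hz : ∀ j, u j 2 * (u j 0 ^ 3 - u j 1 ^ 3) = 0 := fun j => congrFun (hfield j) 2
  simp only [fermatCubic, coordProd] at hFu hGu
  by_cases hc : c = 0
  · refine ⟨0, fun j => ?_⟩
    change IsVertex ((1 : LinearMap.GeneralLinearGroup ℂ (Fin 3 → ℂ)) • _)
    rw [one_smul, isVertex_iff]
    have h1 := hx j
    have h2 := hy j
    have h3 := hz j
    have h4 := hGu j
    rw [hc] at h4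
    generalize u j 0 = x, u j 1 = y, u j 2 = z at h1 h2 h3 h4 ⊢
    rcases mul_eq_zero.1 h4 with h | rfl
    · rcases mul_eq_zero.1 h with rfl | rfl <;> simp_all
    · simp_all
  · have hne : ∀ j, u j 0 ≠ 0 ∧ u j 1 ≠ 0 ∧ u j 2 ≠ 0 := by
      intro j
      refine ⟨?_, ?_, ?_⟩ <;> intro h <;> apply hc <;> rw [← hGu j, h] <;> ring
    have hcube : ∀ j, u j 1 ^ 3 = u j 0 ^ 3 ∧ u j 2 ^ 3 = u j 0 ^ 3 := by
      intro j
      have h1 := (mul_eq_zero.1 (hy j)).resolve_left (hne j).2.1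
      have h2 := (mul_eq_zero.1 (hz j)).resolve_left (hne j).2.2
      exact ⟨by linear_combination -h2, by linear_combination h1⟩
    have ha : ∀ j, u j 0 ^ 3 = a / 3 := by
      intro j
      have h1 := hFu j
      rw [(hcube j).1, (hcube j).2] at h1
      linear_combination h1 / 3
    -- For c ≠ 0 the three coordinates of each image have the common cube a/3 and product c. The
    -- vertices of the triangle with parameter η satisfy x³ = η·xyz, which dictates η; comparing
    -- cubes gives η³ = 1.
    obtain ⟨η, hη⟩ : ∃ η, η * c = a / 3 := ⟨a / 3 / c, by field_simp⟩
    have hη3 : η ^ 3 = 1 := by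
      have h1 : c ^ 3 = (a / 3) ^ 3 := by
        rw [← hGu 0, mul_pow, mul_pow, (hcube 0).1, (hcube 0).2, ha]
        ring
      refine mul_right_cancel₀ (pow_ne_zero 3 hc) ?_
      rw [← mul_pow, hη, h1, one_mul]
    have key : ∀ j, IsVertex (k.hesseGl η hη3 • u j) := by
      intro j
      rw [k.isVertex_hesseGl_iff hη3]
      have h1 : η * (u j 0 * u j 1 * u j 2) = u j 0 ^ 3 := by rw [hGu, hη, ha]
      obtain ⟨h2, h3⟩ := hcube j
      obtain ⟨n0, n1, n2⟩ := hne j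
      simp only [eval_pderiv_hesseCubic, Fin.forall_fin_succ]
      simp
      refine ⟨mul_left_cancel₀ n0 ?_, mul_left_cancel₀ n1 ?_, mul_left_cancel₀ n2 ?_⟩
      · linear_combination -3 * h1
      · linear_combination -3 * h1 + 3 * h2
      · linear_combination -3 * h1 + 3 * h3
    rcases k.eq_root_of_cube hη3 with rfl | rfl | rfl
    exacts [⟨1, key⟩, ⟨2, key⟩, ⟨3, key⟩]

/-- The index j is chosen so that (lift j)(lift i · m)⁻¹ preserves the coordinate triangle; such a
lift changes `fib` only by an automorphism of the line. -/
theorem exists_smul_fib_lift (i : Fin 4) (m : HesseLift) : ∃ j,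
    ∃ A : LinearMap.GeneralLinearGroup ℂ (Fin 2 → ℂ),
      ∀ p, k.fib (k.lift j • p) = A • k.fib (k.lift i • m • p) := by
  obtain ⟨j, hj⟩ := k.exists_isVertex_lift (k.lift i * m)⁻¹
  obtain ⟨A, hA⟩ := k.exists_smul_fib hj
  refine ⟨j, A, fun p => ?_⟩
  rw [← hA, mul_smul, ← mul_smul (k.lift i), inv_smul_smul]

end RootData


/-- The properties of an elliptic fibration with six fibres of type IV whose other fibres have
`j`-invariant zero; `T` is the image in the plane of the set of singular points of the reducible
fibres. -/
structure IsEquianharmonic (f : K3 → P1) (T : Set P2) : Prop where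
  isEllipticFibration : IsEllipticFibration f
  smooth : ∀ t, IsSmoothFibre f t → IsEllipticCurveWithJ (f ⁻¹' {t}) 0
  ncard : {t | IsReducibleFibre f t}.ncard = 6
  isTypeIV : ∀ t, IsReducibleFibre f t → IsTypeIV f t
  singular : coverMap '' reducibleFibreSingularPoints f = T
  isJacobian : IsJacobian f

/-! ### Invariance of these properties under automorphisms -/

theorem IsEquianharmonic.transport {h h' : K3 → P1} {α : K3 ≃ K3}
    {A : LinearMap.GeneralLinearGroup ℂ (Fin 2 → ℂ)} (tr : IsTransport h h' α A) {T : Set P2}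
    (hh : IsEquianharmonic h T) {g : P2 → P2} (hg : Function.Injective g)
    (hα : ∀ x, coverMap (α x) = g (coverMap x)) : IsEquianharmonic h' (g ⁻¹' T) where
  isEllipticFibration := tr.isEllipticFibration hh.isEllipticFibration
  smooth t ht := by
    have h1 := tr.symm.isSmoothFibre ht
    have h2 := tr.isEllipticCurve (hh.smooth _ h1)
    rwa [smul_inv_smul] at h2
  ncard := by
    rw [tr.setOf_isReducibleFibre, Set.ncard_image_of_injective _ (MulAction.injective A), hh.ncard]
  isTypeIV t ht := by
    have h2 := tr.isTypeIV (hh.isTypeIV _ (tr.symm.isReducibleFibre ht))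
    rwa [smul_inv_smul] at h2
  singular := by
    rw [tr.singularPoints, ← hh.singular]
    ext p
    constructor
    · rintro ⟨x, hx, rfl⟩
      exact ⟨α x, hx, hα x⟩
    · rintro ⟨y, hy, hyp⟩
      refine ⟨α.symm y, by simpa using hy, hg ?_⟩
      rw [← hα, α.apply_symm_apply, hyp]
  isJacobian := tr.isJacobian hh.isJacobian

theorem IsEquianharmonic.comp_coveringInvolution {h : K3 → P1} {T : Set P2}
    (hh : IsEquianharmonic h T) : IsEquianharmonic (h ∘ coveringInvolution) T :=
  hh.transport (isTransport_coveringInvolution h) (g := id) Function.injective_id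
    coverMap_coveringInvolution

/-- Changing the coordinate on the line leaves the singular points of the reducible fibres in place,
so the triangle is an invariant that separates fibrations of different index. -/
theorem IsEquianharmonic.eq_of_sameFibration {h h' : K3 → P1} {T T' : Set P2}
    (hh : IsEquianharmonic h T) (hh' : IsEquianharmonic h' T') (hs : SameFibration h h') :
    T = T' := by
  obtain ⟨A, hA⟩ := hs
  have tr : IsTransport h h' (Equiv.refl K3) A := ⟨isMorphism_id, isMorphism_id, hA⟩
  rw [← hh.singular, ← hh'.singular, tr.singularPoints]
  rfl

namespace RootData

variable (k : RootData)

/-! ### A section -/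

theorem secVec_ne_zero (κ : ℂ) {t : Fin 2 → ℂ} (ht : t ≠ 0) :
    k.secVec κ t ≠ 0 := by
  intro h
  have h0 : -3 * t 0 + (κ ^ 2 + κ + 1) * (k.r * t 1) = 0 := congrFun h 0
  have h1 : -3 * t 0 + (κ ^ 2 + k.ε * κ + k.ε ^ 2) * (k.r * t 1) = 0 := congrFun h 1
  have h2 : -3 * t 0 + (κ ^ 2 + k.ε ^ 2 * κ + k.ε) * (k.r * t 1) = 0 := congrFun h 2
  have hε := k.hε
  have h3 : k.r * t 1 = 0 := by
    -- Fourier inversion: the weights 1, ε, ε² isolate the component rt₁ of the transformed vector.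
    linear_combination (h0 + k.ε * h1 + k.ε ^ 2 * h2) / 3 - (-3 * t 0 + κ ^ 2 * (k.r * t 1)
      + κ * (k.r * t 1) * (k.ε ^ 2 - k.ε + 1) + 2 * (k.r * t 1) * (k.ε - 1)) / 3 * hε
  have ht1 : t 1 = 0 := (mul_eq_zero.1 h3).resolve_left k.r_ne_zero
  apply ht
  ext i
  fin_cases i
  · rw [h3] at h0
    change t 0 = 0
    linear_combination -h0 / 3
  · exact ht1

theorem sec_equation {κ : ℂ} (hκ : κ ^ 3 = -2) {t : Fin 2 → ℂ} (ht : t ≠ 0) :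
    k.secW κ t ^ 2 + sextic (k.secVec κ t) = 0 := by
  obtain ⟨e, he⟩ := exists_complement ht
  obtain ⟨h1, h2⟩ := (k.fibre_equations he).1 (k.sec_equations hκ t)
  rw [h2]
  exact k.wForm_equation he h1

theorem isJacobian_fib : IsJacobian k.fib := by
  obtain ⟨κ, hκ⟩ := IsAlgClosed.exists_pow_nat_eq (-2 : ℂ) (n := 3) (by norm_num)
  refine ⟨fun t => K3.point (k.secVec κ (HomogeneousCoordinates.rep t))
    (k.secW κ (HomogeneousCoordinates.rep t)) (k.secVec_ne_zero κ t.rep_nonzero)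
    (k.sec_equation hκ t.rep_nonzero), ?_, fun t => ?_⟩
  · let lin : ℂ → MvPolynomial (Fin 2) ℂ := fun c => C (-3) * X 0 + C c * (C k.r * X 1)
    let P : Fin 3 → MvPolynomial (Fin 2) ℂ := ![lin (κ ^ 2 + κ + 1),
      lin (κ ^ 2 + k.ε * κ + k.ε ^ 2), lin (κ ^ 2 + k.ε ^ 2 * κ + k.ε)]
    let R : MvPolynomial (Fin 2) ℂ :=
      C (-3 * k.r) * (lin (κ ^ 2) ^ 3 + C 5 * (C k.r * X 1) ^ 3)
    have hX : ∀ i : Fin 2, IsForm P1 (X i : MvPolynomial (Fin 2) ℂ) 1 :=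
      fun i => isForm_X (X := P1) i
    have hlin : ∀ c, IsForm P1 (lin c) 1 := fun c =>
      ((hX 0).C_mul _).add (((hX 1).C_mul _).C_mul _)
    have hlinv : ∀ c (y : P1), evalAt (lin c) y = -3 * HomogeneousCoordinates.rep y 0
        + c * (k.r * HomogeneousCoordinates.rep y 1) := by
      intro c y
      simp only [lin, evalAt_add, evalAt_mul, evalAt_C, evalAt_X]
    have hP : ∀ j, IsForm P1 (P j) 1 := by
      intro j
      fin_cases j <;> exact hlin _
    have hR : IsForm P1 R (1 * 3) :=
      (((hlin _).pow 3).add ((((hX 1).C_mul _).pow 3).C_mul _)).C_mul _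
    have hPv : ∀ y : P1, (fun j => evalAt (P j) y) = k.secVec κ (HomogeneousCoordinates.rep y) := by
      intro y
      ext j
      fin_cases j <;> exact hlinv _ y
    have hRv : ∀ y : P1, evalAt R y = k.secW κ (HomogeneousCoordinates.rep y) := by
      intro y
      simp only [R, secW, evalAt_add, evalAt_mul, evalAt_C, evalAt_pow, evalAt_X, hlinv]
    refine isMorphism_toK3 fun x => ⟨1, P, R, 0, 1, hP, hR, isForm_one, ?_, fun y _ => ⟨?_, ?_, ?_⟩⟩
    · rw [← C_1, evalAt_C]
      exact one_ne_zero
    · rw [hPv]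
      exact k.secVec_ne_zero κ y.rep_nonzero
    · rw [hPv, hRv]
      exact k.sec_equation hκ y.rep_nonzero
    · simp only [hPv, hRv]
  · conv_rhs => rw [← proj_mk_rep t]
    exact (k.fib_point_eq_iff _ _ _).2 (k.sec_equations hκ _)

/-! ### The fibres of the first fibration -/

/-- The cyclic shift permutes the three vertices, so the type of a singular fibre need only be
computed where the third coefficient vanishes. -/
theorem exists_cyclic_smul_fib : ∃ (m : HesseLift)
    (A : LinearMap.GeneralLinearGroup ℂ (Fin 2 → ℂ)),
    (∀ (v : Fin 3 → ℂ) i, (m.lin • v) i = v (1 + i)) ∧ ∀ p, k.fib (m • p) = A • k.fib p := by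
  let M := glOfMatrix !![0, 1, 0; 0, 0, 1; 1, 0, (0 : ℂ)] !![0, 0, 1; 1, 0, 0; 0, 1, 0] (by
    ext i j
    fin_cases i <;> fin_cases j <;> simp [Matrix.mul_apply, Fin.sum_univ_three])
  have hM : ∀ v : Fin 3 → ℂ, M • v = ![v 1, v 2, v 0] := by
    intro v
    rw [glOfMatrix_smul]
    ext i
    fin_cases i <;> simp [Matrix.mulVec, dotProduct, Fin.sum_univ_three]
  obtain ⟨m, hm⟩ := HesseLift.exists_of_smul (M := M) (a := 1) (b := 0) (c := 0) (d := 1)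
    (fun v => by rw [hM]; simp only [fermatCubic, Matrix.cons_val]; ring)
    (fun v => by rw [hM]; simp only [coordProd, Matrix.cons_val]; ring) (by norm_num)
  have hm' : ∀ (v : Fin 3 → ℂ) i, (m.lin • v) i = v (1 + i) := by
    intro v i
    rw [hm, hM]
    fin_cases i <;> rfl
  obtain ⟨A, hA⟩ := k.exists_smul_fib_of_cyclic (m := m) (a := 1) (s := 1)
    (fun _ => one_ne_zero) fun v i => by rw [hm', Pi.one_apply, one_mul]
  exact ⟨m, A, hm', hA⟩

theorem isTypeIV_of_vertex {p : K3} (i : Fin 3) (hp : ∀ l, l ≠ i → p.xyz l = 0) :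
    IsTypeIV k.fib (k.fib p) := by
  obtain ⟨m, A, hm, hA⟩ := k.exists_cyclic_smul_fib
  have hstep : ∀ p, IsTypeIV k.fib (k.fib (m • p)) → IsTypeIV k.fib (k.fib p) := by
    intro p hp
    have h1 := (HesseLift.isTransport_of_smul hA).isTypeIV hp
    rwa [hA, inv_smul_smul] at h1
  have hmove : ∀ (p : K3) (i : Fin 3), (∀ l, l ≠ 1 + i → p.xyz l = 0) →
      ∀ l, l ≠ i → (m • p).xyz l = 0 := by
    intro p i hp l hl
    obtain ⟨s, hs, h1, -⟩ := K3.exists_point (m.lin • p.xyz) (m.scalar * p.w)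
      ((smul_ne_zero_iff_ne _).2 p.xyz_ne) (m.equation p.equation)
    have h2 : (m.lin • p.xyz) l = s * (m • p).xyz l := h1 l
    rw [hm, hp _ fun h => hl (add_left_cancel h)] at h2
    exact (mul_eq_zero.1 h2.symm).resolve_left hs
  have h2 : ∀ p : K3, (∀ l, l ≠ 2 → p.xyz l = 0) → IsTypeIV k.fib (k.fib p) := by
    intro p hp
    obtain ⟨t, ht, e⟩ : ∃ t, ∃ ht : t ≠ 0, k.fib p = Projectivization.mk ℂ t ht :=
      ⟨_, _, (proj_mk_rep _).symm⟩
    obtain ⟨d, hd⟩ := exists_complement ht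
    rw [e]
    refine k.isTypeIV_of_coef ht ?_
    have h1 := ((k.fib_eq_iff' p ht hd).1 e).1
    rw [diagCubic, hp 0 (by decide), hp 1 (by decide)] at h1
    have hp2 : p.xyz 2 ≠ 0 := fun h => p.xyz_ne (by
      ext i
      fin_cases i
      exacts [hp 0 (by decide), hp 1 (by decide), h])
    have h3 : k.coef t 2 * p.xyz 2 ^ 3 = 0 := by linear_combination h1
    exact (mul_eq_zero.1 h3).resolve_right (pow_ne_zero 3 hp2)
  have h1 : ∀ p : K3, (∀ l, l ≠ 0 → p.xyz l = 0) → IsTypeIV k.fib (k.fib p) :=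
    fun p hp => hstep p (h2 _ (hmove p 2 hp))
  have h0 : ∀ p : K3, (∀ l, l ≠ 1 → p.xyz l = 0) → IsTypeIV k.fib (k.fib p) :=
    fun p hp => hstep p (h1 _ (hmove p 0 hp))
  fin_cases i
  exacts [h1 p hp, h0 p hp, h2 p hp]

theorem exists_fibre_vertex {t : Fin 2 → ℂ} (ht : t ≠ 0) {i : Fin 3} (hi : k.coef t i = 0) :
    ∃ p, k.fib p = Projectivization.mk ℂ t ht ∧ ∀ l, l ≠ i → p.xyz l = 0 := by
  obtain ⟨e, he⟩ := exists_complement ht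
  have hv : (Pi.single i 1 : Fin 3 → ℂ) ≠ 0 := by simp
  have hvc : diagCubic (k.coef t) (Pi.single i 1) = 0 := by
    fin_cases i <;> simpa [diagCubic] using hi
  have heq := k.wForm_equation he hvc
  obtain ⟨s, hs, h1, -⟩ := K3.exists_point _ _ hv heq
  refine ⟨_, (k.fib_point_eq_iff hv heq ht).2 ((k.fibre_equations he).2 ⟨hvc, rfl⟩),
    fun l hl => ?_⟩
  have h2 := h1 l
  rw [Pi.single_eq_of_ne hl] at h2
  exact (mul_eq_zero.1 h2.symm).resolve_left hs

theorem coef_eq_zero_of_vertex {p : K3} {t : Fin 2 → ℂ} (ht : t ≠ 0)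
    (hp : k.fib p = Projectivization.mk ℂ t ht) {i : Fin 3} (hi : ∀ l, l ≠ i → p.xyz l = 0) :
    k.coef t i = 0 := by
  obtain ⟨e, he⟩ := exists_complement ht
  have h1 := ((k.fib_eq_iff' p ht he).1 hp).1
  have hpi : p.xyz i ≠ 0 := fun h => p.xyz_ne (by
    ext l
    by_cases hl : l = i
    · rw [hl]
      exact h
    · exact hi l hl)
  have h3 : k.coef t i * p.xyz i ^ 3 = 0 := by
    rw [← h1, diagCubic]
    fin_cases i
    · simp [hi 1, hi 2]
    · simp [hi 0, hi 2]
    · simp [hi 0, hi 1]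
  exact (mul_eq_zero.1 h3).resolve_right (pow_ne_zero 3 hpi)

theorem isReducibleFibre_iff {t : Fin 2 → ℂ} (ht : t ≠ 0) :
    IsReducibleFibre k.fib (Projectivization.mk ℂ t ht) ↔ ∃ i, k.coef t i = 0 := by
  constructor
  · intro h
    by_contra! h1
    exact k.isIrreducible_fibre ht h1 h
  · rintro ⟨i, hi⟩
    obtain ⟨p, hp, hpi⟩ := k.exists_fibre_vertex ht hi
    rw [← hp]
    exact (k.isTypeIV_of_vertex i hpi).isReducibleFibre

theorem isTypeIV_of_isReducibleFibre {t : P1} (h : IsReducibleFibre k.fib t) :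
    IsTypeIV k.fib t := by
  obtain ⟨u, hu, rfl⟩ : ∃ u, ∃ hu : u ≠ 0, t = Projectivization.mk ℂ u hu :=
    ⟨_, _, (proj_mk_rep _).symm⟩
  obtain ⟨i, hi⟩ := (k.isReducibleFibre_iff _).1 h
  obtain ⟨p, hp, hpi⟩ := k.exists_fibre_vertex hu hi
  rw [← hp]
  exact k.isTypeIV_of_vertex i hpi

/-- The product of the three quadratic coefficients collapses to t₀⁶ + t₁⁶, so the reducible fibres
lie over the sixth roots of −1. -/
theorem exists_coef_eq_zero_iff (t : Fin 2 → ℂ) :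
    (∃ i, k.coef t i = 0) ↔ t 0 ^ 6 + t 1 ^ 6 = 0 := by
  have hε := k.hε
  have hr := k.hr
  have h : k.coef t 0 * k.coef t 1 * k.coef t 2 = t 0 ^ 6 + t 1 ^ 6 := by
    simp only [coef, Matrix.cons_val]
    generalize k.ε = ε at hε
    generalize k.r = r at hr
    generalize t 0 = l, t 1 = m
    grind
  rw [← h, mul_eq_zero, mul_eq_zero]
  simp [Fin.exists_fin_succ, or_assoc]

theorem ncard_isReducibleFibre : {t | IsReducibleFibre k.fib t}.ncard = 6 := by
  classical
  have hne : ∀ l : ℂ, ![l, 1] ≠ 0 := fun l h => one_ne_zero (congrFun h 1)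
  have hset : {t | IsReducibleFibre k.fib t} = (fun l : ℂ => Projectivization.mk ℂ ![l, 1] (hne l)) ''
      ((Polynomial.nthRoots 6 (-1 : ℂ)).toFinset : Set ℂ) := by
    ext t
    constructor
    · intro h
      change IsReducibleFibre k.fib t at h
      rw [← proj_mk_rep t, isReducibleFibre_iff, exists_coef_eq_zero_iff] at h
      have h1 : HomogeneousCoordinates.rep t 1 ≠ 0 := by
        intro h1
        rw [h1] at h
        refine t.rep_nonzero ?_
        ext i
        fin_cases i
        · change HomogeneousCoordinates.rep t 0 = 0
          exact pow_eq_zero_iff (n := 6) (by norm_num) |>.1 (by linear_combination h)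
        · exact h1
      refine ⟨HomogeneousCoordinates.rep t 0 / HomogeneousCoordinates.rep t 1, ?_, ?_⟩
      · rw [Finset.mem_coe, Multiset.mem_toFinset, Polynomial.mem_nthRoots (by norm_num), div_pow,
          div_eq_iff (pow_ne_zero 6 h1)]
        linear_combination h
      · conv_rhs => rw [← proj_mk_rep t]
        rw [P1_mk_eq_iff]
        simp only [Matrix.cons_val]
        field_simp
    · rintro ⟨l, hl, rfl⟩
      rw [Finset.mem_coe, Multiset.mem_toFinset, Polynomial.mem_nthRoots (by norm_num)] at hl
      change IsReducibleFibre _ _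
      rw [isReducibleFibre_iff, exists_coef_eq_zero_iff]
      simp [hl]
  have hinj : Function.Injective fun l : ℂ => (Projectivization.mk ℂ ![l, 1] (hne l) : P1) := by
    intro l l' h
    have := P1_mk_eq_iff.1 h
    simpa using this
  have hζ := Complex.isPrimitiveRoot_exp 6 (by norm_num)
  rw [hset, Set.ncard_image_of_injective _ hinj, Set.ncard_coe_finset, Multiset.toFinset_card_of_nodup
    (hζ.nthRoots_nodup (by norm_num)), hζ.card_nthRoots, if_pos]
  exact IsAlgClosed.exists_pow_nat_eq _ (by norm_num)

theorem isSmoothFibre_of_coef {t : Fin 2 → ℂ} (ht : t ≠ 0) (hc : ∀ i, k.coef t i ≠ 0) :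
    IsSmoothFibre k.fib (Projectivization.mk ℂ t ht) := by
  intro x hx
  obtain ⟨i, hi⟩ := Function.ne_iff.1 x.xyz_ne
  exact k.fibreSmoothAt ht hx (mul_ne_zero (hc i) hi)

theorem coef_ne_zero_of_isSmoothFibre {t : Fin 2 → ℂ} (ht : t ≠ 0)
    (h : IsSmoothFibre k.fib (Projectivization.mk ℂ t ht)) (i : Fin 3) : k.coef t i ≠ 0 := by
  intro hi
  obtain ⟨p, hp, hpi⟩ := k.exists_fibre_vertex ht hi
  exact k.not_fibreSmoothAt ht hp hi hpi (h p hp)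

theorem isEllipticFibration_fib : IsEllipticFibration k.fib where
  morphism := k.isMorphism_fib
  surjective t := by
    obtain ⟨s, -, hs⟩ := k.isJacobian_fib
    exact ⟨s t, hs t⟩
  generic := by
    refine (Set.finite_of_ncard_pos (s := {t | IsReducibleFibre k.fib t})
      (by rw [ncard_isReducibleFibre]; norm_num)).subset fun t ht => ?_
    by_contra h
    change ¬ IsReducibleFibre k.fib t at h
    apply ht
    rw [← proj_mk_rep t] at h ⊢
    rw [isReducibleFibre_iff] at h
    push Not at h
    exact ⟨k.isSmoothFibre_of_coef _ h, 0, k.isEllipticCurve_fibre _ h⟩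

theorem mem_singularPoints_iff (x : K3) :
    x ∈ reducibleFibreSingularPoints k.fib ↔ IsVertex x.xyz := by
  obtain ⟨t, ht, e⟩ : ∃ t, ∃ ht : t ≠ 0, k.fib x = Projectivization.mk ℂ t ht :=
    ⟨_, _, (proj_mk_rep _).symm⟩
  change IsReducibleFibre k.fib (k.fib x) ∧ _ ↔ _
  rw [e, isReducibleFibre_iff]
  constructor
  · rintro ⟨⟨i, hi⟩, hs⟩
    refine ⟨i, fun l hl => ?_⟩
    by_contra h
    exact hs (k.fibreSmoothAt ht e
      (mul_ne_zero (fun h0 => hl (k.coef_unique ht h0 hi)) h))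
  · rintro ⟨i, hi⟩
    have h := k.coef_eq_zero_of_vertex ht e hi
    exact ⟨⟨i, h⟩, k.not_fibreSmoothAt ht e h hi⟩

theorem image_singularPoints :
    coverMap '' reducibleFibreSingularPoints k.fib = triangleVertices k.ε 0 := by
  have h0 : ∀ v : Fin 3 → ℂ, k.liftLin 0 • v = v := fun v => one_smul _ v
  ext p
  constructor
  · rintro ⟨x, hx, rfl⟩
    rw [mem_singularPoints_iff] at hx
    exact (k.mk_mem_triangleVertices_iff x.xyz_ne 0).2 (by rwa [h0])
  · intro hp
    rw [mem_triangleVertices_iff, h0] at hp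
    obtain ⟨w, hw⟩ := IsAlgClosed.exists_pow_nat_eq (-sextic (HomogeneousCoordinates.rep p))
      (n := 2) (by norm_num)
    have hw' : w ^ 2 + sextic (HomogeneousCoordinates.rep p) = 0 := by rw [hw, neg_add_cancel]
    refine ⟨K3.point _ w p.rep_nonzero hw', ?_, ?_⟩
    · rw [mem_singularPoints_iff]
      obtain ⟨s, hs, h1, -⟩ := K3.exists_point _ w p.rep_nonzero hw'
      exact (isVertex_scale hs h1).1 hp
    · rw [coverMap_point]
      exact proj_mk_rep p

theorem isEquianharmonic_fib : IsEquianharmonic k.fib (triangleVertices k.ε 0) where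
  isEllipticFibration := k.isEllipticFibration_fib
  smooth t ht := by
    rw [← proj_mk_rep t] at ht ⊢
    exact k.isEllipticCurve_fibre _ (k.coef_ne_zero_of_isSmoothFibre _ ht)
  ncard := k.ncard_isReducibleFibre
  isTypeIV _ ht := k.isTypeIV_of_isReducibleFibre ht
  singular := k.image_singularPoints
  isJacobian := k.isJacobian_fib

/-! ### The eight fibrations -/

theorem isEquianharmonic_lift (i : Fin 4) :
    IsEquianharmonic (fun p => k.fib (k.lift i • p)) (triangleVertices k.ε i) := by
  have h := k.isEquianharmonic_fib.transport ((k.lift i).isTransport k.fib)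
    (g := fun p => (k.lift i).lin • p) (MulAction.injective _) (k.lift i).coverMap_smul
  convert h using 1
  ext p
  exact (k.smul_mem_triangleVertices_iff i p).symm

/-- The fibration differs from its composite with the covering involution. -/
theorem not_sameFibration_coveringInvolution :
    ¬ SameFibration k.fib (k.fib ∘ coveringInvolution) := by
  rintro ⟨A, hA⟩
  have hε := k.hε
  obtain ⟨a, ha⟩ := IsAlgClosed.exists_pow_nat_eq (-k.ε ^ 2) (n := 3) (by norm_num)
  obtain ⟨b, hb⟩ := IsAlgClosed.exists_pow_nat_eq (-k.ε) (n := 3) (by norm_num)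
  have hU : ∀ v : Fin 3 → ℂ, k.U v = v 0 ^ 3 + k.ε * v 1 ^ 3 + k.ε ^ 2 * v 2 ^ 3 := by
    intro v
    simp [U, diagCubic]
  have hV : ∀ v : Fin 3 → ℂ, k.V v = v 0 ^ 3 + k.ε ^ 2 * v 1 ^ 3 + k.ε * v 2 ^ 3 := by
    intro v
    simp [V, diagCubic]
  have hS : ∀ v : Fin 3 → ℂ, S v = v 0 ^ 3 + v 1 ^ 3 + v 2 ^ 3 := by
    intro v
    simp [S, diagCubic]
  have ht : (![0, 1] : Fin 2 → ℂ) ≠ 0 := fun h => one_ne_zero (congrFun h 1)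
  -- Where V = 0, the point with w = rS lies in the fibre over [0 : 1]. The involution changes w to
  -- −rS, and the first fibre equation locates the image.
  have key : ∀ v : Fin 3 → ℂ, v ≠ 0 → k.V v = 0 → ∃ p, k.fib p = Projectivization.mk ℂ ![0, 1] ht ∧
      ∀ (u : Fin 2 → ℂ) (hu : u ≠ 0), k.fib (coveringInvolution p) = Projectivization.mk ℂ u hu →
        u 1 * (-2 * k.r * S v) - 2 * u 0 * k.U v = 0 := by
    intro v hv hVv
    have heq : (k.r * S v) ^ 2 + sextic v = 0 := by
      rw [sextic_eq, hVv]
      linear_combination S v ^ 2 * k.hr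
    refine ⟨K3.point v _ hv heq, (k.fib_point_eq_iff hv heq ht).2 ?_, fun u hu h => ?_⟩
    · simp [E₁, E₂, hVv]
    · rw [coveringInvolution_point, fib_point_eq_iff] at h
      have h1 := h.1
      unfold E₁ at h1
      linear_combination h1
  -- For this point and the next the values of U are opposite and those of S add up to 3. The two
  -- conditions on the image fibre therefore force u = 0.
  obtain ⟨p, hp, hp'⟩ := key ![a, 1, 0] (fun h => one_ne_zero (congrFun h 1)) (by
    rw [hV]
    simp [ha])
  obtain ⟨q, hq, hq'⟩ := key ![b, 0, 1] (fun h => one_ne_zero (congrFun h 2)) (by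
    rw [hV]
    simp [hb])
  obtain ⟨u, hu, e⟩ : ∃ u, ∃ hu : u ≠ 0,
      A • Projectivization.mk ℂ ![0, 1] ht = Projectivization.mk ℂ u hu :=
    ⟨_, _, (proj_mk_rep _).symm⟩
  have h1 := hp' u hu ((hA p).trans (by rw [hp, e]))
  have h2 := hq' u hu ((hA q).trans (by rw [hq, e]))
  rw [hS, hU] at h1 h2
  simp only [Matrix.cons_val, ha, hb] at h1 h2
  have h3 : u 1 = 0 := by
    refine (mul_eq_zero.1 (?_ : k.r * u 1 = 0)).resolve_left k.r_ne_zero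
    linear_combination -(h1 + h2) / 6 + k.r * u 1 / 3 * hε
  have h4 : (k.ε ^ 2 - k.ε) * u 0 = 0 := by
    rw [h3] at h1
    linear_combination h1 / 2
  apply hu
  ext i
  fin_cases i
  exacts [(mul_eq_zero.1 h4).resolve_left k.ε_sq_sub_ne_zero, h3]

/-- The triangles force equal indices. The lifts commute with the involution, so the case of equal
indices is carried back to `fib`. -/
theorem not_sameFibration_lift (i j : Fin 4) : ¬ SameFibration (fun p => k.fib (k.lift i • p))
    ((fun p => k.fib (k.lift j • p)) ∘ coveringInvolution) := by
  intro h
  have hij : i = j := k.triangleVertices_injective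
    ((k.isEquianharmonic_lift i).eq_of_sameFibration
      (k.isEquianharmonic_lift j).comp_coveringInvolution h)
  subst hij
  obtain ⟨A, hA⟩ := h
  refine k.not_sameFibration_coveringInvolution ⟨A, fun x => ?_⟩
  have h1 := hA ((k.lift i)⁻¹ • x)
  simp only [Function.comp_apply, HesseLift.smul_coveringInvolution, smul_inv_smul] at h1
  exact h1

end RootData

end

theorem mainTheorem7 (ε : ℂ) (hε : IsPrimitiveRoot ε 3) :
    ∃ ρ : hessianGroup →* Equiv.Perm K3, IsHessianAction ρ ∧
    ∃ h h' : Fin 4 → K3 → P1,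
      -- the eight maps are elliptic fibrations, and no two of them are the same fibration
      (∀ i, IsEllipticFibration (h i) ∧ IsEllipticFibration (h' i)) ∧
      (∀ i j, ¬ SameFibration (h i) (h' j)) ∧
      (∀ i j, i ≠ j → ¬ SameFibration (h i) (h j) ∧ ¬ SameFibration (h' i) (h' j)) ∧
      -- the covering involution exchanges the members of each pair
      (∀ i, h' i = h i ∘ coveringInvolution ∧ h i = h' i ∘ coveringInvolution) ∧
      -- the Hessian group acts on the four fibrations, and transitively
      (∀ g i, ∃ j, SameFibration (h i ∘ ρ g) (h j)) ∧
      (∀ i j, ∃ g, SameFibration (h i ∘ ρ g) (h j)) ∧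
      ∀ i, ∀ f : K3 → P1, f = h i ∨ f = h' i →
        -- smooth fibres
        (∀ t, IsSmoothFibre f t → IsEllipticCurveWithJ (f ⁻¹' {t}) 0) ∧
        -- reducible fibres
        {t | IsReducibleFibre f t}.ncard = 6 ∧
        (∀ t, IsReducibleFibre f t → IsTypeIV f t) ∧
        coverMap '' reducibleFibreSingularPoints f = triangleVertices ε i ∧
        -- a section
        IsJacobian f := by
  have hε' : ε ^ 2 + ε + 1 = 0 := by
    have h1 := hε.geom_sum_eq_zero (by norm_num)
    simp only [Finset.sum_range_succ, Finset.sum_range_zero] at h1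
    linear_combination h1
  obtain ⟨r, hr⟩ := IsAlgClosed.exists_pow_nat_eq (3 : ℂ) (n := 2) (by norm_num)
  let k : RootData := ⟨ε, r, hε', hr⟩
  have hh := k.isEquianharmonic_lift
  have hh' := fun i => (hh i).comp_coveringInvolution
  refine ⟨hessianAction hε', isHessianAction hε', fun i p => k.fib (k.lift i • p),
    fun i => (fun p => k.fib (k.lift i • p)) ∘ coveringInvolution,
    fun i => ⟨(hh i).isEllipticFibration, (hh' i).isEllipticFibration⟩, k.not_sameFibration_lift,
    fun i j hij => ⟨fun h => hij (k.triangleVertices_injective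
      ((hh i).eq_of_sameFibration (hh j) h)),
      fun h => hij (k.triangleVertices_injective
      ((hh' i).eq_of_sameFibration (hh' j) h))⟩,
    fun i => ⟨rfl, ?_⟩, fun g i => ?_, fun i j => ?_, ?_⟩
  · rw [Function.comp_assoc, coveringInvolution_involutive.comp_self, Function.comp_id]
  · obtain ⟨m, rfl⟩ := toHessian_surjective hε' g
    obtain ⟨j, A, hA⟩ := k.exists_smul_fib_lift i m
    refine ⟨j, A, fun p => ?_⟩
    rw [Function.comp_apply, hessianAction_toHessian]
    exact hA p
  -- Both fibrations are pull-backs of the same map, so this quotient of lifts carries one to the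
  -- other with no change of coordinate on the line.
  · refine ⟨HesseLift.toHessian ((k.lift i)⁻¹ * k.lift j), 1, fun p => ?_⟩
    rw [one_smul, Function.comp_apply, hessianAction_toHessian, mul_smul]
    beta_reduce
    rw [smul_inv_smul]
  · rintro i f (rfl | rfl)
    · exact ⟨(hh i).smooth, (hh i).ncard, (hh i).isTypeIV, (hh i).singular, (hh i).isJacobian⟩
    · exact ⟨(hh' i).smooth, (hh' i).ncard, (hh' i).isTypeIV, (hh' i).singular,
        (hh' i).isJacobian⟩
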